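/- **The model.** $N$ threads with identifiers $1,\dots,N$ run the Dynamic Elimination-Combining Stack algorithm (DECS) on shared memory. A thread without a pending operation may at any of its steps invoke `push(d)` or `pop()`, or do nothing. The shared variables are the pointer `CentralStack` to a linked list of cells (fields `data`, `next`), initially null, and arrays `collision[1..N]` of thread identifiers, initially EMPTY, and `location[1..N]` of pointers, initially null. Each operation is represented by its own freshly allocated record, with the fields `id` (its thread), `op` (PUSH or POP), `length` (initially $1$), `cStatus` (initially INIT), `cell` (for a push, a fresh cell containing the data and next pointer null), `next` (initially null) and `last` (initially the record itself). The *list* of an operation is the linked list that starts at its record. An execution is an infinite sequence of atomic steps, each executing one pseudo-code line of one thread, and starts with the empty stack. Memory is not reused, and the choices of `randomIndex()` are arbitrary. It is *fair* if every thread is scheduled infinitely often. *The algorithm.* An operation $m$ repeats iterations until it returns. An iteration first executes `cMultiPop(m)` or `cMultiPush(m)`, and if this returns false, `collide(m)`; the operation returns as soon as one of them returns true. - `cMultiPop(m)`: read `top = CentralStack`. If it is null, then for each record of the list of $m$ in turn set `cell = EMPTY_CELL` and then `cStatus = FINISHED`, and return true. Otherwise follow `next` pointers from `top` to the cell `nTop`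 that is `m.length` cells further (or null if there are fewer cells), and execute `CAS(CentralStack, top, nTop)`. If it fails, return false. If it succeeds, give the removed cells to the records of the list in order (`EMPTY_CELL` when they are exhausted), setting `cStatus = FINISHED` and unlinking the record for each one after $m$, and return true. - `cMultiPush(m)`: read `top = CentralStack`, set `m.last.cell.next = top`, and execute `CAS(CentralStack, top, m.cell)`. If it fails, return false. If it succeeds, set `cStatus = FINISHED` for, and unlink, each record after $m$ in its list, and return true. - `collide(m)` by thread $i$: set `location[i] = m`; choose an index $j$; repeat `him = collision[j]`, `CAS(collision[j], him, i)` until the CAS succeeds. If `him` is not EMPTY, read $p$ = `location[him]`; if $p$ is not null, `p.id` $\neq i$ and `p.id = him`, then execute `CAS(location[i], m, null)` and return `activeCollide(m,p)` if it succeeds and `passiveCollide(m)` if it fails. In all other cases wait for a finite time and execute `CAS(location[i], m, null)`; return `passiveCollide(m)` if it fails, and false if it succeeds. - `activeCollide(m,p)`: execute `CAS(location[p.id], p, m)`; if it fails, return false. If `m.op = p.op`, *combine*: append the list of $p$ to that of $m$ (for pushes also the list of cells), update `m.last` and `m.length`, and return false. Otherwise *eliminate*: walk along both lists simultaneously until one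 of them ends; at each position copy the cell of the push to the pop, set `cStatus = FINISHED` in both records and decrement `m.length` and `p.length`. If a residue of one list is left, give the remaining length and the `last` pointer of that list to the first record of the residue and set its `cStatus` to RETRY. Return true. - `passiveCollide(m)` by thread $i$: read $a$ = `location[i]`, set `location[i]` to null. If `a.op` $\neq$ `m.op`, a pop copies the cell of $a$, and true is returned. Otherwise await `m.cStatus` $\neq$ INIT; if it is FINISHED return true, else reset it to INIT and return false. *Terminology.* The linearization points are: the reading of `CentralStack = null` in `cMultiPop` and the successful CAS on `CentralStack` in `cMultiPop` and `cMultiPush`, for all operations in the list of $m$; and the successful CAS of `activeCollide` when the kinds differ, for all operations at positions that occur in both lists. An operation is *waiting* if its thread executes the await statement and its `cStatus` is INIT. *Delegates*: a newly invoked operation is its own delegate; when the CAS of `activeCollide(m,p)` succeeds and both have the same kind, $m$ replaces $p$ as the delegate of all operations that had the delegate $p$; when RETRY is written to the first operation $h$ of the residue of a list with first operation $s$, $h$ replaces $s$ as the delegate of the operations of the residue. **Theorem.** DECS is deadlock-free. More precisely, in every fair execution: 1. Whenever some operation is pending, some operation completes (returns) at that time or later. 2. In each iteration made by any operation, at a step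 of the execution within this iteration, some operation that is pending at that time is linearized for the first time. 3. At each time each waiting operation $r$ has exactly one delegate $d$; moreover, $d\neq r$ and $d$ is not waiting. At a step at which $r$ is linearized, $d$ is linearized too. If $d$ is linearized at a step at which $r$ is waiting with delegate $d$, then either $r$ is also linearized at this step and the thread that made the step later signals FINISHED to $r$, or $r$ is not linearized at this step and this thread later signals RETRY to $r$ or to another operation, which thereby becomes the delegate of $r$. (To signal $v$ to $r$ is to change `r.cStatus` from INIT to $v$.) 4. A thread that is at the await statement and has been signalled is released: if its operation has been signalled FINISHED, the operation eventually completes, and if it has been signalled RETRY, it eventually begins a new iteration as its own delegate. 5. Every waiting operation is eventually signalled FINISHED or RETRY, unless infinitely many operations complete in the execution. -/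

import Mathlib

namespace DECS

/-- The two kinds of stack operations. -/
inductive Kind
  | push
  | pop
  deriving DecidableEq

/-- The values of the field `cStatus`. -/
inductive Status
  | init
  | finished
  | retry
  deriving DecidableEq

/-- A cell of the linked list that represents the stack. Pointers are natural numbers, and the null
pointer is `none`. -/
structure Cell (D : Type*) where
  data : Option D
  next : Option ℕ

/-- The address of the distinguished cell `EMPTY_CELL`, which carries no data. -/
def emptyCell : ℕ := 0

/-- A `multiOp` structure. There are `N` threads, and a thread identifier is an element of `Fin N`.
The fields `id` and `op` are never written after the initialization. -/
structure MultiOp (N : ℕ) where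
  id : Fin N
  op : Kind
  length : ℤ
  cStatus : Status
  cell : Option ℕ
  next : Option ℕ
  last : ℕ

/-- Program counters together with the local variables. A constructor stands for the pseudo-code
line (or lines) that the thread executes next; `m` is always the address of the `multiOp` structure
of the operation that the thread is performing (`mOp`, and also `aInf` in `activeCollide`, `combine`
and `multiEliminate`, and `pInf` in `passiveCollide`). -/
inductive PC (N : ℕ)
  /-- No operation is in progress. -/
  | idle
  /-- `cMultiPop`: top = CentralStack; if top = null -/
  | popTop (m : ℕ)
  /-- mOp.cell = EMPTY_CELL, where the moving variable `mOp` is `cur` -/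
  | popEmptyCell (m cur : ℕ)
  /-- mOp.cStatus = FINISHED -/
  | popEmptyStatus (m cur : ℕ)
  /-- mOp = mOp.next; until mOp = null -/
  | popEmptyNext (m cur : ℕ)
  /-- nTop = top.next; m = 1 -/
  | popInitNext (m top : ℕ)
  /-- while nTop is not null and m < mOp.length (the counter `m` is `k` here) -/
  | popLoop (m top : ℕ) (nTop : Option ℕ) (k : ℤ)
  /-- nTop = nTop.next, m++ -/
  | popIncr (m top nTop : ℕ) (k : ℤ)
  /-- if CAS(&CentralStack, top, nTop) -/
  | popCas (m top : ℕ) (nTop : Option ℕ)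
  /-- mOp.cell = top -/
  | popOwnCell (m top : ℕ)
  /-- top = top.next -/
  | popOwnTop (m top : ℕ)
  /-- while mOp.next is not null -/
  | popWhile (m : ℕ) (top : Option ℕ)
  /-- mOp.next.cell = EMPTY_CELL if top is null, and mOp.next.cell = top otherwise -/
  | popGiveCell (m : ℕ) (top : Option ℕ)
  /-- top = top.next -/
  | popGiveTop (m top : ℕ)
  /-- mOp.next.cStatus = FINISHED -/
  | popStatus (m : ℕ) (top : Option ℕ)
  /-- mOp.next = mOp.next.next -/
  | popUnlink (m : ℕ) (top : Option ℕ)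
  /-- `cMultiPush`: top = CentralStack -/
  | pushTop (m : ℕ)
  /-- mOp.last.cell.next = top -/
  | pushSetLast (m : ℕ) (top : Option ℕ)
  /-- if CAS(&CentralStack, top, mOp.cell) -/
  | pushCas (m : ℕ) (top : Option ℕ)
  /-- while mOp.next is not null -/
  | pushWhile (m : ℕ)
  /-- mOp.next.cStatus = FINISHED -/
  | pushStatus (m : ℕ)
  /-- mOp.next = mOp.next.next -/
  | pushUnlink (m : ℕ)
  /-- `collide`: location[id] = mOp -/
  | announce (m : ℕ)
  /-- index = randomIndex() -/
  | getIndex (m : ℕ)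
  /-- him = collision[index] -/
  | getHim (m : ℕ) (index : Fin N)
  /-- while CAS(&collision[index], him, id) = false; if him is not EMPTY -/
  | casCollision (m : ℕ) (index : Fin N) (him : Option (Fin N))
  /-- oInfo = location[him]; if oInfo is not null, oInfo.id is not id, and oInfo.id = him -/
  | getInfo (m : ℕ) (him : Fin N)
  /-- if CAS(&location[id], mOp, null) = true -/
  | casLocation (m oInfo : ℕ)
  /-- wait() -/
  | delay (m : ℕ)
  /-- if CAS(&location[id], mOp, null) = false, after the call of wait -/
  | casLocationDelayed (m : ℕ)
  /-- `activeCollide`: if CAS(&location[pInf.id], pInf, aInf); if aInf.op = pInf.op -/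
  | activeCas (m p : ℕ)
  /-- `combine`: aInf.last.cell.next = pInf.cell -/
  | combineCells (m p : ℕ)
  /-- aInf.last.next = pInf -/
  | combineNext (m p : ℕ)
  /-- aInf.last = pInf.last -/
  | combineLast (m p : ℕ)
  /-- aInf.length = aInf.length + pInf.length -/
  | combineLength (m p : ℕ)
  /-- `multiEliminate`, with aCurr = `a` and pCurr = `q`:
  aCurr.cell = pCurr.cell if aInf.op = POP, and pCurr.cell = aCurr.cell otherwise -/
  | elimCell (m p a q : ℕ)
  /-- aCurr.cStatus = FINISHED -/
  | elimStatusA (m p a q : ℕ)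
  /-- pCurr.cStatus = FINISHED -/
  | elimStatusP (m p a q : ℕ)
  /-- aInf.length = aInf.length - 1 -/
  | elimLengthA (m p a q : ℕ)
  /-- pInf.length = pInf.length - 1 -/
  | elimLengthP (m p a q : ℕ)
  /-- aCurr = aCurr.next -/
  | elimNextA (m p a q : ℕ)
  /-- pCurr = pCurr.next; until aCurr = null or pCurr = null; then the null tests of the residue -/
  | elimNextP (m p : ℕ) (a : Option ℕ) (q : ℕ)
  /-- xCurr.length = xInf.length, where x is a or p, xInf is `src` and xCurr is `h` -/
  | residueLength (m src h : ℕ)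
  /-- xCurr.last = xInf.last -/
  | residueLast (m src h : ℕ)
  /-- xCurr.cStatus = RETRY -/
  | residueRetry (m src h : ℕ)
  /-- `passiveCollide`: aInf = location[pInf.id] -/
  | passiveGet (m : ℕ)
  /-- location[pInf.id] = null; then the tests of pInf.op -/
  | passiveReset (m a : ℕ)
  /-- pInf.cell = aInf.cell -/
  | passiveCell (m a : ℕ)
  /-- await(pInf.cStatus is not INIT) -/
  | spin (m : ℕ)
  /-- if pInf.cStatus = FINISHED -/
  | checkStatus (m : ℕ)
  /-- pInf.cStatus = INIT -/
  | setInit (m : ℕ)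
  /-- the return statement of `push` or `pop` -/
  | ret (m : ℕ)

/-- The operation that a thread is performing, named by the address of its `multiOp` structure. -/
def PC.op? {N : ℕ} : PC N → Option ℕ
  | .idle => none
  | .popTop m | .popEmptyCell m _ | .popEmptyStatus m _ | .popEmptyNext m _ | .popInitNext m _
  | .popLoop m _ _ _ | .popIncr m _ _ _ | .popCas m _ _ | .popOwnCell m _ | .popOwnTop m _
  | .popWhile m _ | .popGiveCell m _ | .popGiveTop m _ | .popStatus m _ | .popUnlink m _
  | .pushTop m | .pushSetLast m _ | .pushCas m _ | .pushWhile m | .pushStatus m | .pushUnlink m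
  | .announce m | .getIndex m | .getHim m _ | .casCollision m _ _ | .getInfo m _
  | .casLocation m _ | .delay m | .casLocationDelayed m | .activeCas m _ | .combineCells m _
  | .combineNext m _ | .combineLast m _ | .combineLength m _ | .elimCell m _ _ _
  | .elimStatusA m _ _ _ | .elimStatusP m _ _ _ | .elimLengthA m _ _ _ | .elimLengthP m _ _ _
  | .elimNextA m _ _ _ | .elimNextP m _ _ _ | .residueLength m _ _ | .residueLast m _ _
  | .residueRetry m _ _ | .passiveGet m | .passiveReset m _ | .passiveCell m _ | .spin m
  | .checkStatus m | .setInit m | .ret m => some m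

/-- Configurations: the shared memory, and the program counter of each thread. Memory is allocated
at fresh addresses only (`numOps` and `numCells` are the next free ones). `out` holds the value
returned by the last completed operation of each thread (`none` for "empty" and for a push). -/
structure State (N : ℕ) (D : Type*) where
  ops : ℕ → MultiOp N
  numOps : ℕ
  cells : ℕ → Cell D
  numCells : ℕ
  centralStack : Option ℕ
  collision : Fin N → Option (Fin N)
  location : Fin N → Option ℕ
  pc : Fin N → PC N
  out : Fin N → Option D

namespace State

variable {N : ℕ} {D : Type*}

/-- Initially the stack is empty, both arrays are empty, and no operation is in progress. -/
def IsInitial (s : State N D) : Prop :=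
  s.numOps = 0 ∧ s.numCells = 1 ∧ s.cells emptyCell = ⟨none, none⟩ ∧ s.centralStack = none ∧
  (∀ i, s.collision i = none) ∧ (∀ i, s.location i = none) ∧ (∀ i, s.pc i = .idle)

/-- Thread `i` proceeds to `c`. -/
def goto (s : State N D) (i : Fin N) (c : PC N) : State N D :=
  { s with pc := Function.update s.pc i c }

/-- Modify the `multiOp` structure at address `r`. -/
def modOp (s : State N D) (r : ℕ) (f : MultiOp N → MultiOp N) : State N D :=
  { s with ops := Function.update s.ops r (f (s.ops r)) }

/-- Write the field `next` of the cell at address `c`. -/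
def setCellNext (s : State N D) (c : ℕ) (x : Option ℕ) : State N D :=
  { s with cells := Function.update s.cells c { s.cells c with next := x } }

/-- Write an entry of the array `location`. -/
def setLocation (s : State N D) (j : Fin N) (x : Option ℕ) : State N D :=
  { s with location := Function.update s.location j x }

/-- Thread `i` begins an iteration of the main loop of `push` or `pop`. -/
def startLoop (s : State N D) (i : Fin N) (m : ℕ) : State N D :=
  match (s.ops m).op with
  | .push => s.goto i (.pushTop m)
  | .pop => s.goto i (.popTop m)

/-- The invocation of `push(d)` by thread `i`, including `initMultiOp(d)`. -/
def invokePush (s : State N D) (i : Fin N) (d : D) : State N D :=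
  { s with
    ops := Function.update s.ops s.numOps
      { id := i, op := .push, length := 1, cStatus := .init, cell := some s.numCells,
        next := none, last := s.numOps }
    numOps := s.numOps + 1
    cells := Function.update s.cells s.numCells ⟨some d, none⟩
    numCells := s.numCells + 1
    pc := Function.update s.pc i (.pushTop s.numOps) }

/-- The invocation of `pop()` by thread `i`, including `initMultiOp()`. -/
def invokePop (s : State N D) (i : Fin N) : State N D :=
  { s with
    ops := Function.update s.ops s.numOps
      { id := i, op := .pop, length := 1, cStatus := .init, cell := none,
        next := none, last := s.numOps }
    numOps := s.numOps + 1
    pc := Function.update s.pc i (.popTop s.numOps) }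

/-- The value returned by the operation `m`. -/
def returnValue (s : State N D) (m : ℕ) : Option D :=
  match (s.ops m).op with
  | .push => none
  | .pop => (s.ops m).cell.bind fun c => (s.cells c).data

/-- One atomic step of thread `i` leads from `s` to `s'`. A thread without an operation may invoke
an arbitrary operation or do nothing; the index chosen by `randomIndex()` is arbitrary; a thread that
would dereference a null pointer is stuck. -/
def Step (i : Fin N) (s s' : State N D) : Prop :=
  match s.pc i with
  | .idle => s' = s ∨ (∃ d, s' = s.invokePush i d) ∨ s' = s.invokePop i
  -- cMultiPop
  | .popTop m => s' = match s.centralStack with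
    | none => s.goto i (.popEmptyCell m m)
    | some top => s.goto i (.popInitNext m top)
  | .popEmptyCell m cur =>
    s' = (s.modOp cur fun x => { x with cell := some emptyCell }).goto i (.popEmptyStatus m cur)
  | .popEmptyStatus m cur =>
    s' = (s.modOp cur fun x => { x with cStatus := .finished }).goto i (.popEmptyNext m cur)
  | .popEmptyNext m cur => s' = match (s.ops cur).next with
    | none => s.goto i (.ret m)
    | some w => s.goto i (.popEmptyCell m w)
  | .popInitNext m top => s' = s.goto i (.popLoop m top (s.cells top).next 1)
  | .popLoop m top nTop k => s' = match nTop with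
    | none => s.goto i (.popCas m top none)
    | some n => if k < (s.ops m).length then s.goto i (.popIncr m top n k)
        else s.goto i (.popCas m top (some n))
  | .popIncr m top nTop k => s' = s.goto i (.popLoop m top (s.cells nTop).next (k + 1))
  | .popCas m top nTop =>
    s' = if s.centralStack = some top then
        ({ s with centralStack := nTop } : State N D).goto i (.popOwnCell m top)
      else s.goto i (.announce m)
  | .popOwnCell m top =>
    s' = (s.modOp m fun x => { x with cell := some top }).goto i (.popOwnTop m top)
  | .popOwnTop m top => s' = s.goto i (.popWhile m (s.cells top).next)
  | .popWhile m top => s' = match (s.ops m).next with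
    | none => s.goto i (.ret m)
    | some _ => s.goto i (.popGiveCell m top)
  | .popGiveCell m top => s' = match (s.ops m).next, top with
    | none, _ => s
    | some w, none =>
      (s.modOp w fun x => { x with cell := some emptyCell }).goto i (.popStatus m none)
    | some w, some c => (s.modOp w fun x => { x with cell := some c }).goto i (.popGiveTop m c)
  | .popGiveTop m top => s' = s.goto i (.popStatus m (s.cells top).next)
  | .popStatus m top => s' = match (s.ops m).next with
    | none => s
    | some w => (s.modOp w fun x => { x with cStatus := .finished }).goto i (.popUnlink m top)
  | .popUnlink m top => s' = match (s.ops m).next with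
    | none => s
    | some w => (s.modOp m fun x => { x with next := (s.ops w).next }).goto i (.popWhile m top)
  -- cMultiPush
  | .pushTop m => s' = s.goto i (.pushSetLast m s.centralStack)
  | .pushSetLast m top => s' = match (s.ops (s.ops m).last).cell with
    | none => s
    | some c => (s.setCellNext c top).goto i (.pushCas m top)
  | .pushCas m top =>
    s' = if s.centralStack = top then
        ({ s with centralStack := (s.ops m).cell } : State N D).goto i (.pushWhile m)
      else s.goto i (.announce m)
  | .pushWhile m => s' = match (s.ops m).next with
    | none => s.goto i (.ret m)
    | some _ => s.goto i (.pushStatus m)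
  | .pushStatus m => s' = match (s.ops m).next with
    | none => s
    | some w => (s.modOp w fun x => { x with cStatus := .finished }).goto i (.pushUnlink m)
  | .pushUnlink m => s' = match (s.ops m).next with
    | none => s
    | some w => (s.modOp m fun x => { x with next := (s.ops w).next }).goto i (.pushWhile m)
  -- collide
  | .announce m => s' = (s.setLocation i (some m)).goto i (.getIndex m)
  | .getIndex m => ∃ index, s' = s.goto i (.getHim m index)
  | .getHim m index => s' = s.goto i (.casCollision m index (s.collision index))
  | .casCollision m index him =>
    s' = if s.collision index = him then
        ({ s with collision := Function.update s.collision index (some i) } : State N D).goto i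
          (match him with
            | none => .delay m
            | some j => .getInfo m j)
      else s.goto i (.getHim m index)
  | .getInfo m him => s' = match s.location him with
    | none => s.goto i (.delay m)
    | some o => if (s.ops o).id ≠ i ∧ (s.ops o).id = him then s.goto i (.casLocation m o)
        else s.goto i (.delay m)
  | .casLocation m oInfo =>
    s' = if s.location i = some m then (s.setLocation i none).goto i (.activeCas m oInfo)
      else s.goto i (.passiveGet m)
  | .delay m => s' = s.goto i (.casLocationDelayed m)
  | .casLocationDelayed m =>
    s' = if s.location i = some m then (s.setLocation i none).startLoop i m
      else s.goto i (.passiveGet m)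
  -- activeCollide
  | .activeCas m p =>
    s' = if s.location (s.ops p).id = some p then
        (s.setLocation (s.ops p).id (some m)).goto i
          (if (s.ops m).op = (s.ops p).op then
            (if (s.ops m).op = .push then .combineCells m p else .combineNext m p)
          else .elimCell m p m p)
      else s.startLoop i m
  -- combine
  | .combineCells m p => s' = match (s.ops (s.ops m).last).cell with
    | none => s
    | some c => (s.setCellNext c (s.ops p).cell).goto i (.combineNext m p)
  | .combineNext m p =>
    s' = (s.modOp (s.ops m).last fun x => { x with next := some p }).goto i (.combineLast m p)
  | .combineLast m p =>
    s' = (s.modOp m fun x => { x with last := (s.ops p).last }).goto i (.combineLength m p)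
  | .combineLength m p =>
    s' = (s.modOp m fun x => { x with length := x.length + (s.ops p).length }).startLoop i m
  -- multiEliminate
  | .elimCell m p a q =>
    s' = (if (s.ops m).op = .pop then s.modOp a fun x => { x with cell := (s.ops q).cell }
        else s.modOp q fun x => { x with cell := (s.ops a).cell }).goto i (.elimStatusA m p a q)
  | .elimStatusA m p a q =>
    s' = (s.modOp a fun x => { x with cStatus := .finished }).goto i (.elimStatusP m p a q)
  | .elimStatusP m p a q =>
    s' = (s.modOp q fun x => { x with cStatus := .finished }).goto i (.elimLengthA m p a q)
  | .elimLengthA m p a q =>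
    s' = (s.modOp m fun x => { x with length := x.length - 1 }).goto i (.elimLengthP m p a q)
  | .elimLengthP m p a q =>
    s' = (s.modOp p fun x => { x with length := x.length - 1 }).goto i (.elimNextA m p a q)
  | .elimNextA m p a q => s' = s.goto i (.elimNextP m p (s.ops a).next q)
  | .elimNextP m p a q => s' = match a, (s.ops q).next with
    | some a', some q' => s.goto i (.elimCell m p a' q')
    | some a', none => s.goto i (.residueLength m m a')
    | none, some q' => s.goto i (.residueLength m p q')
    | none, none => s.goto i (.ret m)
  | .residueLength m src h =>
    s' = (s.modOp h fun x => { x with length := (s.ops src).length }).goto i (.residueLast m src h)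
  | .residueLast m src h =>
    s' = (s.modOp h fun x => { x with last := (s.ops src).last }).goto i (.residueRetry m src h)
  | .residueRetry m _ h =>
    s' = (s.modOp h fun x => { x with cStatus := .retry }).goto i (.ret m)
  -- passiveCollide
  | .passiveGet m => s' = match s.location (s.ops m).id with
    | none => s
    | some a => s.goto i (.passiveReset m a)
  | .passiveReset m a =>
    s' = (s.setLocation (s.ops m).id none).goto i
      (if (s.ops m).op ≠ (s.ops a).op then
        (if (s.ops m).op = .pop then .passiveCell m a else .ret m)
      else .spin m)
  | .passiveCell m a =>
    s' = (s.modOp m fun x => { x with cell := (s.ops a).cell }).goto i (.ret m)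
  | .spin m => s' = if (s.ops m).cStatus ≠ .init then s.goto i (.checkStatus m) else s
  | .checkStatus m =>
    s' = if (s.ops m).cStatus = .finished then s.goto i (.ret m) else s.goto i (.setInit m)
  | .setInit m => s' = (s.modOp m fun x => { x with cStatus := .init }).startLoop i m
  -- the return from push or pop
  | .ret m =>
    s' = ({ s with out := Function.update s.out i (s.returnValue m) } : State N D).goto i .idle

/-- The operation number `k` of the multiOp list that starts at `r`. -/
def nth (s : State N D) (r : ℕ) : ℕ → Option ℕ
  | 0 => some r
  | k + 1 => (s.nth r k).bind fun x => (s.ops x).next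

/-- The operation `x` belongs to the multiOp list that starts at `r`. -/
def InList (s : State N D) (r x : ℕ) : Prop := ∃ k, s.nth r k = some x

/-- The next step of thread `i` from `s` is a linearization point of the operation `r`: it finds the
central stack empty in `cMultiPop` or performs a successful CAS on the central stack, and `r` is in
the multiOp list of the delegate operation; or it is the successful CAS of `activeCollide` in an
eliminating collision, and `r` is matched with an operation at the same position of the other list. -/
def Linearizes (s : State N D) (i : Fin N) (r : ℕ) : Prop :=
  match s.pc i with
  | .popTop m => s.centralStack = none ∧ s.InList m r
  | .popCas m top _ => s.centralStack = some top ∧ s.InList m r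
  | .pushCas m top => s.centralStack = top ∧ s.InList m r
  | .activeCas m p =>
    s.location (s.ops p).id = some p ∧ (s.ops m).op ≠ (s.ops p).op ∧
      ∃ k x y, s.nth m k = some x ∧ s.nth p k = some y ∧ (r = x ∨ r = y)
  | _ => False

/-- Thread `i` is waiting with its operation `r`: it executes the await statement and has not been
signalled. -/
def Waiting (s : State N D) (i : Fin N) (r : ℕ) : Prop :=
  s.pc i = .spin r ∧ (s.ops r).cStatus = .init

end State

/-- An infinite execution: at each time `t` thread `sched t` takes one step. -/
structure Execution (N : ℕ) (D : Type*) where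
  st : ℕ → State N D
  sched : ℕ → Fin N
  initial : (st 0).IsInitial
  step : ∀ t, State.Step (sched t) (st t) (st (t + 1))

namespace Execution

variable {N : ℕ} {D : Type*}

/-- Every thread is scheduled infinitely often. -/
def Fair (e : Execution N D) : Prop := ∀ i T, ∃ t, T ≤ t ∧ e.sched t = i

/-- Step `t` is the return of thread `i` from its operation `r`. -/
def CompletesAt (e : Execution N D) (t : ℕ) (i : Fin N) (r : ℕ) : Prop :=
  e.sched t = i ∧ (e.st t).pc i = .ret r

/-- Step `t` is the first step of an iteration (of the main loop of `push` or `pop`) that thread `i`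
makes with its operation `r`. -/
def IterationAt (e : Execution N D) (t : ℕ) (i : Fin N) (r : ℕ) : Prop :=
  e.sched t = i ∧ ((e.st t).pc i = .popTop r ∨ (e.st t).pc i = .pushTop r)

/-- Thread `i`, which makes the first step of an iteration at time `t`, has not left this iteration
before its configuration at time `t'`. -/
def SameIteration (e : Execution N D) (i : Fin N) (t t' : ℕ) : Prop :=
  ∀ u, t < u → u ≤ t' → (e.st u).pc i ≠ .idle ∧
    ∀ r, (e.st u).pc i ≠ .popTop r ∧ (e.st u).pc i ≠ .pushTop r

/-- Step `t` is a linearization point of the operation `r`. -/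
def LinearizedAt (e : Execution N D) (t r : ℕ) : Prop := (e.st t).Linearizes (e.sched t) r

/-- Thread `i` signals `v` to the operation `r` in step `t`. -/
def SignalsAt (e : Execution N D) (t : ℕ) (i : Fin N) (v : Status) (r : ℕ) : Prop :=
  e.sched t = i ∧ ((e.st t).ops r).cStatus = .init ∧ ((e.st (t + 1)).ops r).cStatus = v

/-- `e.Delegate t d r`: at time `t`, the operation `d` is a delegate of the operation `r`. A newly
invoked operation is its own delegate. When `m` collides actively with `p` and both have the same
kind, `m` replaces `p` as the delegate of all operations that were delegated to `p`. When RETRY is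
signalled to the first operation `h` of the residue of the list of `src`, then `h` replaces `src` as
the delegate of the operations of the residue. -/
def Delegate (e : Execution N D) : ℕ → ℕ → ℕ → Prop
  | 0, _, _ => False
  | t + 1, d, r =>
    let s := e.st t
    match s.pc (e.sched t) with
    | .idle => e.Delegate t d r ∨ (s.numOps < (e.st (t + 1)).numOps ∧ d = s.numOps ∧ r = s.numOps)
    | .activeCas m p =>
      if s.location (s.ops p).id = some p ∧ (s.ops m).op = (s.ops p).op then
        (d = m ∧ e.Delegate t p r) ∨ (d ≠ p ∧ e.Delegate t d r)
      else e.Delegate t d r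
    | .residueRetry _ src h =>
      (d = h ∧ e.Delegate t src r ∧ s.InList h r) ∨
        (e.Delegate t d r ∧ ¬ (d = src ∧ s.InList h r))
    | _ => e.Delegate t d r

end Execution

end DECS

/-! Safety. A state is abstracted to a `Conf`: the fields of the records that shape the lists, a
`Role` for each thread, the set `lin` of linearized operations, the delegate relation `del`, and
auxiliary lists `la i`, `lb i` of the captured, not yet signalled operations for which thread `i` is
responsible. An operation changes its role at the moment when another thread overwrites its entry of
`location`, which is before its own thread notices: it becomes `capt` if the kinds agree and `gone`
if they differ. The invariant `Inv` says that the lists are disjoint and contain exactly the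
captured operations with status INIT, that a thread with a rooted role has a complete list of
operations that are not linearized and whose only delegate is its own operation, and that a thread
which distributes results holds what remains of the list that it walks through.

A walk passes over records whose threads may have returned long ago. This is harmless: memory is not
reused, and nobody changes `next` or `last` of a released operation (`Gone`). Most steps concern one
thread only (`Local`), and since the lists are disjoint they preserve the invariants of the others
by a frame argument. Apart from invocations, the exceptions are the successful CAS of
`activeCollide` (`captureSame`, `captureDiff`) and the signal RETRY (`signalRetry`), which move a
list from one thread to another. The uniqueness of delegates and the fact that a delegate is not
itself waiting follow from the invariant.

Liveness. Within an iteration every line lowers the lexicographic measure `rank`, except the await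
statement and a failing CAS on `collision`. A thread that distributes results executes neither of
them and starts no iteration, so it signals every operation in its lists: FINISHED if it has been
linearized, otherwise RETRY to it or to its new delegate. The thread that linearizes a delegate
becomes responsible for the operations delegated to it.

Every iteration contains a linearization: either the stack is read as empty, or the CAS on
`CentralStack` succeeds, or the pointer has changed since it was read, by a successful CAS of
another operation. All operations linearized by a step lie in lists that were not linearized before,
so no operation is linearized twice.

Deadlock-freedom. Suppose that no operation completes from some time on. Then eventually no
operation is invoked, so finitely many operations exist, linearizations stop, and by the previous
paragraph iterations stop too. Each thread then wins only finitely many CAS on `collision`; so this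
array becomes constant and these CAS eventually stop failing. Hence every thread eventually rests,
either idle or waiting. But a resting thread has empty lists, whereas every waiting operation is in
some list. So all threads are idle, and nothing was pending. The last claim of the theorem follows
in the same way, since an operation that is never signalled waits forever. -/

namespace DECS

/-! ### Abstract configurations and their invariant -/

/-- The part that a thread plays with respect to the lists of operations. -/
inductive Role
  | idle
  | free (m : ℕ)
  | merge (m p : ℕ)
  | merged (m p : ℕ)
  | empt (m cur : ℕ)
  | emptNext (m cur : ℕ)
  | give (m : ℕ)
  | hand (m : ℕ)
  | unlink (m : ℕ)
  | elimA (m p a q : ℕ)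
  | elimP (m p a q : ℕ)
  | elimNext (m p a q : ℕ)
  | elimTest (m p : ℕ) (a : Option ℕ) (q : ℕ)
  | residue (m src h : ℕ)
  | residueRetry (m src h : ℕ)
  | capt (m : ℕ)
  | check (m : ℕ)
  | ready (m : ℕ)
  | gone (m : ℕ)

/-- The operation of a thread with a given role. -/
def Role.op? : Role → Option ℕ
  | .idle => none
  | .free m | .merge m _ | .merged m _ | .empt m _ | .emptNext m _ | .give m | .hand m | .unlink m
  | .elimA m _ _ _ | .elimP m _ _ _ | .elimNext m _ _ _ | .elimTest m _ _ _ | .residue m _ _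
  | .residueRetry m _ _ | .capt m | .check m | .ready m | .gone m => some m

/-- The roles of a thread that distributes results after a linearization point. -/
def Role.Working : Role → Prop
  | .empt _ _ | .emptNext _ _ | .give _ | .hand _ | .unlink _ | .elimA _ _ _ _ | .elimP _ _ _ _
  | .elimNext _ _ _ _ | .elimTest _ _ _ _ | .residue _ _ _ | .residueRetry _ _ _ => True
  | _ => False

/-- The linked list that starts at a pointer consists of the given addresses. -/
def IsList (next : ℕ → Option ℕ) : Option ℕ → List ℕ → Prop
  | o, [] => o = none
  | o, x :: l => o = some x ∧ IsList next (next x) l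

theorem IsList.congr {next next' : ℕ → Option ℕ} {l : List ℕ} {o : Option ℕ}
    (h : IsList next o l) (hn : ∀ x ∈ l, next' x = next x) : IsList next' o l := by
  induction l generalizing o with
  | nil => exact h
  | cons x l ih =>
    refine ⟨h.1, ?_⟩
    rw [hn x (by simp)]
    exact ih h.2 fun y hy => hn y (by simp [hy])

theorem IsList.head_mem {next : ℕ → Option ℕ} {h : ℕ} {l : List ℕ}
    (hl : IsList next (some h) l) : h ∈ l := by
  cases l with
  | nil => cases hl
  | cons x l => cases hl.1; simp

/-- If the list is not empty, then `y` is its last element. -/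
def EndsAt (l : List ℕ) (y : ℕ) : Prop := ∀ z, l.getLast? = some z → z = y

/-- In both lists, the elements that satisfy `lin` are those at positions common to both lists. -/
def Pairs (lin : ℕ → Prop) : List ℕ → List ℕ → Prop
  | a :: l, b :: l' => lin a ∧ lin b ∧ Pairs lin l l'
  | l, [] => ∀ x ∈ l, ¬ lin x
  | [], l => ∀ x ∈ l, ¬ lin x

theorem Pairs.congr {lin lin' : ℕ → Prop} {l l' : List ℕ} (h : Pairs lin l l')
    (hl : ∀ x ∈ l ++ l', (lin' x ↔ lin x)) : Pairs lin' l l' := by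
  induction l generalizing l' with
  | nil =>
    cases l' with
    | nil => simp [Pairs]
    | cons b l' =>
      intro x hx
      rw [hl x (by simpa using hx)]
      exact h x hx
  | cons a l ih =>
    cases l' with
    | nil =>
      intro x hx
      rw [hl x (by simpa using hx)]
      exact h x hx
    | cons b l' =>
      refine ⟨(hl a (by simp)).2 h.1, (hl b (by simp)).2 h.2.1, ih h.2.2 fun x hx => hl x ?_⟩
      simp only [List.mem_append, List.mem_cons] at hx ⊢
      tauto

/-- The fields that matter for the structure of the lists, together with auxiliary information:
`lin` are the operations that have been linearized, `del` is the delegate relation, and `la i` and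
`lb i` are the captured and not yet signalled operations that thread `i` is responsible for (those
in `lb i` come from the list of the other side of an elimination). -/
structure Conf (N : ℕ) where
  n : ℕ
  id : ℕ → Fin N
  op : ℕ → Kind
  status : ℕ → Status
  next : ℕ → Option ℕ
  last : ℕ → ℕ
  role : Fin N → Role
  lin : ℕ → Prop
  del : ℕ → ℕ → Prop
  la : Fin N → List ℕ
  lb : Fin N → List ℕ

namespace Conf

variable {N : ℕ}

/-- The operation `x` is finished, or its thread will finish it without reading its status. -/
def Gone (c : Conf N) (x : ℕ) : Prop :=
  x < c.n ∧ ((c.role (c.id x)).op? = some x → c.role (c.id x) = .gone x ∨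
    ((c.role (c.id x) = .capt x ∨ c.role (c.id x) = .check x) ∧ c.status x = .finished))

/-- The list of `m` is `m :: l`, none of its operations has been linearized, and `m` is the delegate
of all of them. -/
structure Root (c : Conf N) (m : ℕ) (l : List ℕ) : Prop where
  fresh : ∀ x ∈ m :: l, ¬ c.lin x
  del : ∀ x ∈ m :: l, ∀ d, c.del d x ↔ d = m
  link : IsList c.next (c.next m) l
  ends : EndsAt (m :: l) (c.last m)
  kind : ∀ x ∈ l, c.op x = c.op m

/-- What holds of the lists `l`, `l'` of operations that are still to be eliminated or retried,
during the elimination of `p` by `m`. -/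
structure Elim (c : Conf N) (m p : ℕ) (l l' : List ℕ) : Prop where
  gone : c.Gone p
  ne : c.op m ≠ c.op p
  delA : ∀ x ∈ l, ∀ d, c.del d x ↔ d = m
  delB : ∀ x ∈ l', ∀ d, c.del d x ↔ d = p
  kindA : ∀ x ∈ l, c.op x = c.op m
  kindB : ∀ x ∈ l', c.op x = c.op p
  endsA : EndsAt l (c.last m)
  endsB : EndsAt l' (c.last p)

/-- `l` is the residue, with the first operation `h`, of the list of `src`. -/
structure Residue (c : Conf N) (m src h : ℕ) (l : List ℕ) : Prop where
  gone : src = m ∨ c.Gone src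
  link : IsList c.next (some h) l
  fresh : ∀ x ∈ l, ¬ c.lin x
  del : ∀ x ∈ l, ∀ d, c.del d x ↔ d = src
  kind : ∀ x ∈ l, c.op x = c.op h
  ends : EndsAt l (c.last src)

/-- All operations of `l` have been linearized, and `m` is their delegate. -/
def Served (c : Conf N) (m : ℕ) (l : List ℕ) : Prop :=
  ∀ x ∈ l, c.lin x ∧ ∀ d, c.del d x ↔ d = m

/-- The invariant of a thread with lists `l` and `l'`. -/
def RInv (c : Conf N) (l l' : List ℕ) : Role → Prop
  | .idle | .gone _ => l = [] ∧ l' = []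
  | .free m => l' = [] ∧ c.status m = .init ∧ c.Root m l
  | .capt m => l' = [] ∧ (c.status m = .retry → c.Root m l) ∧ (c.status m ≠ .retry → l = [])
  | .check m => c.status m ≠ .init ∧ l' = [] ∧ (c.status m = .retry → c.Root m l) ∧
      (c.status m ≠ .retry → l = [])
  | .ready m => l' = [] ∧ c.status m = .retry ∧ c.Root m l
  | .merge m p => l' = [] ∧ c.status m = .init ∧
      (∀ x ∈ m :: l, ¬ c.lin x ∧ ∀ d, c.del d x ↔ d = m) ∧ (∀ x ∈ l, c.op x = c.op m) ∧
      ∃ l₁ l₂, l = l₁ ++ p :: l₂ ∧ IsList c.next (c.next m) l₁ ∧ IsList c.next (c.next p) l₂ ∧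
        EndsAt (m :: l₁) (c.last m) ∧ EndsAt (p :: l₂) (c.last p)
  | .merged m p => l' = [] ∧ c.status m = .init ∧
      (∀ x ∈ m :: l, ¬ c.lin x ∧ ∀ d, c.del d x ↔ d = m) ∧ (∀ x ∈ l, c.op x = c.op m) ∧
      IsList c.next (c.next m) l ∧ p ∈ l ∧ EndsAt (m :: l) (c.last p)
  | .empt m cur => l' = [] ∧ c.Served m l ∧
      ((cur = m ∧ IsList c.next (c.next m) l) ∨ IsList c.next (some cur) l)
  | .emptNext m cur => l' = [] ∧ c.Served m l ∧ (cur = m ∨ c.Gone cur) ∧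
      IsList c.next (c.next cur) l
  | .give m => l' = [] ∧ c.Served m l ∧ IsList c.next (c.next m) l
  | .hand m => l' = [] ∧ c.Served m l ∧ IsList c.next (c.next m) l ∧ l ≠ []
  | .unlink m => l' = [] ∧ c.Served m l ∧
      ∃ w, c.next m = some w ∧ c.Gone w ∧ IsList c.next (c.next w) l
  | .elimA m p a q => c.Elim m p l l' ∧ Pairs c.lin l l' ∧
      ((a = m ∧ q = p ∧ IsList c.next (c.next m) l ∧ IsList c.next (c.next p) l') ∨
        (IsList c.next (some a) l ∧ IsList c.next (some q) l'))
  | .elimP m p a q => c.Elim m p l l' ∧ (a = m ∨ c.Gone a) ∧ IsList c.next (c.next a) l ∧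
      ((q = p ∧ IsList c.next (c.next p) l' ∧ Pairs c.lin l l') ∨
        ∃ l₁, l' = q :: l₁ ∧ c.lin q ∧ IsList c.next (c.next q) l₁ ∧ Pairs c.lin l l₁)
  | .elimNext m p a q => c.Elim m p l l' ∧ (a = m ∨ c.Gone a) ∧ c.Gone q ∧
      IsList c.next (c.next a) l ∧ IsList c.next (c.next q) l' ∧ Pairs c.lin l l'
  | .elimTest m p a q => c.Elim m p l l' ∧ c.Gone q ∧
      IsList c.next a l ∧ IsList c.next (c.next q) l' ∧ Pairs c.lin l l'
  | .residue m src h => c.Residue m src h (l ++ l')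
  | .residueRetry m src h => c.Residue m src h (l ++ l') ∧ EndsAt (l ++ l') (c.last h)

/-- A thread with this role has a complete list of operations that have not been linearized. -/
def Rooted (c : Conf N) : Role → Prop
  | .free _ | .merge _ _ | .merged _ _ | .ready _ => True
  | .capt m | .check m => c.status m = .retry
  | _ => False

/-- Two configurations have the same record of the operation `x`. -/
structure SameRecord (c c' : Conf N) (x : ℕ) : Prop where
  status : c'.status x = c.status x
  next : c'.next x = c.next x
  last : c'.last x = c.last x
  op : c'.op x = c.op x

/-- Two configurations agree on the operation `x`. -/
structure Same (c c' : Conf N) (x : ℕ) : Prop extends SameRecord c c' x where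
  lin : c'.lin x ↔ c.lin x
  del : ∀ d, c'.del d x ↔ c.del d x

/-- The invariant. -/
structure Inv (c : Conf N) : Prop where
  own : ∀ i m, (c.role i).op? = some m → m < c.n ∧ c.id m = i
  rinv : ∀ i, c.RInv (c.la i) (c.lb i) (c.role i)
  held : ∀ i, ∀ x ∈ c.la i ++ c.lb i, x < c.n ∧ c.status x = .init ∧ c.role (c.id x) = .capt x
  cover : ∀ i x, c.role i = .capt x → c.status x = .init → ∃ j, x ∈ c.la j ++ c.lb j
  nodup : ∀ i, (c.la i ++ c.lb i).Nodup
  disj : ∀ i j x, x ∈ c.la i ++ c.lb i → x ∈ c.la j ++ c.lb j → i = j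
  linlt : ∀ x, c.lin x → x < c.n
  dellt : ∀ d x, c.del d x → x < c.n

/-! ### Stability of the invariant of one thread under steps of the others -/

section Frame

variable {c c' : Conf N}

theorem Root.frame {m : ℕ} {l : List ℕ} (h : c.Root m l) (hs : ∀ x ∈ m :: l, Same c c' x) :
    c'.Root m l := by
  have hm := hs m (by simp)
  refine ⟨fun x hx => ?_, fun x hx d => ?_, ?_, ?_, fun x hx => ?_⟩
  · rw [(hs x hx).lin]; exact h.fresh x hx
  · rw [(hs x hx).del]; exact h.del x hx d
  · rw [hm.next]; exact h.link.congr fun x hx => (hs x (by simp [hx])).next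
  · rw [hm.last]; exact h.ends
  · rw [(hs x (by simp [hx])).op, hm.op]; exact h.kind x hx

/-- What has to be preserved of the released operations. -/
def GoneSame (c c' : Conf N) : Prop :=
  ∀ x, c.Gone x → c'.Gone x ∧ c'.next x = c.next x ∧ c'.last x = c.last x ∧ c'.op x = c.op x

theorem Elim.frame {m p : ℕ} {l l' : List ℕ} (h : c.Elim m p l l') (hm : SameRecord c c' m)
    (hs : ∀ x ∈ l ++ l', Same c c' x) (hg : GoneSame c c') : c'.Elim m p l l' := by
  obtain ⟨g1, g2, g3, g4⟩ := hg p h.gone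
  refine ⟨g1, ?_, fun x hx d => ?_, fun x hx d => ?_, fun x hx => ?_, fun x hx => ?_, ?_, ?_⟩
  · rw [hm.op, g4]; exact h.ne
  · rw [(hs x (by simp [hx])).del]; exact h.delA x hx d
  · rw [(hs x (by simp [hx])).del]; exact h.delB x hx d
  · rw [(hs x (by simp [hx])).op, hm.op]; exact h.kindA x hx
  · rw [(hs x (by simp [hx])).op, g4]; exact h.kindB x hx
  · rw [hm.last]; exact h.endsA
  · rw [g3]; exact h.endsB

theorem Residue.frame {m src h : ℕ} {l : List ℕ} (hr : c.Residue m src h l) (hm : SameRecord c c' m)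
    (hs : ∀ x ∈ l, Same c c' x) (hg : GoneSame c c') : c'.Residue m src h l := by
  have hh := hs h hr.link.head_mem
  refine ⟨?_, hr.link.congr fun x hx => (hs x hx).next, fun x hx => ?_, fun x hx d => ?_,
    fun x hx => ?_, ?_⟩
  · exact hr.gone.imp_right fun g => (hg _ g).1
  · rw [(hs x hx).lin]; exact hr.fresh x hx
  · rw [(hs x hx).del]; exact hr.del x hx d
  · rw [(hs x hx).op, hh.op]; exact hr.kind x hx
  · rcases hr.gone with rfl | g
    · rw [hm.last]; exact hr.ends
    · rw [(hg _ g).2.2.1]; exact hr.ends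

theorem Served.frame {m : ℕ} {l : List ℕ} (h : c.Served m l) (hs : ∀ x ∈ l, Same c c' x) :
    c'.Served m l := fun x hx =>
  ⟨(hs x hx).lin.2 (h x hx).1, fun d => by rw [(hs x hx).del]; exact (h x hx).2 d⟩

/-- The invariant of a thread speaks only of its own operation, of the operations in its lists, and
of released operations that it still walks through. For the own operation, `lin` and `del` matter
only if the role is rooted, and nothing matters if the role is `gone`: the eliminating thread may
still write to that record. -/
theorem RInv.frame {l l' : List ℕ} {r : Role} (h : c.RInv l l' r)
    (hm : ∀ m, r.op? = some m → r ≠ .gone m →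
      SameRecord c c' m ∧ (c.Rooted r → Same c c' m))
    (hs : ∀ x ∈ l ++ l', Same c c' x) (hg : GoneSame c c') : c'.RInv l l' r := by
  have hn : ∀ {o : Option ℕ} {k : List ℕ}, (∀ x ∈ k, x ∈ l ++ l') → IsList c.next o k →
      IsList c'.next o k := fun hk hl => hl.congr fun x hx => (hs x (hk x hx)).next
  have hla : ∀ x ∈ l, x ∈ l ++ l' := fun x hx => by simp [hx]
  have hlb : ∀ x ∈ l', x ∈ l ++ l' := fun x hx => by simp [hx]
  have hsa : ∀ x ∈ l, Same c c' x := fun x hx => hs x (hla x hx)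
  have hp : Pairs c.lin l l' → Pairs c'.lin l l' := fun hp => hp.congr fun x hx => (hs x hx).lin
  -- A cursor rests on the own operation or on a released one.
  have hcur : ∀ {m a}, SameRecord c c' m → (a = m ∨ c.Gone a) → c'.next a = c.next a := by
    rintro m a hm (rfl | g)
    exacts [hm.next, (hg _ g).2.1]
  have hcur' : ∀ {m a}, (a = m ∨ c.Gone a) → (a = m ∨ c'.Gone a) :=
    fun h => h.imp_right fun g => (hg _ g).1
  cases r with
  | idle => exact h
  | gone m => exact h
  | free m =>
    have hm := (hm m rfl (by simp)).2 trivial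
    refine ⟨h.1, hm.status.trans h.2.1, h.2.2.frame ?_⟩
    simpa [hm] using hsa
  | capt m =>
    obtain ⟨hm, hm'⟩ := hm m rfl (by simp)
    refine ⟨h.1, fun e => ?_, fun e => h.2.2 ?_⟩
    · rw [hm.status] at e
      exact (h.2.1 e).frame (by simpa [hm' e] using hsa)
    · rwa [← hm.status]
  | check m =>
    obtain ⟨hm, hm'⟩ := hm m rfl (by simp)
    refine ⟨?_, h.2.1, fun e => ?_, fun e => h.2.2.2 ?_⟩
    · rw [hm.status]; exact h.1
    · rw [hm.status] at e
      exact (h.2.2.1 e).frame (by simpa [hm' e] using hsa)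
    · rwa [← hm.status]
  | ready m =>
    have hm := (hm m rfl (by simp)).2 trivial
    refine ⟨h.1, hm.status.trans h.2.1, h.2.2.frame ?_⟩
    simpa [hm] using hsa
  | merge m p =>
    have hm := (hm m rfl (by simp)).2 trivial
    have hs' : ∀ x ∈ m :: l, Same c c' x := by simpa [hm] using hsa
    obtain ⟨h1, h2, h3, h4, l₁, l₂, rfl, h6, h7, h8, h9⟩ := h
    have hp := hsa p (by simp)
    refine ⟨h1, hm.status.trans h2, fun x hx => ?_, fun x hx => ?_, l₁, l₂, rfl, ?_, ?_, ?_, ?_⟩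
    · refine ⟨by rw [(hs' x hx).lin]; exact (h3 x hx).1, fun d => ?_⟩
      rw [(hs' x hx).del]; exact (h3 x hx).2 d
    · rw [(hsa x hx).op, hm.op]; exact h4 x hx
    · rw [hm.next]; exact hn (fun x hx => by simp [hx]) h6
    · rw [hp.next]; exact hn (fun x hx => by simp [hx]) h7
    · rw [hm.last]; exact h8
    · rw [hp.last]; exact h9
  | merged m p =>
    have hm := (hm m rfl (by simp)).2 trivial
    have hs' : ∀ x ∈ m :: l, Same c c' x := by simpa [hm] using hsa
    obtain ⟨h1, h2, h3, h4, h6, h7, h8⟩ := h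
    have hp := hsa p h7
    refine ⟨h1, hm.status.trans h2, fun x hx => ?_, fun x hx => ?_, ?_, h7, ?_⟩
    · refine ⟨by rw [(hs' x hx).lin]; exact (h3 x hx).1, fun d => ?_⟩
      rw [(hs' x hx).del]; exact (h3 x hx).2 d
    · rw [(hsa x hx).op, hm.op]; exact h4 x hx
    · rw [hm.next]; exact hn hla h6
    · rw [hp.last]; exact h8
  | empt m cur =>
    have hm := (hm m rfl (by simp)).1
    refine ⟨h.1, h.2.1.frame hsa, h.2.2.imp (fun e => ⟨e.1, ?_⟩) (hn hla)⟩
    rw [hm.next]; exact hn hla e.2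
  | emptNext m cur =>
    have hm := (hm m rfl (by simp)).1
    refine ⟨h.1, h.2.1.frame hsa, hcur' h.2.2.1, ?_⟩
    rw [hcur hm h.2.2.1]; exact hn hla h.2.2.2
  | give m =>
    have hm := (hm m rfl (by simp)).1
    refine ⟨h.1, h.2.1.frame hsa, ?_⟩
    rw [hm.next]; exact hn hla h.2.2
  | hand m =>
    have hm := (hm m rfl (by simp)).1
    refine ⟨h.1, h.2.1.frame hsa, ?_, h.2.2.2⟩
    rw [hm.next]; exact hn hla h.2.2.1
  | unlink m =>
    have hm := (hm m rfl (by simp)).1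
    obtain ⟨h1, h2, w, h3, h4, h5⟩ := h
    refine ⟨h1, h2.frame hsa, w, hm.next.trans h3, (hg w h4).1, ?_⟩
    rw [(hg w h4).2.1]; exact hn hla h5
  | elimA m p a q =>
    have hm := (hm m rfl (by simp)).1
    refine ⟨h.1.frame hm hs hg, hp h.2.1, h.2.2.imp (fun e => ⟨e.1, e.2.1, ?_, ?_⟩)
      (fun e => ⟨hn hla e.1, hn hlb e.2⟩)⟩
    · rw [hm.next]; exact hn hla e.2.2.1
    · rw [(hg p h.1.gone).2.1]; exact hn hlb e.2.2.2
  | elimP m p a q =>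
    have hm := (hm m rfl (by simp)).1
    obtain ⟨h1, h2, h3, h4⟩ := h
    refine ⟨h1.frame hm hs hg, hcur' h2, ?_, ?_⟩
    · rw [hcur hm h2]; exact hn hla h3
    · rcases h4 with ⟨e1, e2, e3⟩ | ⟨l₁, rfl, e1, e2, e3⟩
      · exact .inl ⟨e1, by rw [(hg p h1.gone).2.1]; exact hn hlb e2, hp e3⟩
      · have hq := hs q (by simp)
        refine .inr ⟨l₁, rfl, hq.lin.2 e1, ?_, e3.congr fun x hx => (hs x ?_).lin⟩
        · rw [hq.next]; exact hn (fun x hx => by simp [hx]) e2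
        · simp only [List.mem_append, List.mem_cons] at hx ⊢; tauto
  | elimNext m p a q =>
    have hm := (hm m rfl (by simp)).1
    obtain ⟨h1, h2, h3, h4, h5, h6⟩ := h
    refine ⟨h1.frame hm hs hg, hcur' h2, (hg q h3).1, ?_, ?_, hp h6⟩
    · rw [hcur hm h2]; exact hn hla h4
    · rw [(hg q h3).2.1]; exact hn hlb h5
  | elimTest m p a q =>
    have hm := (hm m rfl (by simp)).1
    obtain ⟨h1, h3, h4, h5, h6⟩ := h
    refine ⟨h1.frame hm hs hg, (hg q h3).1, hn hla h4, ?_, hp h6⟩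
    rw [(hg q h3).2.1]; exact hn hlb h5
  | residue m src k => exact Residue.frame h (hm m rfl (by simp)).1 hs hg
  | residueRetry m src k =>
    refine ⟨h.1.frame (hm m rfl (by simp)).1 hs hg, ?_⟩
    rw [(hs k h.1.link.head_mem).last]; exact h.2

end Frame

end Conf
end DECS

/-! ### Steps that concern a single thread -/

namespace DECS
namespace Conf

variable {N : ℕ} {c c' : Conf N} {i : Fin N}

theorem Inv.idlt (h : Inv c) {j : Fin N} {x : ℕ} (hx : x ∈ c.la j ++ c.lb j) : x < c.n :=
  (h.held j x hx).1

/-- A held operation is captured and has status INIT, whereas a captured operation is released only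
by FINISHED. -/
theorem Inv.not_gone_of_held (h : Inv c) {j : Fin N} {x : ℕ} (hx : x ∈ c.la j ++ c.lb j) :
    ¬ c.Gone x := by
  intro g
  obtain ⟨-, h2, h3⟩ := h.held j x hx
  have := g.2 (by rw [h3]; rfl)
  rw [h3, h2] at this
  simp at this

theorem Inv.not_held_of_op (h : Inv c) {j : Fin N} {m : ℕ} (hm : (c.role i).op? = some m)
    (hc : c.role i ≠ .capt m) : m ∉ c.la j ++ c.lb j := by
  intro hx
  obtain ⟨-, -, h3⟩ := h.held j m hx
  rw [(h.own i m hm).2] at h3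
  exact hc h3

/-- A step of thread `i` that concerns its own role and lists, and that signals nothing but
FINISHED. -/
structure Local (i : Fin N) (c c' : Conf N) : Prop where
  n : c'.n = c.n
  id : c'.id = c.id
  op : c'.op = c.op
  del : c'.del = c.del
  role : ∀ j ≠ i, c'.role j = c.role j
  la : ∀ j ≠ i, c'.la j = c.la j
  lb : ∀ j ≠ i, c'.lb j = c.lb j
  op? : ∀ m, (c'.role i).op? = some m → (c.role i).op? = some m
  capt : ∀ x, c.role i = .capt x → c.status x ≠ .init
  capt' : ∀ x, c'.role i ≠ .capt x
  other : ∀ x, (c.role i).op? ≠ some x → x ∉ c.la i ++ c.lb i →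
    c'.next x = c.next x ∧ c'.last x = c.last x ∧
      (c'.status x = c.status x ∨ c.Gone x ∧ c'.status x = .finished)
  lin : ∀ x, (c.role i).op? ≠ some x → x ∉ c.la i ++ c.lb i → (c'.lin x ↔ c.lin x)
  sub : ∀ x ∈ c'.la i ++ c'.lb i, x ∈ c.la i ++ c.lb i ∧ c'.status x = c.status x
  rem : ∀ x ∈ c.la i ++ c.lb i, x ∉ c'.la i ++ c'.lb i → c'.status x = .finished
  nodup : (c'.la i ++ c'.lb i).Nodup
  gone : ∀ m, c.Gone m → (c.role i).op? = some m → c'.next m = c.next m ∧ c'.last m = c.last m ∧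
    ((c'.role i).op? = some m →
      c'.role i = .gone m ∨ c'.role i = .check m ∧ c'.status m = .finished)

/-- Release is permanent. For the own operation of `i` this is the field `gone`. The status FINISHED
of any other released operation can be overwritten only by FINISHED, by the field `other`. -/
theorem Local.gone_mono (h : Inv c) (hl : Local i c c') (x : ℕ) (g : c.Gone x) : c'.Gone x := by
  refine ⟨hl.n ▸ g.1, ?_⟩
  rw [hl.id]
  intro ho
  by_cases e : c.id x = i
  · rw [e] at ho ⊢
    rcases (hl.gone x g (hl.op? x ho)).2.2 ho with h1 | h1
    exacts [.inl h1, .inr ⟨.inr h1.1, h1.2⟩]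
  · rw [hl.role _ e] at ho ⊢
    refine (g.2 ho).imp_right fun h1 => ⟨h1.1, ?_⟩
    have hne : (c.role i).op? ≠ some x := fun h2 => e (h.own i x h2).2
    rcases (hl.other x hne fun hx => h.not_gone_of_held hx g).2.2 with h2 | h2
    exacts [h2.trans h1.2, h2.2]

theorem Local.gone_of_finished (h : Inv c) (hl : Local i c c') {x : ℕ}
    (hx : x ∈ c.la i ++ c.lb i) (hf : c'.status x = .finished) : c'.Gone x := by
  obtain ⟨h1, h2, h3⟩ := h.held i x hx
  refine ⟨hl.n ▸ h1, fun _ => .inr ⟨.inl ?_, hf⟩⟩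
  have e : c.id x ≠ i := fun e => hl.capt x (e ▸ h3) h2
  rw [hl.id, hl.role _ e, h3]

theorem Local.goneSame (h : Inv c) (hl : Local i c c') : GoneSame c c' := by
  intro x g
  refine ⟨hl.gone_mono h x g, ?_⟩
  rw [hl.op]
  by_cases e : (c.role i).op? = some x
  · exact ⟨(hl.gone x g e).1, (hl.gone x g e).2.1, rfl⟩
  · have := hl.other x e fun hx => h.not_gone_of_held hx g
    exact ⟨this.1, this.2.1, rfl⟩

/-- As the lists are disjoint, the step does not touch records in the lists of other threads, and
`RInv.frame` applies to them. The exception is a thread whose own captured operation is held by `i`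
and may be signalled: its list is empty unless the status is RETRY, and a local step signals nothing
but FINISHED. What remains is the invariant of `i` itself, the hypothesis `hself`. -/
theorem Inv.local (h : Inv c) (hl : Local i c c')
    (hself : (∀ x, c.Gone x → c'.Gone x) →
      (∀ x ∈ c.la i ++ c.lb i, c'.status x = .finished → c'.Gone x) →
      c'.RInv (c'.la i) (c'.lb i) (c'.role i)) : Inv c' := by
  have hne : ∀ {j}, j ≠ i → ∀ {x}, x ∈ c.la j ++ c.lb j →
      (c.role i).op? ≠ some x ∧ x ∉ c.la i ++ c.lb i := by
    intro j hj x hx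
    refine ⟨fun e => ?_, fun hx' => hj (h.disj _ _ x hx hx')⟩
    obtain ⟨h1, h2, h3⟩ := h.held j x hx
    rw [(h.own i x e).2] at h3
    exact hl.capt x h3 h2
  have hst : ∀ {j}, j ≠ i → ∀ {x}, x ∈ c.la j ++ c.lb j → c'.status x = c.status x := by
    intro j hj x hx
    obtain ⟨h1, h2⟩ := hne hj hx
    rcases (hl.other x h1 h2).2.2 with h3 | h3
    exacts [h3, (h.not_gone_of_held hx h3.1).elim]
  have hmem : ∀ {j x}, x ∈ c'.la j ++ c'.lb j → x ∈ c.la j ++ c.lb j ∧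
      c'.status x = c.status x := by
    intro j x hx
    by_cases e : j = i
    · subst e; exact hl.sub x hx
    · rw [hl.la j e, hl.lb j e] at hx; exact ⟨hx, hst e hx⟩
  refine ⟨fun j m hm => ?_, fun j => ?_, fun j x hx => ?_, fun j x hr hs => ?_, fun j => ?_,
    fun j k x hx hx' => h.disj j k x (hmem hx).1 (hmem hx').1, fun x hx => ?_, fun d x hx => ?_⟩
  · rw [hl.n, hl.id]
    by_cases e : j = i
    · subst e; exact h.own j m (hl.op? m hm)
    · rw [hl.role j e] at hm; exact h.own j m hm
  · by_cases e : j = i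
    · subst e
      exact hself (hl.gone_mono h) fun x hx hf => hl.gone_of_finished h hx hf
    · rw [hl.role j e, hl.la j e, hl.lb j e]
      have hr := h.rinv j
      by_cases hj : ∃ x, c.role j = .capt x ∧ x ∈ c.la i ++ c.lb i
      · obtain ⟨x, hx, hx'⟩ := hj
        have hi := (h.held i x hx').2.1
        have hnr : c'.status x ≠ .retry := by
          by_cases hx2 : x ∈ c'.la i ++ c'.lb i
          · rw [(hl.sub x hx2).2, hi]; simp
          · rw [hl.rem x hx' hx2]; simp
        rw [hx] at hr ⊢
        exact ⟨hr.1, fun e => (hnr e).elim, fun _ => hr.2.2 (by rw [hi]; simp)⟩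
      · refine hr.frame (fun m hm hg => ?_) (fun x hx => ?_) (hl.goneSame h)
        · have h1 : (c.role i).op? ≠ some m := fun e' =>
            e ((h.own j m hm).2.symm.trans (h.own i m e').2)
          have h2 : m ∉ c.la i ++ c.lb i := by
            intro hx
            have := (h.held i m hx).2.2
            rw [(h.own j m hm).2] at this
            exact hj ⟨m, this, hx⟩
          obtain ⟨h3, h4, h5⟩ := hl.other m h1 h2
          suffices hs : Same c c' m from ⟨hs.toSameRecord, fun _ => hs⟩
          refine ⟨⟨?_, h3, h4, by rw [hl.op]⟩, hl.lin m h1 h2, by simp [hl.del]⟩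
          rcases h5 with h5 | ⟨g, h5⟩
          · exact h5
          -- The status was overwritten by FINISHED, so `m` is released; as its role is not `gone`,
          -- its status was FINISHED already.
          · have := g.2
            rw [(h.own j m hm).2] at this
            rcases this hm with h6 | h6
            · exact (hg h6).elim
            · rw [h5, h6.2]
        · obtain ⟨h1, h2⟩ := hne e hx
          obtain ⟨h3, h4, -⟩ := hl.other x h1 h2
          exact ⟨⟨hst e hx, h3, h4, by rw [hl.op]⟩, hl.lin x h1 h2, by simp [hl.del]⟩
  · obtain ⟨h1, h2⟩ := hmem hx
    obtain ⟨h3, h4, h5⟩ := h.held j x h1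
    refine ⟨hl.n ▸ h3, h2.trans h4, ?_⟩
    rw [hl.id, hl.role _ fun e => hl.capt x (e ▸ h5) h4, h5]
  · by_cases e : j = i
    · subst e; exact (hl.capt' x hr).elim
    · rw [hl.role j e] at hr
      have ho : (c.role j).op? = some x := by rw [hr]; rfl
      have h1 : (c.role i).op? ≠ some x := fun e' =>
          e ((h.own j x ho).2.symm.trans (h.own i x e').2)
      by_cases hx : x ∈ c.la i ++ c.lb i
      · by_cases hx' : x ∈ c'.la i ++ c'.lb i
        · exact ⟨i, hx'⟩
        · rw [hl.rem x hx hx'] at hs; cases hs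
      · rcases (hl.other x h1 hx).2.2 with h2 | h2
        · obtain ⟨k, hk⟩ := h.cover j x hr (h2.symm.trans hs)
          have : k ≠ i := by rintro rfl; exact hx hk
          exact ⟨k, by rwa [hl.la k this, hl.lb k this]⟩
        · rw [h2.2] at hs; cases hs
  · by_cases e : j = i
    · subst e; exact hl.nodup
    · rw [hl.la j e, hl.lb j e]; exact h.nodup j
  · rw [hl.n]
    by_cases h1 : (c.role i).op? = some x
    · exact (h.own i x h1).1
    · by_cases h2 : x ∈ c.la i ++ c.lb i
      · exact (h.held i x h2).1
      · exact h.linlt x ((hl.lin x h1 h2).1 hx)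
  · rw [hl.n]; rw [hl.del] at hx; exact h.dellt d x hx

/-- The effect of a step of thread `i`. -/
structure Trans (i : Fin N) (c c' : Conf N) : Prop where
  keep : ∀ j ≠ i, (c.role j).Working → c'.la j = c.la j ∧ c'.lb j = c.lb j
  serve : (c.role i).Working → ∀ r ∈ c.la i ++ c.lb i,
    ((c'.role i).Working ∧ r ∈ c'.la i ++ c'.lb i) ∨ (c'.status r = .finished ∧ c.lin r) ∨
      ∃ h, c.status h = .init ∧ c'.status h = .retry ∧ c'.del h r ∧ ¬ c.lin r
  status : ∀ x < c.n, c'.status x = c.status x ∨ x ∈ c.la i ++ c.lb i ∨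
    (c.Gone x ∧ c'.status x = .finished) ∨ c.id x = i
  linked : ∀ j d r, r ∈ c.la j ++ c.lb j → c.del d r → c'.lin d → ¬ c.lin d →
    (c'.role i).Working ∧ r ∈ c'.la i ++ c'.lb i

/-- `Trans` collects what the liveness arguments use: other threads leave the lists of a working
thread alone (`keep`), a working thread drops only operations that are taken care of by a signal
(`serve`), a signalled status is not lost (`status`), and the linearization of a delegate makes the
stepping thread responsible for the operations delegated to it (`linked`). Without a new
linearization, `linked` is vacuous. -/
theorem Local.trans (h : Inv c) (hl : Local i c c') (hlin : c'.lin = c.lin)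
    (hs : (c.role i).Working → ∀ r ∈ c.la i ++ c.lb i,
      ((c'.role i).Working ∧ r ∈ c'.la i ++ c'.lb i) ∨ (c'.status r = .finished ∧ c.lin r)) :
    Trans i c c' where
  keep j hj _ := ⟨hl.la j hj, hl.lb j hj⟩
  serve hw r hr := (hs hw r hr).imp_right .inl
  status x hx := by
    by_cases h1 : (c.role i).op? = some x
    · exact .inr <| .inr <| .inr (h.own i x h1).2
    · by_cases h2 : x ∈ c.la i ++ c.lb i
      · exact .inr <| .inl h2
      · rcases (hl.other x h1 h2).2.2 with h3 | h3
        exacts [.inl h3, .inr <| .inr <| .inl h3]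
  linked j d r _ _ h1 h2 := by rw [hlin] at h1; exact (h2 h1).elim

theorem Trans.refl (c : Conf N) : Trans i c c where
  keep _ _ _ := ⟨rfl, rfl⟩
  serve hw _ hr := .inl ⟨hw, hr⟩
  status _ _ := .inl rfl
  linked _ _ _ _ _ h1 h2 := (h2 h1).elim

/-- For lines that write to no record. A released own operation has to remain recognizable as
released (`hgone`), and a working role may be given up only with empty lists (`hw`). -/
theorem Inv.relabel (h : Inv c) {r : Role}
    (hop : ∀ m, r.op? = some m → (c.role i).op? = some m)
    (hcapt : ∀ x, c.role i = .capt x → c.status x ≠ .init) (hcapt' : ∀ x, r ≠ .capt x)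
    (hgone : ∀ m, c.Gone m → (c.role i).op? = some m → r.op? = some m →
      r = .gone m ∨ r = .check m ∧ c.status m = .finished)
    (hr : c.RInv (c.la i) (c.lb i) r)
    (hw : (c.role i).Working → r.Working ∨ c.la i = [] ∧ c.lb i = []) :
    Inv { c with role := Function.update c.role i r } ∧
      Trans i c { c with role := Function.update c.role i r } := by
  have hl : Local i c { c with role := Function.update c.role i r } := by
    refine ⟨rfl, rfl, rfl, rfl, fun j hj => by simp [hj], fun _ _ => rfl, fun _ _ => rfl, ?_, hcapt,
      ?_, fun _ _ _ => ⟨rfl, rfl, .inl rfl⟩, fun _ _ _ => Iff.rfl, fun x hx => ⟨hx, rfl⟩,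
      fun x hx hx' => (hx' hx).elim, h.nodup i, fun m g ho => ⟨rfl, rfl, ?_⟩⟩
    · simpa using hop
    · simpa using hcapt'
    · simpa using hgone m g ho
  refine ⟨h.local hl fun hg _ => ?_, hl.trans h rfl fun hw' x hx => .inl ?_⟩
  · simp only [Function.update_self]
    exact hr.frame
      (fun _ _ _ => ⟨⟨rfl, rfl, rfl, rfl⟩, fun _ =>
        ⟨⟨rfl, rfl, rfl, rfl⟩, Iff.rfl, fun _ => Iff.rfl⟩⟩)
      (fun _ _ => ⟨⟨rfl, rfl, rfl, rfl⟩, Iff.rfl, fun _ => Iff.rfl⟩)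
      fun x g => ⟨hg x g, rfl, rfl, rfl⟩
  · rcases hw hw' with h1 | h1
    · exact ⟨by simpa using h1, hx⟩
    · rw [h1.1, h1.2] at hx; cases hx

end Conf
end DECS

/-! ### Signals FINISHED, unlinking and combination of lists -/

namespace DECS

/-- The roles of a thread whose operation is not captured and not completed. -/
def Role.Active : Role → Prop
  | .idle | .capt _ | .check _ | .gone _ => False
  | _ => True

namespace Conf

variable {N : ℕ} {c c' : Conf N} {i : Fin N}

theorem Inv.not_gone_of_active (h : Inv c) {m : ℕ} (hm : (c.role i).op? = some m)
    (ha : (c.role i).Active) : ¬ c.Gone m := by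
  intro g
  have := g.2
  rw [(h.own i m hm).2] at this
  rcases this hm with h1 | ⟨h1 | h1, -⟩ <;> rw [h1] at ha <;> exact ha

/-- A thread with an active role signals FINISHED to some operations, and writes to fields of
operations in its lists. -/
theorem Inv.write (h : Inv c) {r : Role} {m : ℕ} {st : ℕ → Status} {nx : ℕ → Option ℕ}
    {lt : ℕ → ℕ} {l l' : List ℕ} {la' lb' : Fin N → List ℕ}
    (hla : la' = Function.update c.la i l) (hlb : lb' = Function.update c.lb i l')
    (hm : (c.role i).op? = some m) (ha : (c.role i).Active)
    (hr : r.op? = some m) (hcapt : r ≠ .capt m)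
    (hst : ∀ x, x ≠ m → x ∉ c.la i ++ c.lb i →
      st x = c.status x ∨ c.Gone x ∧ st x = .finished)
    (hnx : ∀ x, x ≠ m → x ∉ c.la i ++ c.lb i → nx x = c.next x)
    (hlt : ∀ x, x ≠ m → x ∉ c.la i ++ c.lb i → lt x = c.last x)
    (hsub : (l ++ l').Sublist (c.la i ++ c.lb i)) (hst' : ∀ x ∈ l ++ l', st x = c.status x)
    (hrem : ∀ x ∈ c.la i ++ c.lb i, x ∉ l ++ l' → st x = .finished ∧ c.lin x)
    (hself : ∀ c' : Conf N, c' = { c with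
        status := st, next := nx, last := lt, role := Function.update c.role i r,
        la := la', lb := lb' } →
      (∀ x, c.Gone x → c'.Gone x) →
      (∀ x ∈ c.la i ++ c.lb i, st x = .finished → c'.Gone x) → c'.RInv l l' r)
    (hw : (c.role i).Working → r.Working) :
    Inv { c with status := st, next := nx, last := lt, role := Function.update c.role i r,
                 la := la', lb := lb' } ∧
      Trans i c { c with status := st, next := nx, last := lt, role := Function.update c.role i r,
                         la := la', lb := lb' } := by
  subst hla hlb
  have hl : Local i c { c with
      status := st, next := nx, last := lt, role := Function.update c.role i r,
      la := Function.update c.la i l, lb := Function.update c.lb i l' } := by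
    refine ⟨rfl, rfl, rfl, rfl, fun j hj => by simp [hj], fun j hj => by simp [hj],
      fun j hj => by simp [hj], ?_, fun x e => ?_, fun x => ?_, fun x ho hx => ?_,
      fun _ _ _ => Iff.rfl, ?_, ?_, ?_, fun x g ho => ?_⟩
    · simp [hm, hr]
    · rw [e] at ha; exact ha.elim
    · simp only [Function.update_self]
      rintro rfl
      cases hr; exact hcapt rfl
    · have : x ≠ m := by rintro rfl; exact ho hm
      exact ⟨hnx x this hx, hlt x this hx, hst x this hx⟩
    · simp only [Function.update_self]
      exact fun x hx => ⟨hsub.subset hx, hst' x hx⟩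
    · simp only [Function.update_self]
      exact fun x hx hx' => (hrem x hx hx').1
    · simp only [Function.update_self]
      exact hsub.nodup (h.nodup i)
    · rw [hm] at ho; cases ho
      exact (h.not_gone_of_active hm ha g).elim
  refine ⟨h.local hl ?_, hl.trans h rfl ?_⟩
  · simp only [Function.update_self]
    exact hself _ rfl
  · simp only [Function.update_self]
    intro hw' x hx
    by_cases hx' : x ∈ l ++ l'
    exacts [.inl ⟨hw hw', hx'⟩, .inr (hrem x hx hx')]

theorem nodup_cons_append {x : ℕ} {l l' : List ℕ} (h : (x :: l ++ l').Nodup) : x ∉ l ++ l' := by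
  rw [List.cons_append, List.nodup_cons] at h; exact h.1

/-- The cursor is at `m`, which is not in `la i`, or at the head of `la i`. Only in the second case
does the signal shorten the list; the length equation is what the comparison of ranks needs. -/
theorem Inv.finishEmpty (h : Inv c) {m cur : ℕ} (hr : c.role i = .empt m cur) :
    ∃ l, Inv { c with status := Function.update c.status cur .finished
                      role := Function.update c.role i (.emptNext m cur)
                      la := Function.update c.la i l } ∧
      Trans i c { c with status := Function.update c.status cur .finished
                         role := Function.update c.role i (.emptNext m cur)
                         la := Function.update c.la i l } ∧
      l.length + (if cur = m then 0 else 1) = (c.la i).length := by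
  have hm : (c.role i).op? = some m := by rw [hr]; rfl
  have hri := h.rinv i
  rw [hr] at hri
  obtain ⟨h1, h2, h3⟩ := hri
  have key := fun l => h.write (r := .emptNext m cur) (st := Function.update c.status cur .finished)
    (nx := c.next) (lt := c.last) (l := l) (l' := c.lb i)
    (la' := Function.update c.la i l) (lb' := c.lb) rfl (by simp) hm (by rw [hr]; trivial)
    rfl (by simp)
  rcases h3 with ⟨rfl, h3⟩ | h3
  · have hnot := h.not_held_of_op (j := i) hm (by simp [hr])
    obtain ⟨k1, k2⟩ := key (c.la i)
      (fun x hx hx' => .inl (by simp [hx])) (fun _ _ _ => rfl) (fun _ _ _ => rfl)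
      (List.Sublist.refl _) (fun x hx => by
        have : x ≠ cur := by rintro rfl; exact hnot hx
        simp [this])
      (fun x hx hx' => (hx' hx).elim)
      (by
        rintro _ rfl hg _
        exact ⟨h1, h2, .inl rfl, h3⟩)
      (fun _ => trivial)
    exact ⟨c.la i, k1, k2, by simp⟩
  · obtain ⟨l, hl⟩ : ∃ l, c.la i = cur :: l := by
      cases e : c.la i with
      | nil => rw [e] at h3; cases h3
      | cons x l => rw [e] at h3; cases h3.1; exact ⟨l, rfl⟩
    have hnd := h.nodup i
    rw [hl] at hnd
    have hnd := nodup_cons_append hnd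
    have hcm : cur ≠ m := by
      rintro rfl
      exact h.not_held_of_op (j := i) hm (by simp [hr]) (by simp [hl])
    obtain ⟨k1, k2⟩ := key l
      (fun x hx hx' => .inl (by
        have : x ≠ cur := by rintro rfl; exact hx' (by simp [hl])
        simp [this])) (fun _ _ _ => rfl) (fun _ _ _ => rfl)
      (by rw [hl]; simp) (fun x hx => by
        have : x ≠ cur := by rintro rfl; exact hnd hx
        simp [this])
      (fun x hx hx' => by
        have : x = cur := by
          rw [hl, List.cons_append, List.mem_cons] at hx
          exact hx.resolve_right hx'
        subst this
        exact ⟨by simp, (h2 x (by simp [hl])).1⟩)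
      (by
        rintro _ rfl hg hf
        rw [hl] at h2 h3 
        exact ⟨h1, fun x hx => h2 x (by simp [hx]), .inr (hf cur (by simp [hl]) (by simp)), h3.2⟩)
      (fun _ => trivial)
    exact ⟨l, k1, k2, by simp [hl, hcm]⟩

theorem Inv.finishNext (h : Inv c) {m w : ℕ} (hr : c.role i = .hand m) (hw : c.next m = some w) :
    ∃ l, Inv { c with status := Function.update c.status w .finished
                      role := Function.update c.role i (.unlink m)
                      la := Function.update c.la i l } ∧
      Trans i c { c with status := Function.update c.status w .finished
                         role := Function.update c.role i (.unlink m)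
                         la := Function.update c.la i l } ∧
      l.length + 1 = (c.la i).length := by
  have hm : (c.role i).op? = some m := by rw [hr]; rfl
  have hri := h.rinv i
  rw [hr] at hri
  obtain ⟨h1, h2, h3, -⟩ := hri
  have key := fun l => h.write (r := .unlink m) (st := Function.update c.status w .finished)
    (nx := c.next) (lt := c.last) (l := l) (l' := c.lb i)
    (la' := Function.update c.la i l) (lb' := c.lb) rfl (by simp) hm (by rw [hr]; trivial)
    rfl (by simp)
  obtain ⟨l, hl⟩ : ∃ l, c.la i = w :: l := by
    cases e : c.la i with
    | nil => rw [e, hw] at h3; cases h3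
    | cons x l => rw [e, hw] at h3; cases h3.1; exact ⟨l, rfl⟩
  have hnd := h.nodup i
  rw [hl] at hnd
  have hnd := nodup_cons_append hnd
  obtain ⟨k1, k2⟩ := key l
    (fun x hx hx' => .inl (by
      have : x ≠ w := by rintro rfl; exact hx' (by simp [hl])
      simp [this])) (fun _ _ _ => rfl) (fun _ _ _ => rfl)
    (by rw [hl]; simp) (fun x hx => by
      have : x ≠ w := by rintro rfl; exact hnd hx
      simp [this])
    (fun x hx hx' => by
      have : x = w := by
        rw [hl, List.cons_append, List.mem_cons] at hx
        exact hx.resolve_right hx'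
      subst this
      exact ⟨by simp, (h2 x (by simp [hl])).1⟩)
    (by
      rintro _ rfl hg hf
      rw [hl] at h2 h3 
      exact ⟨h1, fun x hx => h2 x (by simp [hx]), w, hw, hf w (by simp [hl]) (by simp), h3.2⟩)
    (fun _ => trivial)
  exact ⟨l, k1, k2, by simp [hl]⟩

/-- A nonempty suffix has the same last element, so the `last` pointers stay correct while the lists
are consumed from the front. -/
theorem Elim.mono {m p : ℕ} {l l' k k' : List ℕ} (h : c.Elim m p l l')
    (hg : ∀ x, c.Gone x → c'.Gone x) (ho : c'.op = c.op) (hd : c'.del = c.del)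
    (hl : c'.last = c.last)
    (hk : k <:+ l) (hk' : k' <:+ l') : c'.Elim m p k k' := by
  have e : ∀ {l k : List ℕ} {y}, k <:+ l → EndsAt l y → EndsAt k y := by
    rintro l k y ⟨a, rfl⟩ h z hz
    refine h z ?_
    rw [List.getLast?_append, hz]; rfl
  refine ⟨hg p h.gone, ?_, ?_, ?_, ?_, ?_, ?_, ?_⟩
  · rw [ho]; exact h.ne
  · rw [hd]; exact fun x hx => h.delA x (hk.subset hx)
  · rw [hd]; exact fun x hx => h.delB x (hk'.subset hx)
  · rw [ho]; exact fun x hx => h.kindA x (hk.subset hx)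
  · rw [ho]; exact fun x hx => h.kindB x (hk'.subset hx)
  · rw [hl]; exact e hk h.endsA
  · rw [hl]; exact e hk' h.endsB

/-- In the first round the cursors are at `m` and `p`, which are in neither list; in later rounds
they are at the heads of `la i` and `lb i`. In these rounds the head `q` of `lb i` stays in place
with its linearization recorded, until `finishP` removes it. -/
theorem Inv.finishA (h : Inv c) {m p a q : ℕ} (hr : c.role i = .elimA m p a q) :
    ∃ l, Inv { c with status := Function.update c.status a .finished
                      role := Function.update c.role i (.elimP m p a q)
                      la := Function.update c.la i l } ∧
      Trans i c { c with status := Function.update c.status a .finished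
                         role := Function.update c.role i (.elimP m p a q)
                         la := Function.update c.la i l } ∧
      l.length + (if q = p then 0 else 1) = (c.la i).length ∧ (a = m ↔ q = p) := by
  have hm : (c.role i).op? = some m := by rw [hr]; rfl
  have hri := h.rinv i
  rw [hr] at hri
  obtain ⟨h1, h2, h3⟩ := hri
  have key := fun l => h.write (r := .elimP m p a q) (st := Function.update c.status a .finished)
    (nx := c.next) (lt := c.last) (l := l) (l' := c.lb i)
    (la' := Function.update c.la i l) (lb' := c.lb) rfl (by simp) hm (by rw [hr]; trivial)
    rfl (by simp)
  have hnot := h.not_held_of_op (j := i) hm (by simp [hr])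
  rcases h3 with ⟨rfl, rfl, h3, h4⟩ | ⟨h3, h4⟩
  · obtain ⟨k1, k2⟩ := key (c.la i)
      (fun x hx hx' => .inl (by simp [hx])) (fun _ _ _ => rfl) (fun _ _ _ => rfl)
      (List.Sublist.refl _) (fun x hx => by
        have : x ≠ a := by rintro rfl; exact hnot hx
        simp [this])
      (fun x hx hx' => (hx' hx).elim)
      (by
        rintro _ rfl hg _
        exact ⟨h1.mono hg rfl rfl rfl (List.suffix_refl _) (List.suffix_refl _), .inl rfl, h3,
          .inl ⟨rfl, h4, h2⟩⟩)
      (fun _ => trivial)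
    exact ⟨c.la i, k1, k2, by simp, by simp⟩
  · obtain ⟨l, hl⟩ : ∃ l, c.la i = a :: l := by
      cases e : c.la i with
      | nil => rw [e] at h3; cases h3
      | cons x l => rw [e] at h3; cases h3.1; exact ⟨l, rfl⟩
    obtain ⟨l', hl'⟩ : ∃ l, c.lb i = q :: l := by
      cases e : c.lb i with
      | nil => rw [e] at h4; cases h4
      | cons x l => rw [e] at h4; cases h4.1; exact ⟨l, rfl⟩
    have hnd := h.nodup i
    rw [hl] at hnd
    have hnd := nodup_cons_append hnd
    have hcm : a ≠ m := by
      rintro rfl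
      exact hnot (by simp [hl])
    have hqp : q ≠ p := by
      rintro rfl
      exact h.not_gone_of_held (j := i) (by simp [hl']) h1.gone
    rw [hl, hl'] at h2
    obtain ⟨k1, k2⟩ := key l
      (fun x hx hx' => .inl (by
        have : x ≠ a := by rintro rfl; exact hx' (by simp [hl])
        simp [this])) (fun _ _ _ => rfl) (fun _ _ _ => rfl)
      (by rw [hl]; simp) (fun x hx => by
        have : x ≠ a := by rintro rfl; exact hnd hx
        simp [this])
      (fun x hx hx' => by
        have : x = a := by
          rw [hl, List.cons_append, List.mem_cons] at hx
          exact hx.resolve_right hx'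
        subst this
        exact ⟨by simp, h2.1⟩)
      (by
        rintro _ rfl hg hf
        refine ⟨h1.mono hg rfl rfl rfl (by rw [hl]; simp) (List.suffix_refl _),
          .inr (hf a (by simp [hl]) (by simp)), ?_, .inr ⟨l', hl', h2.2.1, ?_, h2.2.2⟩⟩
        · rw [hl] at h3; exact h3.2
        · rw [hl'] at h4; exact h4.2)
      (fun _ => trivial)
    exact ⟨l, k1, k2, by simp [hl, hqp], by simp [hcm, hqp]⟩

/-- In the first round `q = p` was released when it was captured, so that FINISHED is written to a
released record, which `Inv.write` permits. In later rounds `q` is the head of `lb i`. -/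
theorem Inv.finishP (h : Inv c) {m p a q : ℕ} (hr : c.role i = .elimP m p a q) :
    ∃ l, Inv { c with status := Function.update c.status q .finished
                      role := Function.update c.role i (.elimNext m p a q)
                      lb := Function.update c.lb i l } ∧
      Trans i c { c with status := Function.update c.status q .finished
                         role := Function.update c.role i (.elimNext m p a q)
                         lb := Function.update c.lb i l } ∧
      l.length + (if q = p then 0 else 1) = (c.lb i).length := by
  have hm : (c.role i).op? = some m := by rw [hr]; rfl
  have hri := h.rinv i
  rw [hr] at hri
  obtain ⟨h1, h2, h3, h4⟩ := hri
  have key := fun l' => h.write (r := .elimNext m p a q)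
    (st := Function.update c.status q .finished)
    (nx := c.next) (lt := c.last) (l := c.la i) (l' := l')
    (la' := c.la) (lb' := Function.update c.lb i l') (by simp) rfl hm (by rw [hr]; trivial)
    rfl (by simp)
  rcases h4 with ⟨rfl, h4, h5⟩ | ⟨l', hl', h4, h5, h6⟩
  · obtain ⟨k1, k2⟩ := key (c.lb i)
      (fun x hx hx' => by
        by_cases e : x = q
        · subst e; exact .inr ⟨h1.gone, by simp⟩
        · exact .inl (by simp [e])) (fun _ _ _ => rfl) (fun _ _ _ => rfl)
      (List.Sublist.refl _) (fun x hx => by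
        have : x ≠ q := by rintro rfl; exact h.not_gone_of_held hx h1.gone
        simp [this])
      (fun x hx hx' => (hx' hx).elim)
      (by
        rintro _ rfl hg _
        exact ⟨h1.mono hg rfl rfl rfl (List.suffix_refl _) (List.suffix_refl _),
          h2.imp_right (hg _), hg _ h1.gone, h3, h4, h5⟩)
      (fun _ => trivial)
    exact ⟨c.lb i, k1, k2, by simp⟩
  · have hqp : q ≠ p := by
      rintro rfl
      exact h.not_gone_of_held (j := i) (by simp [hl']) h1.gone
    have hnd := h.nodup i
    rw [hl', List.nodup_append, List.nodup_cons] at hnd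
    have hnd : q ∉ c.la i ++ l' := by
      simp only [List.mem_append, not_or]
      exact ⟨fun hq => hnd.2.2 q hq q (by simp) rfl, hnd.2.1.1⟩
    obtain ⟨k1, k2⟩ := key l'
      (fun x hx hx' => .inl (by
        have : x ≠ q := by rintro rfl; exact hx' (by simp [hl'])
        simp [this])) (fun _ _ _ => rfl) (fun _ _ _ => rfl)
      (by rw [hl']; simp) (fun x hx => by
        have : x ≠ q := by rintro rfl; exact hnd hx
        simp [this])
      (fun x hx hx' => by
        have : x = q := by
          simp only [hl', List.mem_append, List.mem_cons] at hx hx'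
          tauto
        subst this
        exact ⟨by simp, h4⟩)
      (by
        rintro _ rfl hg hf
        exact ⟨h1.mono hg rfl rfl rfl (List.suffix_refl _) (by rw [hl']; simp),
          h2.imp_right (hg _), hf q (by simp [hl']) (by simp), h3, h5, h6⟩)
      (fun _ => trivial)
    exact ⟨l', k1, k2, by simp [hl', hqp]⟩

/-- The thread of `w` may have returned since the signal, but the `next` field of a released record
still leads to the rest of the list. -/
theorem Inv.unlinkNext (h : Inv c) {m w : ℕ} (hr : c.role i = .unlink m) (hw : c.next m = some w) :
    Inv { c with next := Function.update c.next m (c.next w)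
                 role := Function.update c.role i (.give m) } ∧
      Trans i c { c with next := Function.update c.next m (c.next w)
                         role := Function.update c.role i (.give m) } := by
  have hm : (c.role i).op? = some m := by rw [hr]; rfl
  have hri := h.rinv i
  rw [hr] at hri
  obtain ⟨h1, h2, w', h3, h4, h5⟩ := hri
  have : w' = w := Option.some_injective _ (h3.symm.trans hw)
  subst this
  have hnot := h.not_held_of_op (j := i) hm (by simp [hr])
  have key := h.write (r := .give m) (st := c.status)
    (nx := Function.update c.next m (c.next w')) (lt := c.last) (l := c.la i) (l' := c.lb i)
    (la' := c.la) (lb' := c.lb) (by simp) (by simp) hm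
    (by rw [hr]; trivial) rfl (by simp)
  refine key (fun _ _ _ => .inl rfl) (fun x hx _ => by simp [hx]) (fun _ _ _ => rfl)
    (List.Sublist.refl _) (fun _ _ => rfl) (fun x hx hx' => (hx' hx).elim) ?_ (fun _ => trivial)
  rintro _ rfl hg hf
  refine ⟨h1, h2, ?_⟩
  simp only [Function.update_self]
  refine h5.congr fun x hx => ?_
  have : x ≠ m := by rintro rfl; exact hnot (by simp [hx])
  simp [this]

/-- The write at the last record `z` joins the two lists: since there are no repetitions it alters
no earlier link of the first list, and since `z ∉ l'` no link of the second. -/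
theorem IsList.append {next : ℕ → Option ℕ} {l l' : List ℕ} {o : Option ℕ} {m z : ℕ}
    (hnd : (m :: l).Nodup) (hl : IsList next (next m) l) (hz : (m :: l).getLast? = some z)
    (hl' : IsList next o l') (hne : z ∉ l') :
    IsList (Function.update next z o) (Function.update next z o m) (l ++ l') := by
  induction l generalizing m with
  | nil =>
    simp at hz
    subst hz
    simp only [Function.update_self, List.nil_append]
    exact hl'.congr fun x hx => by
      have : x ≠ m := by rintro rfl; exact hne hx
      simp [this]
  | cons y l ih =>
    have hz' : (y :: l).getLast? = some z := by simpa using hz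
    have hmz : m ≠ z := by
      rintro rfl
      exact (List.nodup_cons.1 hnd).1 (List.mem_of_getLast? hz')
    refine ⟨?_, ih (List.nodup_cons.1 hnd).2 hl.2 hz'⟩
    simpa [hmz] using hl.1

/-- The auxiliary list already is `l₁ ++ p :: l₂` since the capture; this write makes the linked
list agree with it. -/
theorem Inv.link (h : Inv c) {m p : ℕ} (hr : c.role i = .merge m p) :
    Inv { c with next := Function.update c.next (c.last m) (some p)
                 role := Function.update c.role i (.merged m p) } ∧
      Trans i c { c with next := Function.update c.next (c.last m) (some p)
                         role := Function.update c.role i (.merged m p) } := by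
  have hm : (c.role i).op? = some m := by rw [hr]; rfl
  have hri := h.rinv i
  rw [hr] at hri
  obtain ⟨h1, h2, h3, h4, l₁, l₂, h5, h6, h7, h8, h9⟩ := hri
  have hnot := h.not_held_of_op (j := i) hm (by simp [hr])
  have hnd : (m :: c.la i).Nodup := by
    rw [List.nodup_cons]
    refine ⟨fun hx => hnot (by simp [hx]), ?_⟩
    have := h.nodup i
    rw [h1] at this; simpa using this
  rw [h5] at hnd
  obtain ⟨z, hz⟩ : ∃ z, (m :: l₁).getLast? = some z := ⟨_, List.getLast?_eq_some_getLast (by simp)⟩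
  have hz' : z = c.last m := h8 z hz
  have hzm : z ∈ m :: l₁ := List.mem_of_getLast? hz
  -- The record that is written belongs to the first part, hence not to the second.
  have hz2 : z ∉ p :: l₂ := by
    rw [← List.cons_append, List.nodup_append] at hnd
    exact fun hx => hnd.2.2 z hzm z hx rfl
  have key := h.write (r := .merged m p) (st := c.status)
    (nx := Function.update c.next (c.last m) (some p)) (lt := c.last) (l := c.la i) (l' := c.lb i)
    (la' := c.la) (lb' := c.lb) (by simp) (by simp) hm
    (by rw [hr]; trivial) rfl (by simp)
  refine key (fun _ _ _ => .inl rfl) (fun x hx hx' => ?_) (fun _ _ _ => rfl)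
    (List.Sublist.refl _) (fun _ _ => rfl) (fun x hx hx' => (hx' hx).elim) ?_
    (fun hw => by rw [hr] at hw; exact hw.elim)
  · have : x ≠ c.last m := by
      rintro rfl
      rw [← hz'] at hx hx'
      rw [List.mem_cons] at hzm
      refine hx' ?_
      rw [h5]; simp [hzm.resolve_left hx]
    simp [this]
  · rintro _ rfl hg hf
    refine ⟨h1, h2, h3, h4, ?_, by simp [h5], ?_⟩
    · rw [h5, ← hz']
      refine IsList.append ?_ h6 hz ⟨rfl, h7⟩ hz2
      rw [← List.cons_append, List.nodup_append] at hnd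
      exact hnd.1
    · intro y hy
      refine h9 y ?_
      rw [h5] at hy
      rw [← List.cons_append] at hy
      rw [List.getLast?_append] at hy
      obtain ⟨y', hy'⟩ : ∃ y', (p :: l₂).getLast? = some y' :=
        ⟨_, List.getLast?_eq_some_getLast (by simp)⟩
      rw [hy'] at hy ⊢
      exact hy

theorem Inv.relast (h : Inv c) {m p : ℕ} (hr : c.role i = .merged m p) :
    Inv { c with last := Function.update c.last m (c.last p)
                 role := Function.update c.role i (.free m) } ∧
      Trans i c { c with last := Function.update c.last m (c.last p)
                         role := Function.update c.role i (.free m) } := by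
  have hm : (c.role i).op? = some m := by rw [hr]; rfl
  have hri := h.rinv i
  rw [hr] at hri
  obtain ⟨h1, h2, h3, h4, h5, h6, h7⟩ := hri
  have key := h.write (r := .free m) (st := c.status)
    (nx := c.next) (lt := Function.update c.last m (c.last p)) (l := c.la i) (l' := c.lb i)
    (la' := c.la) (lb' := c.lb) (by simp) (by simp) hm
    (by rw [hr]; trivial) rfl (by simp)
  refine key (fun _ _ _ => .inl rfl) (fun _ _ _ => rfl) (fun x hx hx' => by simp [hx])
    (List.Sublist.refl _) (fun _ _ => rfl) (fun x hx hx' => (hx' hx).elim) ?_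
    (fun hw => by rw [hr] at hw; exact hw.elim)
  rintro _ rfl hg hf
  exact ⟨h1, h2, fun x hx => (h3 x hx).1, fun x hx => (h3 x hx).2, h5, by simpa using h7, h4⟩

theorem Inv.residueLast (h : Inv c) {m src k : ℕ} (hr : c.role i = .residue m src k) :
    Inv { c with last := Function.update c.last k (c.last src)
                 role := Function.update c.role i (.residueRetry m src k) } ∧
      Trans i c { c with last := Function.update c.last k (c.last src)
                         role := Function.update c.role i (.residueRetry m src k) } := by
  have hm : (c.role i).op? = some m := by rw [hr]; rfl
  have hri := h.rinv i
  rw [hr] at hri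
  have hri : c.Residue m src k _ := hri
  have hk := hri.link.head_mem
  have key := h.write (r := .residueRetry m src k) (st := c.status)
    (nx := c.next) (lt := Function.update c.last k (c.last src)) (l := c.la i) (l' := c.lb i)
    (la' := c.la) (lb' := c.lb) (by simp) (by simp) hm
    (by rw [hr]; trivial) rfl (by simp)
  refine key (fun _ _ _ => .inl rfl) (fun _ _ _ => rfl) (fun x hx hx' => ?_)
    (List.Sublist.refl _) (fun _ _ => rfl) (fun x hx hx' => (hx' hx).elim) ?_ (fun _ => trivial)
  · have : x ≠ k := by rintro rfl; exact hx' hk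
    simp [this]
  rintro _ rfl hg hf
  -- The source is the own operation or a released one, whereas the head of the residue is held. So
  -- the write does not destroy `last src`.
  have hks : src ≠ k := by
    rintro rfl
    rcases hri.gone with e | e
    · subst e
      exact h.not_held_of_op (j := i) hm (by simp [hr]) hk
    · exact h.not_gone_of_held hk e
  refine ⟨⟨hri.gone.imp_right (hg _), hri.link, hri.fresh, hri.del, hri.kind, ?_⟩, ?_⟩
  · simpa [hks] using hri.ends
  · simpa using hri.ends

theorem Inv.reset (h : Inv c) {m : ℕ} (hr : c.role i = .ready m) :
    Inv { c with status := Function.update c.status m .init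
                 role := Function.update c.role i (.free m) } ∧
      Trans i c { c with status := Function.update c.status m .init
                         role := Function.update c.role i (.free m) } := by
  have hm : (c.role i).op? = some m := by rw [hr]; rfl
  have hri := h.rinv i
  rw [hr] at hri
  obtain ⟨h1, h2, h3⟩ := hri
  have hnot := h.not_held_of_op (j := i) hm (by simp [hr])
  have key := h.write (r := .free m) (st := Function.update c.status m .init)
    (nx := c.next) (lt := c.last) (l := c.la i) (l' := c.lb i)
    (la' := c.la) (lb' := c.lb) (by simp) (by simp) hm
    (by rw [hr]; trivial) rfl (by simp)
  refine key (fun x hx _ => .inl (by simp [hx])) (fun _ _ _ => rfl) (fun x hx hx' => rfl)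
    (List.Sublist.refl _) (fun x hx => ?_) (fun x hx hx' => (hx' hx).elim) ?_
    (fun hw => by rw [hr] at hw; exact hw.elim)
  · have : x ≠ m := by rintro rfl; exact hnot hx
    simp [this]
  rintro _ rfl hg hf
  exact ⟨h1, by simp, h3.fresh, h3.del, h3.link, h3.ends, h3.kind⟩

end Conf
end DECS

/-! ### Delegates, linearization of a list, and combining captures -/

namespace DECS
namespace Conf

variable {N : ℕ} {c c' : Conf N} {i : Fin N}

/-- It serves to show that redirecting delegates or linearizing a list does not affect the own
operations of uninvolved threads with rooted roles: these are their own delegates. -/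
theorem Inv.root (h : Inv c) {m : ℕ} (hm : (c.role i).op? = some m) (hr : c.Rooted (c.role i)) :
    ¬ c.lin m ∧ ∀ d, c.del d m ↔ d = m := by
  have hi := h.rinv i
  cases e : c.role i <;> rw [e] at hm hr hi <;> cases hm <;> try exact hr.elim
  · exact ⟨hi.2.2.fresh _ (by simp), hi.2.2.del _ (by simp)⟩
  · exact hi.2.2.1 _ (by simp)
  · exact hi.2.2.1 _ (by simp)
  · have := hi.2.1 hr
    exact ⟨this.fresh _ (by simp), this.del _ (by simp)⟩
  · have := hi.2.2.1 hr
    exact ⟨this.fresh _ (by simp), this.del _ (by simp)⟩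
  · exact ⟨hi.2.2.fresh _ (by simp), hi.2.2.del _ (by simp)⟩

/-- The delegate of a captured operation that has not been signalled. -/
theorem Inv.delegate (h : Inv c) {j : Fin N} {r : ℕ} (hr : r ∈ c.la j ++ c.lb j) :
    ∃ d₀, (∀ d, c.del d r ↔ d = d₀) ∧ (((c.role j).op? = some d₀ ∧
      (c.role j = .capt d₀ → c.status d₀ = .retry)) ∨ c.Gone d₀ ∧ (c.role j).Working) := by
  have hi := h.rinv j
  have hb : c.lb j = [] → r ∈ c.la j := fun e => by simpa [e] using hr
  -- The list of a captured thread is nonempty only after RETRY.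
  have capt : ∀ m, (c.status m = .retry → c.Root m (c.la j)) →
      (c.status m ≠ .retry → c.la j = []) → c.lb j = [] →
      c.status m = .retry ∧ ∀ d, c.del d r ↔ d = m := by
    intro m h1 h2 h3
    by_cases e : c.status m = .retry
    · exact ⟨e, (h1 e).del r (by simp [hb h3])⟩
    · have := hb h3
      rw [h2 e] at this; cases this
  have elim : ∀ m p, c.Elim m p (c.la j) (c.lb j) → (c.role j).op? = some m → (c.role j).Working →
      (∀ x, c.role j ≠ .capt x) →
      ∃ d₀, (∀ d, c.del d r ↔ d = d₀) ∧ (((c.role j).op? = some d₀ ∧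
        (c.role j = .capt d₀ → c.status d₀ = .retry)) ∨ c.Gone d₀ ∧ (c.role j).Working) := by
    intro m p he hm hw hc
    rcases List.mem_append.1 hr with hr | hr
    · exact ⟨m, he.delA r hr, .inl ⟨hm, fun e => (hc _ e).elim⟩⟩
    · exact ⟨p, he.delB r hr, .inr ⟨he.gone, hw⟩⟩
  have res : ∀ m src k, c.Residue m src k (c.la j ++ c.lb j) → (c.role j).op? = some m →
      (c.role j).Working → (∀ x, c.role j ≠ .capt x) →
      ∃ d₀, (∀ d, c.del d r ↔ d = d₀) ∧ (((c.role j).op? = some d₀ ∧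
        (c.role j = .capt d₀ → c.status d₀ = .retry)) ∨ c.Gone d₀ ∧ (c.role j).Working) := by
    intro m src k he hm hw hc
    refine ⟨src, he.del r hr, ?_⟩
    rcases he.gone with rfl | g
    · exact .inl ⟨hm, fun e => (hc _ e).elim⟩
    · exact .inr ⟨g, hw⟩
  cases e : c.role j <;> rw [e] at hi
  case idle => rw [hi.1, hi.2] at hr; cases hr
  case gone m => rw [hi.1, hi.2] at hr; cases hr
  case free m => exact ⟨m, hi.2.2.del r (by simp [hb hi.1]), .inl ⟨rfl, by simp⟩⟩
  case merge m p => exact ⟨m, (hi.2.2.1 r (by simp [hb hi.1])).2, .inl ⟨rfl, by simp⟩⟩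
  case merged m p => exact ⟨m, (hi.2.2.1 r (by simp [hb hi.1])).2, .inl ⟨rfl, by simp⟩⟩
  case empt m cur => exact ⟨m, (hi.2.1 r (hb hi.1)).2, .inl ⟨rfl, by simp⟩⟩
  case emptNext m cur => exact ⟨m, (hi.2.1 r (hb hi.1)).2, .inl ⟨rfl, by simp⟩⟩
  case give m => exact ⟨m, (hi.2.1 r (hb hi.1)).2, .inl ⟨rfl, by simp⟩⟩
  case hand m => exact ⟨m, (hi.2.1 r (hb hi.1)).2, .inl ⟨rfl, by simp⟩⟩
  case unlink m => exact ⟨m, (hi.2.1 r (hb hi.1)).2, .inl ⟨rfl, by simp⟩⟩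
  case elimA m p a q =>
    rw [← e]; exact elim m p hi.1 (by rw [e]; rfl) (by rw [e]; trivial) (by simp [e])
  case elimP m p a q =>
    rw [← e]; exact elim m p hi.1 (by rw [e]; rfl) (by rw [e]; trivial) (by simp [e])
  case elimNext m p a q =>
    rw [← e]; exact elim m p hi.1 (by rw [e]; rfl) (by rw [e]; trivial) (by simp [e])
  case elimTest m p a q =>
    rw [← e]; exact elim m p hi.1 (by rw [e]; rfl) (by rw [e]; trivial) (by simp [e])
  case residue m s k =>
    rw [← e]; exact res m s k hi (by rw [e]; rfl) (by rw [e]; trivial) (by simp [e])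
  case residueRetry m s k =>
    rw [← e]; exact res m s k hi.1 (by rw [e]; rfl) (by rw [e]; trivial) (by simp [e])
  case capt m =>
    obtain ⟨h1, h2⟩ := capt m hi.2.1 hi.2.2 hi.1
    exact ⟨m, h2, .inl ⟨rfl, fun _ => h1⟩⟩
  case check m =>
    obtain ⟨h1, h2⟩ := capt m hi.2.2.1 hi.2.2.2 hi.2.1
    exact ⟨m, h2, .inl ⟨rfl, by simp⟩⟩
  case ready m => exact ⟨m, hi.2.2.del r (by simp [hb hi.1]), .inl ⟨rfl, by simp⟩⟩

/-- If the delegate of a captured operation is an operation with a free role, then it belongs to the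
responsible thread. -/
theorem Inv.eq_of_free (h : Inv c) {j : Fin N} {r m : ℕ} (hr : r ∈ c.la j ++ c.lb j)
    (hi : c.role i = .free m) (hd : c.del m r) : j = i := by
  obtain ⟨d₀, h1, h2⟩ := h.delegate hr
  have := (h1 m).1 hd
  subst this
  have ho : (c.role i).op? = some m := by rw [hi]; rfl
  rcases h2 with h2 | h2
  · exact (h.own j m h2.1).2.symm.trans (h.own i m ho).2
  · exact (h.not_gone_of_active ho (by rw [hi]; trivial) h2.1).elim

/-- The delegate of a captured operation is not captured. -/
theorem Inv.del_not_held (h : Inv c) {j k : Fin N} {r d : ℕ} (hr : r ∈ c.la j ++ c.lb j)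
    (hd : c.del d r) : d ∉ c.la k ++ c.lb k := by
  intro hx
  obtain ⟨h1, h2, h3⟩ := h.held k d hx
  obtain ⟨d₀, h4, h5⟩ := h.delegate hr
  have := (h4 d).1 hd
  subst this
  rcases h5 with h5 | h5
  · rw [(h.own j d h5.1).2] at h3
    rw [h5.2 h3] at h2; cases h2
  · exact h.not_gone_of_held hx h5.1

/-- The step of `cMultiPop` or `cMultiPush` that linearizes a list. -/
theorem Inv.linearize (h : Inv c) {m : ℕ} (hi : c.role i = .free m) {r : Role}
    (hr : r = .empt m m ∨ r = .give m) {lin' : ℕ → Prop}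
    (hlin : ∀ x, lin' x ↔ c.lin x ∨ x ∈ m :: c.la i) :
    Inv { c with role := Function.update c.role i r, lin := lin' } ∧
      Trans i c { c with role := Function.update c.role i r, lin := lin' } := by
  have hm : (c.role i).op? = some m := by rw [hi]; rfl
  have hri := h.rinv i
  rw [hi] at hri
  obtain ⟨h1, h2, h3⟩ := hri
  have hl : Local i c { c with role := Function.update c.role i r, lin := lin' } := by
    refine ⟨rfl, rfl, rfl, rfl, fun j hj => by simp [hj], fun j hj => rfl,
      fun j hj => rfl, ?_, by simp [hi], fun x => ?_, fun x ho hx => ⟨rfl, rfl, .inl rfl⟩,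
      fun x ho hx => ?_, fun x hx => ⟨hx, rfl⟩, fun x hx hx' => (hx' hx).elim, h.nodup i,
      fun x g ho => ?_⟩
    · rcases hr with rfl | rfl <;> simp [hi, Role.op?]
    · rcases hr with rfl | rfl <;> simp
    · rw [hm] at ho
      have : x ≠ m := by rintro rfl; exact ho rfl
      have : x ∉ c.la i := by simp at hx; exact hx.1
      simp [*]
    · rw [hm] at ho; cases ho
      exact (h.not_gone_of_active hm (by rw [hi]; trivial) g).elim
  have hw : r.Working := by rcases hr with rfl | rfl <;> trivial
  have hs : ∀ {c' : Conf N}, c'.lin = lin' → c'.del = c.del → c'.Served m (c.la i) := by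
    intro c' e1 e2 x hx
    rw [e1, e2]
    exact ⟨(hlin x).2 (.inr (by simp [hx])), h3.del x (by simp [hx])⟩
  refine ⟨h.local hl fun _ _ => ?_, fun j hj _ => ⟨rfl, rfl⟩, fun hw => ?_, fun x _ => .inl rfl,
    fun j d x hx hd hl1 hl2 => ?_⟩
  · simp only [Function.update_self]
    rcases hr with rfl | rfl
    · exact ⟨h1, hs rfl rfl, .inl ⟨rfl, h3.link⟩⟩
    · exact ⟨h1, hs rfl rfl, h3.link⟩
  · rw [hi] at hw; exact hw.elim
  · simp only [Function.update_self]
    refine ⟨hw, ?_⟩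
    rcases List.mem_cons.1 (((hlin d).1 hl1).resolve_left hl2) with rfl | hd'
    · rwa [h.eq_of_free hx hi hd] at hx
    · exact (h.del_not_held (k := i) hx hd (by simp [hd'])).elim

theorem GoneSame.of_eq (hn : c'.n = c.n) (hid : c'.id = c.id) (hop : c'.op = c.op)
    (hf : ∀ x, c.Gone x → c'.next x = c.next x ∧ c'.last x = c.last x ∧ c'.status x = c.status x)
    (hr : ∀ x, c.Gone x → c'.role (c.id x) = c.role (c.id x) ∨ c'.role (c.id x) = .gone x ∨
      (c'.role (c.id x)).op? ≠ some x) : GoneSame c c' := by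
  intro x g
  obtain ⟨h1, h2, h3⟩ := hf x g
  refine ⟨⟨hn ▸ g.1, fun ho => ?_⟩, h1, h2, by rw [hop]⟩
  rw [hid] at ho ⊢
  rw [h3]
  rcases hr x g with e | e | e
  · rw [e] at ho ⊢; exact g.2 ho
  · exact .inl e
  · exact (e ho).elim

/-- It translates equal positions, as in the definition of the linearization point, into the
recursive form that is consumed round by round. Without repetitions, a later element is never
matched through the two heads. -/
theorem Pairs.of_getElem {lin : ℕ → Prop} {l l' : List ℕ} (hnd : (l ++ l').Nodup)
    (h : ∀ x ∈ l ++ l', (lin x ↔ ∃ (n a b : ℕ), l[n]? = some a ∧ l'[n]? = some b ∧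
      (x = a ∨ x = b))) :
    Pairs lin l l' := by
  induction l generalizing l' with
  | nil =>
    have : ∀ x ∈ l', ¬ lin x := fun x hx => by
      rw [h x (by simpa using hx)]; simp
    cases l' with
    | nil => simp [Pairs]
    | cons b l' => exact this
  | cons a l ih =>
    cases l' with
    | nil =>
      intro x hx
      rw [h x (by simpa using hx)]; simp
    | cons b l' =>
      refine ⟨(h a (by simp)).2 ⟨0, a, b, by simp⟩, (h b (by simp)).2 ⟨0, a, b, by simp⟩, ih ?_ ?_⟩
      · refine hnd.sublist ?_
        exact (List.sublist_cons_self a l).append (List.sublist_cons_self b l')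
      · intro x hx
        have hxa : x ≠ a := by
          rintro rfl
          refine nodup_cons_append hnd ?_
          simp only [List.mem_append, List.mem_cons] at hx ⊢
          tauto
        have hxb : x ≠ b := by
          rintro rfl
          have h1 := (List.nodup_append.1 hnd)
          rcases List.mem_append.1 hx with hx | hx
          · exact h1.2.2 x (by simp [hx]) x (by simp) rfl
          · exact (List.nodup_cons.1 h1.2.1).1 hx
        have hx' : x ∈ a :: l ++ b :: l' := by
          simp only [List.mem_append, List.mem_cons] at hx ⊢
          tauto
        rw [h x hx']
        constructor
        · rintro ⟨n, a', b', h1, h2, h3⟩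
          cases n with
          | zero =>
            simp at h1 h2
            subst h1 h2
            rcases h3 with h3 | h3
            exacts [(hxa h3).elim, (hxb h3).elim]
          | succ n => exact ⟨n, a', b', by simpa using h1, by simpa using h2, h3⟩
        · rintro ⟨n, a', b', h1, h2, h3⟩
          exact ⟨n + 1, a', b', by simpa using h1, by simpa using h2, h3⟩

/-- The CAS moves `p` and its whole list to the end of the list of `i`, and leaves thread `k`
captured, with status INIT and no list. Replacing `p` by `m` as delegate affects only `p` and its
former list among the operations that the invariant speaks of, because all others have a unique
delegate different from `p`. -/
theorem Inv.captureSame (h : Inv c) {k : Fin N} {m p : ℕ} (hi : c.role i = .free m)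
    (hk : c.role k = .free p) (hik : k ≠ i) (hop : c.op m = c.op p) {del' : ℕ → ℕ → Prop}
    (hdel : ∀ d r, del' d r ↔ (d = m ∧ c.del p r) ∨ (d ≠ p ∧ c.del d r)) :
    Inv { c with
      role := Function.update (Function.update c.role i (.merge m p)) k (.capt p), del := del',
      la := Function.update (Function.update c.la i (c.la i ++ p :: c.la k)) k [] } ∧
    Trans i c { c with
      role := Function.update (Function.update c.role i (.merge m p)) k (.capt p), del := del',
      la := Function.update (Function.update c.la i (c.la i ++ p :: c.la k)) k [] } := by
  have hmi : (c.role i).op? = some m := by rw [hi]; rfl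
  have hpk : (c.role k).op? = some p := by rw [hk]; rfl
  have ri := h.rinv i
  have rk := h.rinv k
  rw [hi] at ri
  rw [hk] at rk
  obtain ⟨i1, i2, i3⟩ := ri
  obtain ⟨k1, k2, k3⟩ := rk
  have hmp : m ≠ p := by
    rintro rfl
    exact hik ((h.own k m hpk).2.symm.trans (h.own i m hmi).2)
  have hmh : ∀ j, m ∉ c.la j ++ c.lb j := fun j => h.not_held_of_op hmi (by simp [hi])
  have hph : ∀ j, p ∉ c.la j ++ c.lb j := fun j => h.not_held_of_op hpk (by simp [hk])
  obtain ⟨c', hc'⟩ : ∃ c', c' = { c with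
      role := Function.update (Function.update c.role i (.merge m p)) k (.capt p), del := del',
      la := Function.update (Function.update c.la i (c.la i ++ p :: c.la k)) k [] } := ⟨_, rfl⟩
  rw [← hc']
  have rolei : c'.role i = .merge m p := by simp [hc', hik.symm]
  have rolek : c'.role k = .capt p := by simp [hc']
  have rolej : ∀ j, j ≠ i → j ≠ k → c'.role j = c.role j := fun j h1 h2 => by simp [hc', h1, h2]
  have lai : c'.la i = c.la i ++ p :: c.la k := by simp [hc', hik.symm]
  have lak : c'.la k = [] := by simp [hc']
  have laj : ∀ j, j ≠ i → j ≠ k → c'.la j = c.la j := fun j h1 h2 => by simp [hc', h1, h2]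
  have elb : c'.lb = c.lb := by rw [hc']
  have eid : c'.id = c.id := by rw [hc']
  have en : c'.n = c.n := by rw [hc']
  have eop : c'.op = c.op := by rw [hc']
  have est : c'.status = c.status := by rw [hc']
  have enx : c'.next = c.next := by rw [hc']
  have elt : c'.last = c.last := by rw [hc']
  have elin : c'.lin = c.lin := by rw [hc']
  have edel : c'.del = del' := by rw [hc']
  clear hc'
  -- Operations whose unique delegate is not `p` keep it.
  have hdel_eq : ∀ {x d₀}, d₀ ≠ p → (∀ d, c.del d x ↔ d = d₀) → ∀ d, c'.del d x ↔ c.del d x := by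
    intro x d₀ hne hx d
    rw [edel, hdel, hx, hx]
    constructor
    · rintro (⟨-, e⟩ | e)
      exacts [(hne e.symm).elim, e.2]
    · rintro rfl
      exact .inr ⟨hne, rfl⟩
  have hmem : ∀ j x, x ∈ c'.la j ++ c'.lb j →
      (∃ j', x ∈ c.la j' ++ c.lb j' ∧ (j' = j ∨ j' = k ∧ j = i)) ∨ x = p ∧ j = i := by
    intro j x hx
    by_cases e1 : j = i
    · subst e1
      rw [lai, elb, i1] at hx
      simp only [List.append_nil, List.mem_append, List.mem_cons] at hx
      rcases hx with hx | hx | hx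
      · exact .inl ⟨j, by simp [hx], .inl rfl⟩
      · exact .inr ⟨hx, rfl⟩
      · exact .inl ⟨k, by simp [hx], .inr ⟨rfl, rfl⟩⟩
    · by_cases e2 : j = k
      · subst e2
        rw [lak, elb, k1] at hx; cases hx
      · rw [laj j e1 e2, elb] at hx
        exact .inl ⟨j, hx, .inl rfl⟩
  refine ⟨⟨fun j x hx => ?_, fun j => ?_, fun j x hx => ?_, fun j x hr hs => ?_, fun j => ?_,
    fun j j' x hx hx' => ?_, fun x hx => ?_, fun d x hx => ?_⟩,
    fun j hj hw => ?_, fun hw => ?_, fun x _ => .inl (by rw [est]),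
    fun j d x hx hd hl1 hl2 => ?_⟩
  · rw [en, eid]
    by_cases e1 : j = i
    · subst e1; rw [rolei] at hx; cases hx; exact h.own j _ hmi
    · by_cases e2 : j = k
      · subst e2; rw [rolek] at hx; cases hx; exact h.own j _ hpk
      · rw [rolej j e1 e2] at hx; exact h.own j x hx
  · by_cases e1 : j = i
    · subst e1
      rw [rolei, lai, elb]
      refine ⟨i1, by rw [est, i2], fun x hx => ?_, fun x hx => ?_, c.la j, c.la k, rfl,
        ?_, ?_, ?_, ?_⟩
      · rw [elin]
        rw [← List.cons_append, List.mem_append] at hx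
        rcases hx with hx | hx
        · exact ⟨i3.fresh x hx, fun d => by
            rw [hdel_eq hmp (i3.del x hx), i3.del x hx]⟩
        · refine ⟨k3.fresh x hx, fun d => ?_⟩
          rw [edel, hdel, k3.del x hx, k3.del x hx]
          tauto
      · rw [eop]
        rcases List.mem_append.1 hx with hx | hx
        · exact i3.kind x hx
        · rw [hop]
          rcases List.mem_cons.1 hx with rfl | hx
          exacts [rfl, k3.kind x hx]
      · rw [enx]; exact i3.link
      · rw [enx]; exact k3.link
      · rw [elt]; exact i3.ends
      · rw [elt]; exact k3.ends
    · by_cases e2 : j = k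
      · subst e2
        rw [rolek, lak, elb]
        refine ⟨k1, fun e => ?_, fun _ => rfl⟩
        rw [est, k2] at e; cases e
      · rw [rolej j e1 e2, laj j e1 e2, elb]
        refine (h.rinv j).frame (fun x hx _ =>
          ⟨⟨by rw [est], by rw [enx], by rw [elt], by rw [eop]⟩,
          fun hr => ⟨⟨by rw [est], by rw [enx], by rw [elt], by rw [eop]⟩, by rw [elin], ?_⟩⟩)
          (fun x hx => ⟨⟨by rw [est], by rw [enx], by rw [elt], by rw [eop]⟩, by rw [elin], ?_⟩)
          (GoneSame.of_eq en eid eop (fun x _ => ⟨by rw [enx], by rw [elt], by rw [est]⟩)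
            fun x g => ?_)
        · refine hdel_eq (d₀ := x) ?_ (h.root hx hr).2
          rintro rfl
          exact e2 ((h.own j x hx).2.symm.trans (h.own k x hpk).2)
        -- If the delegate of an operation held by `j` were the free operation `p`, then `j` would
        -- be the thread of `p`.
        · obtain ⟨d₀, h1, h2⟩ := h.delegate hx
          refine hdel_eq (d₀ := d₀) ?_ h1
          rintro rfl
          exact e2 (h.eq_of_free hx hk ((h1 d₀).2 rfl))
        · by_cases e3 : c.id x = i
          · right; right
            rw [e3, rolei]
            intro e; cases e
            exact h.not_gone_of_active hmi (by rw [hi]; trivial) g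
          · by_cases e4 : c.id x = k
            · right; right
              rw [e4, rolek]
              intro e; cases e
              exact h.not_gone_of_active hpk (by rw [hk]; trivial) g
            · exact .inl (rolej _ e3 e4)
  · rw [en, est, eid]
    rcases hmem j x hx with ⟨j', h1, -⟩ | ⟨rfl, -⟩
    · obtain ⟨h2, h3, h4⟩ := h.held j' x h1
      refine ⟨h2, h3, ?_⟩
      rw [rolej, h4]
      · intro e; rw [e, hi] at h4; cases h4
      · intro e; rw [e, hk] at h4; cases h4
    · refine ⟨(h.own k x hpk).1, k2, ?_⟩
      rw [(h.own k x hpk).2, rolek]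
  · rw [est] at hs
    by_cases e1 : j = i
    · subst e1; rw [rolei] at hr; cases hr
    · by_cases e2 : j = k
      · subst e2; rw [rolek] at hr; cases hr
        exact ⟨i, by simp [lai]⟩
      · rw [rolej j e1 e2] at hr
        obtain ⟨j', hj'⟩ := h.cover j x hr hs
        by_cases e3 : j' = i
        · subst e3
          refine ⟨j', ?_⟩
          rw [i1] at hj'
          rw [lai, elb, i1]
          simp only [List.append_nil, List.mem_append, List.mem_cons] at hj' ⊢
          tauto
        · by_cases e4 : j' = k
          · subst e4
            refine ⟨i, ?_⟩
            rw [k1] at hj'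
            rw [lai, elb, i1]
            simp only [List.append_nil, List.mem_append, List.mem_cons] at hj' ⊢
            tauto
          · exact ⟨j', by rwa [laj j' e3 e4, elb]⟩
  · by_cases e1 : j = i
    · subst e1
      rw [lai, elb, i1, List.append_nil]
      have n1 := h.nodup j
      have n2 := h.nodup k
      rw [i1, List.append_nil] at n1
      rw [k1, List.append_nil] at n2
      rw [List.nodup_append]
      refine ⟨n1, ?_, ?_⟩
      · rw [List.nodup_cons]
        exact ⟨fun hx => hph k (by simp [hx]), n2⟩
      · rintro x hx y hy rfl
        rcases List.mem_cons.1 hy with rfl | hy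
        · exact hph j (by simp [hx])
        · exact hik (h.disj k j x (by simp [hy]) (by simp [hx]))
    · by_cases e2 : j = k
      · subst e2; rw [lak, elb, k1]; simp
      · rw [laj j e1 e2, elb]; exact h.nodup j
  · rcases hmem j x hx with ⟨a, h1, h2⟩ | ⟨rfl, rfl⟩
    · rcases hmem j' x hx' with ⟨a', h1', h2'⟩ | ⟨rfl, rfl⟩
      · have := h.disj a a' x h1 h1'
        subst this
        have hne : ∀ y, y ∈ c'.la k ++ c'.lb k → False := by
          intro y hy; rw [lak, elb, k1] at hy; cases hy
        rcases h2 with e | ⟨e, e2⟩ <;> rcases h2' with e' | ⟨e', e2'⟩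
        · exact e.symm.trans e'
        · subst e e'; exact (hne x hx).elim
        · subst e e'; exact (hne x hx').elim
        · exact e2.trans e2'.symm
      · exact (hph a h1).elim
    · rcases hmem j' x hx' with ⟨a', h1', h2'⟩ | ⟨-, rfl⟩
      · exact (hph a' h1').elim
      · rfl
  · rw [en]; rw [elin] at hx; exact h.linlt x hx
  · rw [en]; rw [edel, hdel] at hx
    rcases hx with hx | hx
    exacts [h.dellt _ x hx.2, h.dellt _ x hx.2]
  · have : j ≠ k := by rintro rfl; rw [hk] at hw; exact hw
    exact ⟨laj j hj this, by rw [elb]⟩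
  · rw [hi] at hw; exact hw.elim
  · rw [elin] at hl1; exact (hl2 hl1).elim

end Conf
end DECS

/-! ### Eliminating captures, the signal RETRY, and invocations -/

namespace DECS
namespace Conf

variable {N : ℕ} {c c' : Conf N} {i : Fin N}

/-- The list of `p` becomes the second list `lb i`, and `p` is released at once, since its thread
will return without reading its status. All newly linearized operations are `m`, `p` or members of
their lists, so that third threads notice nothing. -/
theorem Inv.captureDiff (h : Inv c) {k : Fin N} {m p : ℕ} (hi : c.role i = .free m)
    (hk : c.role k = .free p) (hik : k ≠ i) (hop : c.op m ≠ c.op p) {lin' : ℕ → Prop}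
    (hlin : ∀ x, lin' x ↔ c.lin x ∨ ∃ (n a b : ℕ), (m :: c.la i)[n]? = some a ∧
      (p :: c.la k)[n]? = some b ∧ (x = a ∨ x = b)) :
    Inv { c with
      role := Function.update (Function.update c.role i (.elimA m p m p)) k (.gone p), lin := lin',
      la := Function.update c.la k [], lb := Function.update c.lb i (c.la k) } ∧
    Trans i c { c with
      role := Function.update (Function.update c.role i (.elimA m p m p)) k (.gone p), lin := lin',
      la := Function.update c.la k [], lb := Function.update c.lb i (c.la k) } := by
  have hmi : (c.role i).op? = some m := by rw [hi]; rfl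
  have hpk : (c.role k).op? = some p := by rw [hk]; rfl
  have ri := h.rinv i
  have rk := h.rinv k
  rw [hi] at ri
  rw [hk] at rk
  obtain ⟨i1, i2, i3⟩ := ri
  obtain ⟨k1, k2, k3⟩ := rk
  have hmh : ∀ j, m ∉ c.la j ++ c.lb j := fun j => h.not_held_of_op hmi (by simp [hi])
  have hph : ∀ j, p ∉ c.la j ++ c.lb j := fun j => h.not_held_of_op hpk (by simp [hk])
  obtain ⟨c', hc'⟩ : ∃ c', c' = { c with
      role := Function.update (Function.update c.role i (.elimA m p m p)) k (.gone p), lin := lin',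
      la := Function.update c.la k [], lb := Function.update c.lb i (c.la k) } := ⟨_, rfl⟩
  rw [← hc']
  have rolei : c'.role i = .elimA m p m p := by simp [hc', hik.symm]
  have rolek : c'.role k = .gone p := by simp [hc']
  have rolej : ∀ j, j ≠ i → j ≠ k → c'.role j = c.role j := fun j h1 h2 => by simp [hc', h1, h2]
  have lak : c'.la k = [] := by simp [hc']
  have laj : ∀ j, j ≠ k → c'.la j = c.la j := fun j h2 => by simp [hc', h2]
  have lbi : c'.lb i = c.la k := by simp [hc']
  have lbj : ∀ j, j ≠ i → c'.lb j = c.lb j := fun j h2 => by simp [hc', h2]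
  have eid : c'.id = c.id := by rw [hc']
  have en : c'.n = c.n := by rw [hc']
  have eop : c'.op = c.op := by rw [hc']
  have est : c'.status = c.status := by rw [hc']
  have enx : c'.next = c.next := by rw [hc']
  have elt : c'.last = c.last := by rw [hc']
  have elin : c'.lin = lin' := by rw [hc']
  have edel : c'.del = c.del := by rw [hc']
  clear hc'
  have mema : ∀ {n a : ℕ}, (m :: c.la i)[n]? = some a → a = m ∨ a ∈ c.la i := fun e =>
    List.mem_cons.1 (List.mem_of_getElem? e)
  have memb : ∀ {n a : ℕ}, (p :: c.la k)[n]? = some a → a = p ∨ a ∈ c.la k := fun e =>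
    List.mem_cons.1 (List.mem_of_getElem? e)
  -- Matched positions lie in the lists of `m` and `p`.
  have hlin_new : ∀ {x}, lin' x → ¬ c.lin x → x = m ∨ x = p ∨ x ∈ c.la i ∨ x ∈ c.la k := by
    intro x h1 h2
    obtain ⟨n, a, b, e1, e2, e3⟩ := ((hlin x).1 h1).resolve_left h2
    have := mema e1
    have := memb e2
    rcases e3 with rfl | rfl <;> tauto
  have hlin_eq : ∀ {x}, x ≠ m → x ≠ p → x ∉ c.la i → x ∉ c.la k → (c'.lin x ↔ c.lin x) := by
    intro x h1 h2 h3 h4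
    rw [elin]
    constructor
    · intro hx
      by_contra hx'
      have := hlin_new hx hx'
      tauto
    · exact fun hx => (hlin x).2 (.inl hx)
  have hmem : ∀ j x, x ∈ c'.la j ++ c'.lb j →
      ∃ j', x ∈ c.la j' ++ c.lb j' ∧ (j' = j ∧ j ≠ k ∨ j' = k ∧ j = i) := by
    intro j x hx
    by_cases e1 : j = i
    · subst e1
      rw [laj j hik.symm, lbi] at hx
      rcases List.mem_append.1 hx with hx | hx
      · exact ⟨j, by simp [hx], .inl ⟨rfl, hik.symm⟩⟩
      · exact ⟨k, by simp [hx], .inr ⟨rfl, rfl⟩⟩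
    · by_cases e2 : j = k
      · subst e2
        rw [lak, lbj j e1, k1] at hx; cases hx
      · rw [laj j e2, lbj j e1] at hx
        exact ⟨j, hx, .inl ⟨rfl, e2⟩⟩
  have hgone : GoneSame c c' := by
    refine GoneSame.of_eq en eid eop (fun x _ => ⟨by rw [enx], by rw [elt], by rw [est]⟩)
      fun x g => ?_
    by_cases e3 : c.id x = i
    · right; right
      rw [e3, rolei]
      intro e; cases e
      exact h.not_gone_of_active hmi (by rw [hi]; trivial) g
    · by_cases e4 : c.id x = k
      · right; right
        rw [e4, rolek]
        intro e; cases e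
        exact h.not_gone_of_active hpk (by rw [hk]; trivial) g
      · exact .inl (rolej _ e3 e4)
  have hndik : (c.la i ++ c.la k).Nodup := by
    have n1 := h.nodup i
    have n2 := h.nodup k
    rw [i1, List.append_nil] at n1
    rw [k1, List.append_nil] at n2
    rw [List.nodup_append]
    refine ⟨n1, n2, ?_⟩
    rintro x hx y hy rfl
    exact hik (h.disj k i x (by simp [hy]) (by simp [hx]))
  have hlinm : lin' m := (hlin m).2 (.inr ⟨0, m, p, by simp⟩)
  have hlinp : lin' p := (hlin p).2 (.inr ⟨0, m, p, by simp⟩)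
  refine ⟨⟨fun j x hx => ?_, fun j => ?_, fun j x hx => ?_, fun j x hr hs => ?_, fun j => ?_,
    fun j j' x hx hx' => ?_, fun x hx => ?_, fun d x hx => ?_⟩,
    fun j hj hw => ?_, fun hw => ?_, fun x _ => .inl (by rw [est]),
    fun j d x hx hd hl1 hl2 => ?_⟩
  · rw [en, eid]
    by_cases e1 : j = i
    · subst e1; rw [rolei] at hx; cases hx; exact h.own j _ hmi
    · by_cases e2 : j = k
      · subst e2; rw [rolek] at hx; cases hx; exact h.own j _ hpk
      · rw [rolej j e1 e2] at hx; exact h.own j x hx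
  · by_cases e1 : j = i
    · subst e1
      rw [rolei, laj j hik.symm, lbi]
      refine ⟨⟨?_, by rwa [eop], ?_, ?_, ?_, ?_, ?_, ?_⟩, ?_, .inl ⟨rfl, rfl, ?_, ?_⟩⟩
      · refine ⟨by rw [en]; exact (h.own k p hpk).1, fun _ => .inl ?_⟩
        rw [eid, (h.own k p hpk).2, rolek]
      · rw [edel]; exact fun x hx => i3.del x (by simp [hx])
      · rw [edel]; exact fun x hx => k3.del x (by simp [hx])
      · rw [eop]; exact i3.kind
      · rw [eop]; exact k3.kind
      · rw [elt]
        intro z hz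
        refine i3.ends z ?_
        rw [List.getLast?_cons, hz]; rfl
      · rw [elt]
        intro z hz
        refine k3.ends z ?_
        rw [List.getLast?_cons, hz]; rfl
      · refine Pairs.of_getElem hndik fun x hx => ?_
        have hxm : x ≠ m := by
          rintro rfl
          rcases List.mem_append.1 hx with hx | hx
          exacts [hmh j (by simp [hx]), hmh k (by simp [hx])]
        have hxp : x ≠ p := by
          rintro rfl
          rcases List.mem_append.1 hx with hx | hx
          exacts [hph j (by simp [hx]), hph k (by simp [hx])]
        have hxl : ¬ c.lin x := by
          rcases List.mem_append.1 hx with hx | hx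
          exacts [i3.fresh x (by simp [hx]), k3.fresh x (by simp [hx])]
        rw [elin, hlin]
        constructor
        · intro h1
          obtain ⟨n, a, b, e1, e2, e3⟩ := h1.resolve_left hxl
          cases n with
          | zero =>
            simp at e1 e2
            subst e1 e2
            rcases e3 with e3 | e3
            exacts [(hxm e3).elim, (hxp e3).elim]
          | succ n => exact ⟨n, a, b, by simpa using e1, by simpa using e2, e3⟩
        · rintro ⟨n, a, b, e1, e2, e3⟩
          exact .inr ⟨n + 1, a, b, by simpa using e1, by simpa using e2, e3⟩
      · rw [enx]; exact i3.link
      · rw [enx]; exact k3.link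
    · by_cases e2 : j = k
      · subst e2
        rw [rolek, lak, lbj j e1]
        exact ⟨rfl, k1⟩
      · rw [rolej j e1 e2, laj j e2, lbj j e1]
        have hs : ∀ x, x ≠ m → x ≠ p → x ∉ c.la i → x ∉ c.la k → Same c c' x := fun x h1 h2 h3 h4 =>
          ⟨⟨by rw [est], by rw [enx], by rw [elt], by rw [eop]⟩, hlin_eq h1 h2 h3 h4,
          by rw [edel]; simp⟩
        refine (h.rinv j).frame (fun x hx _ =>
          ⟨⟨by rw [est], by rw [enx], by rw [elt], by rw [eop]⟩,
          fun hr => ?_⟩) (fun x hx => ?_) hgone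
        · have hdx := (h.root hx hr).2
          refine hs x ?_ ?_ (fun hx' => ?_) (fun hx' => ?_)
          · rintro rfl
            exact e1 ((h.own j x hx).2.symm.trans (h.own i x hmi).2)
          · rintro rfl
            exact e2 ((h.own j x hx).2.symm.trans (h.own k x hpk).2)
          -- A member of `la i` has the delegate `m`, but the rooted operation `x` is its own
          -- delegate; so `x = m` would belong to thread `i`.
          · have h1 := (i3.del x (by simp [hx']) x).1 ((hdx x).2 rfl)
            exact e1 ((h.own j x hx).2.symm.trans (by rw [h1]; exact (h.own i m hmi).2))
          · have h1 := (k3.del x (by simp [hx']) x).1 ((hdx x).2 rfl)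
            exact e2 ((h.own j x hx).2.symm.trans (by rw [h1]; exact (h.own k p hpk).2))
        · refine hs x ?_ ?_ (fun hx' => ?_) (fun hx' => ?_)
          · rintro rfl; exact hmh j hx
          · rintro rfl; exact hph j hx
          · exact e1 (h.disj j i x hx (by simp [hx']))
          · exact e2 (h.disj j k x hx (by simp [hx']))
  · rw [en, est, eid]
    obtain ⟨j', h1, -⟩ := hmem j x hx
    obtain ⟨h2, h3, h4⟩ := h.held j' x h1
    refine ⟨h2, h3, ?_⟩
    rw [rolej, h4]
    · intro e; rw [e, hi] at h4; cases h4
    · intro e; rw [e, hk] at h4; cases h4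
  · rw [est] at hs
    by_cases e1 : j = i
    · subst e1; rw [rolei] at hr; cases hr
    · by_cases e2 : j = k
      · subst e2; rw [rolek] at hr; cases hr
      · rw [rolej j e1 e2] at hr
        obtain ⟨j', hj'⟩ := h.cover j x hr hs
        by_cases e3 : j' = i
        · subst e3
          refine ⟨j', ?_⟩
          rw [i1] at hj'
          rw [laj j' hik.symm, lbi]
          simp only [List.append_nil, List.mem_append] at hj' ⊢
          tauto
        · by_cases e4 : j' = k
          · subst e4
            refine ⟨i, ?_⟩
            rw [k1] at hj'
            rw [laj i hik.symm, lbi]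
            simp only [List.append_nil, List.mem_append] at hj' ⊢
            tauto
          · exact ⟨j', by rwa [laj j' e4, lbj j' e3]⟩
  · by_cases e1 : j = i
    · subst e1
      rw [laj j hik.symm, lbi]; exact hndik
    · by_cases e2 : j = k
      · subst e2; rw [lak, lbj j e1, k1]; simp
      · rw [laj j e2, lbj j e1]; exact h.nodup j
  · obtain ⟨a, h1, h2⟩ := hmem j x hx
    obtain ⟨a', h1', h2'⟩ := hmem j' x hx'
    have := h.disj a a' x h1 h1'
    subst this
    rcases h2 with ⟨e, e2⟩ | ⟨e, e2⟩ <;> rcases h2' with ⟨e', e2'⟩ | ⟨e', e2'⟩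
    · exact e.symm.trans e'
    · exact (e2 (e.symm.trans e')).elim
    · exact (e2' (e'.symm.trans e)).elim
    · exact e2.trans e2'.symm
  · rw [en]; rw [elin, hlin] at hx
    rcases hx with hx | ⟨n, a, b, e1, e2, e3⟩
    · exact h.linlt x hx
    · rcases e3 with rfl | rfl
      · rcases mema e1 with rfl | hx
        exacts [(h.own i x hmi).1, h.idlt (j := i) (by simp [hx])]
      · rcases memb e2 with rfl | hx
        exacts [(h.own k x hpk).1, h.idlt (j := k) (by simp [hx])]
  · rw [en]; rw [edel] at hx; exact h.dellt _ x hx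
  · have : j ≠ k := by rintro rfl; rw [hk] at hw; exact hw
    exact ⟨laj j this, lbj j hj⟩
  · rw [hi] at hw; exact hw.elim
  · rw [rolei, laj i hik.symm, lbi]
    refine ⟨trivial, ?_⟩
    rw [elin] at hl1
    have hnh := fun k => h.del_not_held (k := k) hx hd
    rcases hlin_new hl1 hl2 with rfl | rfl | hd' | hd'
    · have := h.eq_of_free hx hi hd
      subst this
      rw [i1] at hx
      simp only [List.append_nil, List.mem_append] at hx ⊢
      tauto
    · have := h.eq_of_free hx hk hd
      subst this
      rw [k1] at hx
      simp only [List.append_nil, List.mem_append] at hx ⊢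
      tauto
    · exact (hnh i (by simp [hd'])).elim
    · exact (hnh k (by simp [hd'])).elim

/-- The head `k` of the residue becomes the root of the rest, which is handed over to the thread of
`k`. This happens with the signal itself, before that thread reacts: a captured operation with
status RETRY counts as rooted. The thread `i` ends with empty lists. -/
theorem Inv.signalRetry (h : Inv c) {m src k : ℕ} (hi : c.role i = .residueRetry m src k)
    {del' : ℕ → ℕ → Prop} (hdel : ∀ d r, del' d r ↔
      (d = k ∧ c.del src r ∧ r ∈ c.la i ++ c.lb i) ∨
        (c.del d r ∧ ¬ (d = src ∧ r ∈ c.la i ++ c.lb i))) :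
    Inv { c with
      status := Function.update c.status k .retry, role := Function.update c.role i (.gone m)
      del := del', la := Function.update (Function.update c.la i []) (c.id k)
        (c.la i ++ c.lb i).tail
      lb := Function.update c.lb i [] } ∧
    Trans i c { c with
      status := Function.update c.status k .retry, role := Function.update c.role i (.gone m)
      del := del', la := Function.update (Function.update c.la i []) (c.id k)
        (c.la i ++ c.lb i).tail
      lb := Function.update c.lb i [] } := by
  have hmi : (c.role i).op? = some m := by rw [hi]; rfl
  have ri := h.rinv i
  rw [hi] at ri
  obtain ⟨i1, i2⟩ := ri
  have hkm := i1.link.head_mem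
  obtain ⟨l, hl⟩ : ∃ l, c.la i ++ c.lb i = k :: l := by
    have := i1.link
    cases e : c.la i ++ c.lb i with
    | nil => rw [e] at this; cases this
    | cons x l => rw [e] at this; cases this.1; exact ⟨l, rfl⟩
  have hlink := i1.link
  rw [hl] at hlink
  have hlink := hlink.2
  have hlsub : ∀ x ∈ l, x ∈ c.la i ++ c.lb i := fun x hx => by rw [hl]; simp [hx]
  have hnd := h.nodup i
  rw [hl, List.nodup_cons] at hnd
  obtain ⟨hk1, hk2, hk3⟩ := h.held i k hkm
  obtain ⟨j₀, hj₀⟩ : ∃ j₀, j₀ = c.id k := ⟨_, rfl⟩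
  rw [← hj₀] at hk3 ⊢
  rw [hl, List.tail_cons]
  have rk := h.rinv j₀
  rw [hk3] at rk
  obtain ⟨k1, -, k3⟩ := rk
  -- As the status of `k` was INIT, its thread has no list yet and can receive the tail of the
  -- residue.
  have k3 := k3 (by rw [hk2]; simp)
  have hji : j₀ ≠ i := by rintro rfl; rw [hi] at hk3; cases hk3
  have hmh : ∀ j, m ∉ c.la j ++ c.lb j := fun j => h.not_held_of_op hmi (by simp [hi])
  obtain ⟨c', hc'⟩ : ∃ c', c' = { c with
      status := Function.update c.status k .retry, role := Function.update c.role i (.gone m)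
      del := del', la := Function.update (Function.update c.la i []) j₀ l
      lb := Function.update c.lb i [] } := ⟨_, rfl⟩
  rw [← hc']
  have rolei : c'.role i = .gone m := by simp [hc']
  have rolej : ∀ j, j ≠ i → c'.role j = c.role j := fun j h1 => by simp [hc', h1]
  have lai : c'.la i = [] := by simp [hc', hji.symm]
  have lak : c'.la j₀ = l := by simp [hc']
  have laj : ∀ j, j ≠ i → j ≠ j₀ → c'.la j = c.la j := fun j h1 h2 => by simp [hc', h1, h2]
  have lbi : c'.lb i = [] := by simp [hc']
  have lbj : ∀ j, j ≠ i → c'.lb j = c.lb j := fun j h2 => by simp [hc', h2]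
  have eid : c'.id = c.id := by rw [hc']
  have en : c'.n = c.n := by rw [hc']
  have eop : c'.op = c.op := by rw [hc']
  have stk : c'.status k = .retry := by simp [hc']
  have stj : ∀ x, x ≠ k → c'.status x = c.status x := fun x hx => by simp [hc', hx]
  have enx : c'.next = c.next := by rw [hc']
  have elt : c'.last = c.last := by rw [hc']
  have elin : c'.lin = c.lin := by rw [hc']
  have edel : c'.del = del' := by rw [hc']
  clear hc'
  have hdel_eq : ∀ {x}, x ∉ c.la i ++ c.lb i → ∀ d, c'.del d x ↔ c.del d x := by
    intro x hx d
    rw [edel, hdel]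
    simp only [hx, and_false, false_or, not_false_eq_true, and_true]
  have hdel_mem : ∀ {x}, x ∈ c.la i ++ c.lb i → ∀ d, c'.del d x ↔ d = k := by
    intro x hx d
    rw [edel, hdel, i1.del x hx, i1.del x hx]
    simp only [hx]
    tauto
  have hmem : ∀ j x, x ∈ c'.la j ++ c'.lb j →
      ∃ j', x ∈ c.la j' ++ c.lb j' ∧ x ≠ k ∧ (j' = j ∧ j ≠ i ∨ j' = i ∧ j = j₀) := by
    intro j x hx
    by_cases e1 : j = i
    · subst e1
      rw [lai, lbi] at hx; cases hx
    · by_cases e2 : j = j₀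
      · subst e2
        rw [lak, lbj j e1, k1, List.append_nil] at hx
        exact ⟨i, hlsub x hx, by rintro rfl; exact hnd.1 hx, .inr ⟨rfl, rfl⟩⟩
      · rw [laj j e1 e2, lbj j e1] at hx
        refine ⟨j, hx, ?_, .inl ⟨rfl, e1⟩⟩
        rintro rfl
        exact e1 (h.disj j i x hx hkm)
  have hkg : ¬ c.Gone k := h.not_gone_of_held hkm
  have hgone : GoneSame c c' := by
    refine GoneSame.of_eq en eid eop (fun x g => ⟨by rw [enx], by rw [elt], ?_⟩)
      fun x g => ?_
    · exact stj x (by rintro rfl; exact hkg g)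
    · by_cases e3 : c.id x = i
      · right; right
        rw [e3, rolei]
        intro e; cases e
        exact h.not_gone_of_active hmi (by rw [hi]; trivial) g
      · exact .inl (rolej _ e3)
  refine ⟨⟨fun j x hx => ?_, fun j => ?_, fun j x hx => ?_, fun j x hr hs => ?_, fun j => ?_,
    fun j j' x hx hx' => ?_, fun x hx => ?_, fun d x hx => ?_⟩,
    fun j hj hw => ?_, fun hw x hx => ?_, fun x _ => ?_,
    fun j d x hx hd hl1 hl2 => ?_⟩
  · rw [en, eid]
    by_cases e1 : j = i
    · subst e1; rw [rolei] at hx; cases hx; exact h.own j _ hmi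
    · rw [rolej j e1] at hx; exact h.own j x hx
  · by_cases e1 : j = i
    · subst e1
      rw [rolei, lai, lbi]
      exact ⟨rfl, rfl⟩
    · by_cases e2 : j = j₀
      · subst e2
        rw [rolej j e1, hk3, lak, lbj j e1]
        refine ⟨k1, fun _ => ⟨fun x hx => ?_, fun x hx => ?_, ?_, ?_, fun x hx => ?_⟩,
          fun e => (e stk).elim⟩
        · rw [elin]; exact i1.fresh x (by rwa [hl])
        · exact hdel_mem (by rwa [hl])
        · rwa [enx]
        · rw [elt]; rwa [hl] at i2
        · rw [eop]; exact i1.kind x (hlsub x hx)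
      · rw [rolej j e1, laj j e1 e2, lbj j e1]
        have hs : ∀ x, x ∉ c.la i ++ c.lb i → Same c c' x := fun x h1 =>
          ⟨⟨stj x (by rintro rfl; exact h1 hkm), by rw [enx], by rw [elt], by rw [eop]⟩,
            by rw [elin], hdel_eq h1⟩
        refine (h.rinv j).frame (fun x hx _ => ⟨⟨stj x ?_, by rw [enx], by rw [elt], by rw [eop]⟩,
          fun hr => hs x fun hx' => ?_⟩)
          (fun x hx => hs x fun hx' => e1 (h.disj j i x hx hx')) hgone
        · rintro rfl
          exact e2 ((h.own j x hx).2.symm.trans hj₀.symm)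
        -- A rooted operation in the residue would be its own delegate, hence equal to `src`. But
        -- `src` is `m` or released, and neither of these is held.
        · have h1 := (i1.del x hx' x).1 (((h.root hx hr).2 x).2 rfl)
          rcases i1.gone with h2 | h2
          · rw [h1, h2] at hx'; exact hmh i hx'
          · rw [← h1] at h2; exact h.not_gone_of_held hx' h2
  · rw [en, eid]
    obtain ⟨j', h1, hxk, -⟩ := hmem j x hx
    obtain ⟨h2, h3, h4⟩ := h.held j' x h1
    refine ⟨h2, by rw [stj x hxk, h3], ?_⟩
    rw [rolej, h4]
    intro e; rw [e, hi] at h4; cases h4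
  · by_cases e1 : j = i
    · subst e1; rw [rolei] at hr; cases hr
    · have hxk : x ≠ k := by rintro rfl; rw [stk] at hs; cases hs
      rw [rolej j e1] at hr
      rw [stj x hxk] at hs
      obtain ⟨j', hj'⟩ := h.cover j x hr hs
      by_cases e3 : j' = i
      · subst e3
        rw [hl] at hj'
        exact ⟨j₀, by rw [lak]; simp [(List.mem_cons.1 hj').resolve_left hxk]⟩
      · by_cases e4 : j' = j₀
        · subst e4
          rw [k3, k1] at hj'; cases hj'
        · exact ⟨j', by rwa [laj j' e3 e4, lbj j' e3]⟩
  · by_cases e1 : j = i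
    · subst e1
      rw [lai, lbi]; simp
    · by_cases e2 : j = j₀
      · subst e2; rw [lak, lbj j e1, k1]; simpa using hnd.2
      · rw [laj j e1 e2, lbj j e1]; exact h.nodup j
  · obtain ⟨a, h1, -, h2⟩ := hmem j x hx
    obtain ⟨a', h1', -, h2'⟩ := hmem j' x hx'
    have := h.disj a a' x h1 h1'
    subst this
    rcases h2 with ⟨e, e2⟩ | ⟨e, e2⟩ <;> rcases h2' with ⟨e', e2'⟩ | ⟨e', e2'⟩
    · exact e.symm.trans e'
    · exact (e2 (e.symm.trans e')).elim
    · exact (e2' (e'.symm.trans e)).elim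
    · exact e2.trans e2'.symm
  · rw [en]; rw [elin] at hx; exact h.linlt x hx
  · rw [en]; rw [edel, hdel] at hx
    rcases hx with hx | hx
    exacts [h.dellt _ x hx.2.1, h.dellt _ x hx.1]
  · have : j ≠ j₀ := by rintro rfl; rw [hk3] at hw; exact hw
    exact ⟨laj j hj this, lbj j hj⟩
  · exact .inr (.inr ⟨k, hk2, stk, (hdel_mem hx k).2 rfl, i1.fresh x hx⟩)
  · by_cases e : x = k
    · subst e; exact .inr (.inl hkm)
    · exact .inl (stj x e)
  · rw [elin] at hl1; exact (hl2 hl1).elim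

/-- By the bounds in `Inv`, no list, role, linearization or delegation mentions the new address
`c.n`. -/
theorem Inv.invoke (h : Inv c) (hi : c.role i = .idle) (hc'n : c'.n = c.n + 1)
    (hn : c'.id c.n = i ∧ c'.status c.n = .init ∧ c'.next c.n = none ∧ c'.last c.n = c.n)
    (ho : ∀ x, x ≠ c.n → c'.id x = c.id x ∧ SameRecord c c' x)
    (hr : c'.role = Function.update c.role i (.free c.n))
    (hlin : c'.lin = c.lin) (hdel : ∀ d r, c'.del d r ↔ c.del d r ∨ (d = c.n ∧ r = c.n))
    (hla : c'.la = c.la) (hlb : c'.lb = c.lb) : Inv c' ∧ Trans i c c' := by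
  have ri := h.rinv i
  rw [hi] at ri
  have rolei : c'.role i = .free c.n := by simp [hr]
  have rolej : ∀ j, j ≠ i → c'.role j = c.role j := fun j h1 => by simp [hr, h1]
  have hs : ∀ x < c.n, Same c c' x := fun x hx =>
    ⟨(ho x hx.ne).2, by rw [hlin], fun d => by
      rw [hdel]
      refine or_iff_left ?_
      rintro ⟨-, rfl⟩
      exact hx.false⟩
  have hgone : GoneSame c c' := by
    intro x g
    obtain ⟨h1, h2⟩ := ho x g.1.ne
    refine ⟨⟨by rw [hc'n]; exact g.1.trans (by simp), ?_⟩, h2.next, h2.last, h2.op⟩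
    rw [h1, h2.status]
    by_cases e : c.id x = i
    · rw [e, rolei]
      intro e'
      cases e'
      exact (g.1.false).elim
    · rw [rolej _ e]; exact g.2
  refine ⟨⟨fun j x hx => ?_, fun j => ?_, fun j x hx => ?_, fun j x hr' hs' => ?_, fun j => ?_,
    fun j j' x hx hx' => ?_, fun x hx => ?_, fun d x hx => ?_⟩,
    fun j hj hw => ⟨by rw [hla], by rw [hlb]⟩, fun hw x hx => ?_, fun x hx => .inl (hs x hx).status,
    fun j d x hx hd hl1 hl2 => ?_⟩
  · rw [hc'n]
    by_cases e : j = i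
    · subst e; rw [rolei] at hx; cases hx
      exact ⟨by simp, hn.1⟩
    · rw [rolej j e] at hx
      have := h.own j x hx
      rw [(ho x this.1.ne).1]
      exact ⟨by omega, this.2⟩
  · rw [hla, hlb]
    by_cases e : j = i
    · subst e
      rw [rolei, ri.1, ri.2]
      refine ⟨rfl, hn.2.1, fun x hx => ?_, fun x hx d => ?_, hn.2.2.1, fun z hz => ?_, by simp⟩
      · rw [List.mem_singleton] at hx
        subst hx
        rw [hlin]; exact fun h' => (h.linlt _ h').false
      · rw [List.mem_singleton] at hx
        subst hx
        rw [hdel]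
        constructor
        · rintro (h' | h')
          exacts [((h.dellt _ _ h').false).elim, h'.1]
        · exact fun e => .inr ⟨e, rfl⟩
      · rw [hn.2.2.2]
        simpa using hz.symm
    · rw [rolej j e]
      refine (h.rinv j).frame (fun x hx _ => ?_) (fun x hx => hs x (h.idlt hx)) hgone
      have := hs x (h.own j x hx).1
      exact ⟨this.toSameRecord, fun _ => this⟩
  · rw [hla, hlb] at hx
    obtain ⟨h1, h2, h3⟩ := h.held j x hx
    have := ho x h1.ne
    refine ⟨by omega, this.2.status.trans h2, ?_⟩
    rw [this.1, rolej, h3]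
    intro e; rw [e, hi] at h3; cases h3
  · rw [hla, hlb]
    by_cases e : j = i
    · subst e; rw [rolei] at hr'; cases hr'
    · rw [rolej j e] at hr'
      have hx := (h.own j x (by rw [hr']; rfl)).1
      exact h.cover j x hr' ((hs x hx).status ▸ hs')
  · rw [hla, hlb]; exact h.nodup j
  · rw [hla, hlb] at hx hx'; exact h.disj j j' x hx hx'
  · rw [hlin] at hx
    have := h.linlt x hx
    omega
  · rw [hdel] at hx
    rcases hx with hx | hx
    · have := h.dellt d x hx
      omega
    · omega
  · rw [hi] at hw; exact hw.elim
  · rw [hlin] at hl1; exact (hl2 hl1).elim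

end Conf
end DECS

/-! ### Concrete steps: identifiers and the array `location` -/

namespace DECS
namespace State

variable {N : ℕ} {D : Type*} {s s' : State N D} {i : Fin N}

section Fields

variable (s) (j : Fin N) (c : PC N) (r : ℕ) (f : MultiOp N → MultiOp N) (x : Option ℕ)

@[simp] theorem goto_ops : (s.goto i c).ops = s.ops := rfl
@[simp] theorem goto_numOps : (s.goto i c).numOps = s.numOps := rfl
@[simp] theorem goto_centralStack : (s.goto i c).centralStack = s.centralStack := rfl
@[simp] theorem goto_location : (s.goto i c).location = s.location := rfl
@[simp] theorem goto_pc : (s.goto i c).pc = Function.update s.pc i c := rfl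

@[simp] theorem modOp_ops : (s.modOp r f).ops = Function.update s.ops r (f (s.ops r)) := rfl
@[simp] theorem modOp_numOps : (s.modOp r f).numOps = s.numOps := rfl
@[simp] theorem modOp_location : (s.modOp r f).location = s.location := rfl
@[simp] theorem modOp_pc : (s.modOp r f).pc = s.pc := rfl

@[simp] theorem setCellNext_ops : (s.setCellNext r x).ops = s.ops := rfl
@[simp] theorem setCellNext_numOps : (s.setCellNext r x).numOps = s.numOps := rfl
@[simp] theorem setCellNext_location : (s.setCellNext r x).location = s.location := rfl
@[simp] theorem setCellNext_pc : (s.setCellNext r x).pc = s.pc := rfl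

@[simp] theorem setLocation_ops : (s.setLocation j x).ops = s.ops := rfl
@[simp] theorem setLocation_numOps : (s.setLocation j x).numOps = s.numOps := rfl
@[simp] theorem setLocation_location :
    (s.setLocation j x).location = Function.update s.location j x := rfl
@[simp] theorem setLocation_pc : (s.setLocation j x).pc = s.pc := rfl

end Fields

/-- The first line of an iteration. -/
def loopPC (N : ℕ) (o : Kind) (m : ℕ) : PC N :=
  match o with
  | .push => .pushTop m
  | .pop => .popTop m

@[simp] theorem loopPC_op? (o : Kind) (m : ℕ) : (loopPC N o m).op? = some m := by
  cases o <;> rfl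

theorem startLoop_eq (s : State N D) (i : Fin N) (m : ℕ) :
    s.startLoop i m = s.goto i (loopPC N (s.ops m).op m) := by
  unfold startLoop loopPC; cases (s.ops m).op <;> rfl

/-- Facts about the entry of `location` and the local variables of a thread. -/
def PInv (s : State N D) (i : Fin N) : PC N → Prop
  | .getIndex m | .getHim m _ | .casCollision m _ _ | .getInfo m _ | .delay m
  | .casLocationDelayed m => ∃ a, s.location i = some a ∧ (a = m ∨ (s.ops a).id ≠ i)
  | .casLocation m p => (∃ a, s.location i = some a ∧ (a = m ∨ (s.ops a).id ≠ i)) ∧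
      p < s.numOps ∧ (s.ops p).id ≠ i
  | .activeCas _ p => s.location i = none ∧ p < s.numOps ∧ (s.ops p).id ≠ i
  | .passiveGet _ => ∃ a, s.location i = some a ∧ (s.ops a).id ≠ i
  | .passiveReset _ a => s.location i = some a ∧ (s.ops a).id ≠ i
  | .pushTop m | .pushSetLast m _ | .pushCas m _ | .combineCells m _ =>
      s.location i = none ∧ (s.ops m).op = .push
  | .passiveCell m _ => s.location i = none ∧ (s.ops m).op = .pop
  | _ => s.location i = none

/-- Basic facts about identifiers and the array `location`. -/
structure Base (s : State N D) : Prop where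
  own : ∀ i m, (s.pc i).op? = some m → m < s.numOps ∧ (s.ops m).id = i
  loclt : ∀ i a, s.location i = some a → a < s.numOps
  pinv : ∀ i, s.PInv i (s.pc i)

/-- What no step of thread `i` changes. -/
structure Static (i : Fin N) (s s' : State N D) : Prop where
  le : s.numOps ≤ s'.numOps
  id : ∀ x < s.numOps, (s'.ops x).id = (s.ops x).id
  op : ∀ x < s.numOps, (s'.ops x).op = (s.ops x).op
  pc : ∀ j ≠ i, s'.pc j = s.pc j

theorem update_id {ops : ℕ → MultiOp N} {r : ℕ} {o : MultiOp N} (h : o.id = (ops r).id) (x : ℕ) :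
    (Function.update ops r o x).id = (ops x).id := by
  by_cases e : x = r
  · subst e; simpa
  · simp [e]

theorem update_op {ops : ℕ → MultiOp N} {r : ℕ} {o : MultiOp N} (h : o.op = (ops r).op) (x : ℕ) :
    (Function.update ops r o x).op = (ops x).op := by
  by_cases e : x = r
  · subst e; simpa
  · simp [e]

theorem Step.static (h : Step i s s') : Static i s s' := by
  have same : Static i s s := ⟨le_rfl, fun _ _ => rfl, fun _ _ => rfl, fun _ _ => rfl⟩
  have mk : ∀ s' : State N D, s'.numOps = s.numOps → (∀ x, (s'.ops x).id = (s.ops x).id) →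
      (∀ x, (s'.ops x).op = (s.ops x).op) → (∀ j ≠ i, s'.pc j = s.pc j) → Static i s s' :=
    fun s' h1 h2 h3 h4 => ⟨h1.ge, fun x _ => h2 x, fun x _ => h3 x, h4⟩
  unfold Step at h
  split at h
  case h_1 =>
    rcases h with rfl | ⟨d, rfl⟩ | rfl
    · exact same
    · exact ⟨by simp [invokePush], fun x hx => by simp [invokePush, hx.ne],
        fun x hx => by simp [invokePush, hx.ne], fun j hj => by simp [invokePush, hj]⟩
    · exact ⟨by simp [invokePop], fun x hx => by simp [invokePop, hx.ne],
        fun x hx => by simp [invokePop, hx.ne], fun j hj => by simp [invokePop, hj]⟩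
  all_goals
    obtain ⟨_, rfl⟩ := h
    repeat' split
    all_goals first
      | exact same
      | refine mk _ ?_ ?_ ?_ ?_ <;>
          simp +contextual [update_id, update_op, startLoop_eq]

/-- All other writes to `location` go to the entry of the thread named in the record of the own
operation, which is the thread that makes the step. -/
theorem Step.location (h : Step i s s') (hb : Base s) {j : Fin N} (hj : j ≠ i) :
    s'.location j = s.location j ∨ ∃ m p, s.pc i = .activeCas m p ∧ s.location j = some p ∧
      (s.ops p).id = j ∧ s'.location j = some m := by
  have own := hb.own i
  unfold Step at h
  split at h
  case h_1 => rcases h with rfl | ⟨d, rfl⟩ | rfl <;> exact .inl rfl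
  case h_31 m p hpc =>
    subst h
    split
    · rename_i hl
      by_cases e : j = (s.ops p).id
      · exact .inr ⟨m, p, hpc, by rw [e, hl], e.symm, by simp [e]⟩
      · left; simp [e]
    · left; simp [startLoop_eq]
  all_goals
    rename_i hpc
    rw [hpc] at own
    have own := fun m h => (own m h).2
    simp only [PC.op?, Option.some.injEq, forall_eq'] at own
    obtain ⟨_, rfl⟩ := h
    try (left; simp [startLoop_eq, own, hj]; done)
    repeat' split
    all_goals try exact .inl rfl
    all_goals try (left; simp [startLoop_eq, hj])

/-- The operation that a thread performs next changes only when a new one is invoked. -/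
theorem Step.op? (h : Step i s s') : (s'.pc i).op? = (s.pc i).op? ∨ (s'.pc i).op? = none ∨
    (s.pc i = .idle ∧ (s'.pc i).op? = some s.numOps ∧ s'.numOps = s.numOps + 1 ∧
      (s'.ops s.numOps).id = i) := by
  unfold Step at h
  split at h
  case h_1 hpc =>
    rcases h with rfl | ⟨d, rfl⟩ | rfl
    · exact .inl rfl
    · exact .inr (.inr ⟨hpc, by simp [invokePush, PC.op?]⟩)
    · exact .inr (.inr ⟨hpc, by simp [invokePop, PC.op?]⟩)
  all_goals
    rename_i hpc
    rw [hpc]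
    obtain ⟨_, rfl⟩ := h
    repeat' split
    all_goals first
      | (left; simp [hpc, PC.op?]; done)
      | (left; rw [startLoop_eq]; simp only [goto_pc, Function.update_self, loopPC_op?]; rfl)
      | (right; left; simp [PC.op?])

end State
end DECS

namespace DECS
namespace State

variable {N : ℕ} {D : Type*} {s s' : State N D} {i : Fin N}

theorem pinv_loopPC {m : ℕ} {o : Kind} (h : s.location i = none) (ho : (s.ops m).op = o) :
    s.PInv i (loopPC N o m) := by
  cases o
  exacts [⟨h, ho⟩, h]

theorem Step.location_self (h : Step i s s') (hb : Base s) :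
    s'.location i = s.location i ∨ s'.location i = none ∨
      ∃ m, s.pc i = .announce m ∧ s'.location i = some m := by
  have own := hb.own i
  have hp := hb.pinv i
  unfold Step at h
  split at h
  case h_1 => rcases h with rfl | ⟨d, rfl⟩ | rfl <;> exact .inl rfl
  all_goals
    rename_i hpc
    rw [hpc] at own hp
    have own := fun m h => (own m h).2
    simp only [PC.op?, Option.some.injEq, forall_eq'] at own
    obtain ⟨_, rfl⟩ := h
    repeat' split
    all_goals first
      | exact .inl rfl
      | (left; simp [startLoop_eq]; done)
      | (left; simp [startLoop_eq, hp.2.2.symm]; done)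
      | (right; left; simp [startLoop_eq, own]; done)
      | (right; right; exact ⟨_, hpc, by simp⟩)

theorem Step.pinv_self (h : Step i s s') (hb : Base s) : s'.PInv i (s'.pc i) := by
  have own := hb.own i
  have hp := hb.pinv i
  have hl := hb.loclt
  -- If the CAS on the own entry fails, the entry holds an operation of another thread.
  have key : ∀ {m}, (∃ a, s.location i = some a ∧ (a = m ∨ (s.ops a).id ≠ i)) →
      ¬ s.location i = some m → ∃ a, s.location i = some a ∧ (s.ops a).id ≠ i := by
    rintro m ⟨a, h1, h2⟩ h3
    refine ⟨a, h1, h2.resolve_left ?_⟩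
    rintro rfl; exact h3 h1
  have key' : ∀ {m a}, (∃ a, s.location i = some a ∧ (s.ops a).id ≠ i) → (s.ops m).id = i →
      s.location (s.ops m).id = some a → s.location i = some a ∧ (s.ops a).id ≠ i := by
    rintro m a ⟨b, h1, h2⟩ h3 h4
    rw [h3] at h4
    obtain rfl := Option.some_injective _ (h1.symm.trans h4)
    exact ⟨h1, h2⟩
  unfold Step at h
  split at h
  case h_1 hpc =>
    rw [hpc] at hp
    rcases h with rfl | ⟨d, rfl⟩ | rfl
    · rwa [hpc]
    · simpa [invokePush, PInv] using hp
    · simpa [invokePop, PInv] using hp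
  all_goals
    rename_i hpc
    rw [hpc] at own hp
    have own := fun m h => (own m h).2
    simp only [PC.op?, Option.some.injEq, forall_eq'] at own
    obtain ⟨_, rfl⟩ := h
    repeat' split
    all_goals first
      | (rw [hpc]; exact hp)
      | (rw [startLoop_eq]; simp only [goto_pc, Function.update_self]; first
          | exact pinv_loopPC hp.1 rfl
          | exact pinv_loopPC hp rfl
          | exact pinv_loopPC (Function.update_self ..) rfl)
      | (simp only [goto_pc, Function.update_self]; first
          | exact hp
          | exact hp.1
          | exact hp.2
          | exact key hp (by assumption)
          | exact key hp.1 (by assumption)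
          | exact ⟨hp, hl _ _ (by assumption), (by assumption : _ ∧ _).1⟩
          | exact ⟨Function.update_self .., hp.2⟩
          | exact ⟨(Function.update_of_ne hp.2.2.symm _ _).trans hp.1, ‹_›⟩
          | exact (Function.update_of_ne hp.2.2.symm _ _).trans hp.1
          | exact key' hp own (by assumption)
          | exact ⟨_, rfl, .inl rfl⟩
          | (simp [PInv]; done)
          | simp [PInv, *])

theorem PInv.frame {j : Fin N} {c : PC N} (hp : s.PInv j c) (hb : Base s)
    (hop : ∀ m, c.op? = some m → m < s.numOps ∧ (s.ops m).id = j) (hs : Static i s s') (hj : j ≠ i)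
    (hl : s'.location j = s.location j ∨ ∃ m p, s.pc i = .activeCas m p ∧ s.location j = some p ∧
      (s.ops p).id = j ∧ s'.location j = some m) : s'.PInv j c := by
  -- A capture writes an operation of thread `i`, which is foreign to `j`.
  have key : ∀ {m}, (∃ a, s.location j = some a ∧ (a = m ∨ (s.ops a).id ≠ j)) →
      ∃ a, s'.location j = some a ∧ (a = m ∨ (s'.ops a).id ≠ j) := by
    rintro m ⟨a, h1, h2⟩
    rcases hl with h3 | ⟨m', p, h4, h5, h6, h7⟩
    · refine ⟨a, h3.trans h1, h2.imp_right fun h => ?_⟩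
      rwa [hs.id a (hb.loclt _ _ h1)]
    · refine ⟨m', h7, .inr ?_⟩
      obtain ⟨h8, h9⟩ := hb.own i m' (by rw [h4]; rfl)
      rw [hs.id _ h8, h9]; exact hj.symm
  have hnone : s.location j = none → s'.location j = none := by
    intro h1
    rcases hl with h3 | ⟨m', p, h4, h5, h6, h7⟩
    · exact h3.trans h1
    · rw [h1] at h5; cases h5
  -- A foreign entry cannot be captured once more: the CAS expects an operation of the owner of the
  -- entry.
  have hsome : ∀ {a}, s.location j = some a → (s.ops a).id ≠ j →
      s'.location j = some a ∧ (s'.ops a).id ≠ j := by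
    intro a h1 h2
    rcases hl with h3 | ⟨m', p, h4, h5, h6, h7⟩
    · exact ⟨h3.trans h1, by rwa [hs.id a (hb.loclt _ _ h1)]⟩
    · obtain rfl := Option.some_injective _ (h1.symm.trans h5)
      exact (h2 h6).elim
  have hop' : ∀ m, c.op? = some m → (s'.ops m).op = (s.ops m).op := fun m h => hs.op m (hop m h).1
  have hid : ∀ {p}, p < s.numOps ∧ (s.ops p).id ≠ j → p < s'.numOps ∧ (s'.ops p).id ≠ j := by
    rintro p ⟨h1, h2⟩
    exact ⟨h1.trans_le hs.le, by rwa [hs.id p h1]⟩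
  cases c <;> first
    | exact key hp
    | exact hnone hp
    | exact hsome hp.1 hp.2
    | exact ⟨hnone hp.1, (hop' _ rfl).trans hp.2⟩
    | exact ⟨hnone hp.1, hid hp.2⟩
    | exact ⟨key hp.1, hid hp.2⟩
    | (obtain ⟨a, h1, h2⟩ := hp; exact ⟨a, hsome h1 h2⟩)

theorem Step.base (h : Step i s s') (hb : Base s) : Base s' := by
  have hs := h.static
  refine ⟨fun j m hm => ?_, fun j a ha => ?_, fun j => ?_⟩
  · by_cases e : j = i
    · subst e
      rcases h.op? with h1 | h1 | ⟨h1, h2, h3, h4⟩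
      · rw [h1] at hm
        obtain ⟨h2, h3⟩ := hb.own j m hm
        exact ⟨h2.trans_le hs.le, (hs.id m h2).trans h3⟩
      · rw [h1] at hm; cases hm
      · rw [h2] at hm; cases hm
        exact ⟨by omega, h4⟩
    · rw [hs.pc j e] at hm
      obtain ⟨h2, h3⟩ := hb.own j m hm
      exact ⟨h2.trans_le hs.le, (hs.id m h2).trans h3⟩
  · by_cases e : j = i
    · subst e
      rcases h.location_self hb with h1 | h1 | ⟨m, h1, h2⟩
      · rw [h1] at ha; exact (hb.loclt j a ha).trans_le hs.le
      · rw [h1] at ha; cases ha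
      · rw [h2] at ha; cases ha
        exact (hb.own j a (by rw [h1]; rfl)).1.trans_le hs.le
    · rcases h.location hb e with h1 | ⟨m, p, h1, h2, h3, h4⟩
      · rw [h1] at ha; exact (hb.loclt j a ha).trans_le hs.le
      · rw [h4] at ha; cases ha
        exact (hb.own i a (by rw [h1]; rfl)).1.trans_le hs.le
  · by_cases e : j = i
    · subst e; exact h.pinv_self hb
    · rw [hs.pc j e]
      exact (hb.pinv j).frame hb (hb.own j) hs e (h.location hb e)

theorem IsInitial.base (h : s.IsInitial) : Base s := by
  obtain ⟨h1, h2, h3, h4, h5, h6, h7⟩ := h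
  refine ⟨fun i m hm => ?_, fun i a ha => ?_, fun i => ?_⟩
  · rw [h7] at hm; cases hm
  · rw [h6] at ha; cases ha
  · rw [h7]; exact h6 i

end State
end DECS

/-! ### Roles and ranks of program counters; the statement to be proved for each step -/

namespace DECS

variable {N : ℕ} {D : Type*}

/-- The role of a thread, determined from its program counter and its entry of `location`. -/
def roleOf (op : ℕ → Kind) (loc : Option ℕ) : PC N → Role
  | .idle => .idle
  | .popTop m | .popInitNext m _ | .popLoop m _ _ _ | .popIncr m _ _ _ | .popCas m _ _
  | .pushTop m | .pushSetLast m _ | .pushCas m _ | .announce m | .activeCas m _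
  | .combineLength m _ => .free m
  | .getIndex m | .getHim m _ | .casCollision m _ _ | .getInfo m _ | .casLocation m _ | .delay m
  | .casLocationDelayed m | .passiveGet m =>
      if loc = some m then .free m
      else if loc.map op = some (op m) then .capt m else .gone m
  | .passiveReset m a => if op m = op a then .capt m else .gone m
  | .combineCells m p | .combineNext m p => .merge m p
  | .combineLast m p => .merged m p
  | .popEmptyCell m cur | .popEmptyStatus m cur => .empt m cur
  | .popEmptyNext m cur => .emptNext m cur
  | .popOwnCell m _ | .popOwnTop m _ | .popWhile m _ | .pushWhile m => .give m
  | .popGiveCell m _ | .popGiveTop m _ | .popStatus m _ | .pushStatus m => .hand m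
  | .popUnlink m _ | .pushUnlink m => .unlink m
  | .elimCell m p a q | .elimStatusA m p a q => .elimA m p a q
  | .elimStatusP m p a q => .elimP m p a q
  | .elimLengthA m p a q | .elimLengthP m p a q | .elimNextA m p a q => .elimNext m p a q
  | .elimNextP m p a q => .elimTest m p a q
  | .residueLength m src h | .residueLast m src h => .residue m src h
  | .residueRetry m src h => .residueRetry m src h
  | .spin m => .capt m
  | .checkStatus m => .check m
  | .setInit m => .ready m
  | .passiveCell m _ | .ret m => .gone m

/-- The termination measure of an iteration. It decreases lexicographically at each line that is
executed. Here `len` are the values of the field `length`, and `w` is the number of operations that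
the thread still has to signal. -/
def rank (len : ℕ → ℤ) (w : ℕ) : PC N → ℕ × ℕ
  | .idle => (0, 0)
  | .ret _ => (0, 1)
  | .passiveCell _ _ => (1, 0)
  | .popEmptyCell m cur => (2, 10 * (w + if cur = m then 1 else 0) + 12)
  | .popEmptyStatus m cur => (2, 10 * (w + if cur = m then 1 else 0) + 11)
  | .popEmptyNext _ _ => (2, 10 * w + 13)
  | .popOwnCell _ _ => (2, 10 * w + 30)
  | .popOwnTop _ _ => (2, 10 * w + 29)
  | .popWhile _ _ | .pushWhile _ => (2, 10 * w + 16)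
  | .popGiveCell _ _ => (2, 10 * w + 15)
  | .popGiveTop _ _ => (2, 10 * w + 14)
  | .popStatus _ _ | .pushStatus _ => (2, 10 * w + 13)
  | .popUnlink _ _ | .pushUnlink _ => (2, 10 * w + 22)
  | .elimCell _ p _ q => (2, 10 * (w + if q = p then 2 else 0) + 12)
  | .elimStatusA _ p _ q => (2, 10 * (w + if q = p then 2 else 0) + 11)
  | .elimStatusP _ p _ q => (2, 10 * (w + if q = p then 1 else 0) + 15)
  | .elimLengthA _ _ _ _ => (2, 10 * w + 20)
  | .elimLengthP _ _ _ _ => (2, 10 * w + 19)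
  | .elimNextA _ _ _ _ => (2, 10 * w + 18)
  | .elimNextP _ _ _ _ => (2, 10 * w + 17)
  | .residueLength _ _ _ => (2, 10 * w + 9)
  | .residueLast _ _ _ => (2, 10 * w + 8)
  | .residueRetry _ _ _ => (2, 10 * w + 7)
  | .checkStatus _ => (3, 9)
  | .setInit _ => (3, 8)
  | .combineCells _ _ => (3, 7)
  | .combineNext _ _ => (3, 6)
  | .combineLast _ _ => (3, 5)
  | .combineLength _ _ => (3, 4)
  | .getInfo _ _ => (4, 9)
  | .casLocation _ _ | .delay _ => (4, 8)
  | .activeCas _ _ | .casLocationDelayed _ => (4, 7)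
  | .passiveGet _ => (4, 6)
  | .passiveReset _ _ => (4, 5)
  | .spin _ => (4, 4)
  | .announce _ => (5, 9)
  | .getIndex _ => (5, 8)
  | .getHim _ _ => (5, 7)
  | .casCollision _ _ _ => (5, 6)
  | .popCas _ _ _ | .pushCas _ _ => (6, 0)
  | .popLoop m _ _ k => (7, 2 * (len m - k).toNat + 1)
  | .popIncr m _ _ k => (7, 2 * (len m - (k + 1)).toNat + 2)
  | .popInitNext _ _ | .pushSetLast _ _ => (8, 0)
  | .popTop _ | .pushTop _ => (9, 0)

namespace State

variable {s s' : State N D} {i : Fin N} {lin : ℕ → Prop} {del : ℕ → ℕ → Prop}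
  {la lb : Fin N → List ℕ}

/-- The configuration that belongs to a state. -/
def conf (s : State N D) (lin : ℕ → Prop) (del : ℕ → ℕ → Prop) (la lb : Fin N → List ℕ) :
    Conf N where
  n := s.numOps
  id x := (s.ops x).id
  op x := (s.ops x).op
  status x := (s.ops x).cStatus
  next x := (s.ops x).next
  last x := (s.ops x).last
  role j := roleOf (fun x => (s.ops x).op) (s.location j) (s.pc j)
  lin := lin
  del := del
  la := la
  lb := lb

/-- The delegate relation after a step of thread `i` from `s` to `s'`. -/
def delegateStep (s s' : State N D) (i : Fin N) (del : ℕ → ℕ → Prop) (d r : ℕ) : Prop :=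
  match s.pc i with
  | .idle => del d r ∨ (s.numOps < s'.numOps ∧ d = s.numOps ∧ r = s.numOps)
  | .activeCas m p =>
    if s.location (s.ops p).id = some p ∧ (s.ops m).op = (s.ops p).op then
      (d = m ∧ del p r) ∨ (d ≠ p ∧ del d r)
    else del d r
  | .residueRetry _ src h =>
    (d = h ∧ del src r ∧ s.InList h r) ∨ (del d r ∧ ¬ (d = src ∧ s.InList h r))
  | _ => del d r

/-- Every push operation has a cell. -/
def PushCells (s : State N D) : Prop :=
  ∀ x < s.numOps, (s.ops x).op = .push → (s.ops x).cell ≠ none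

/-- Thread `i` makes progress in its iteration, or leaves it, or has to wait. -/
def Advances (i : Fin N) (s s' : State N D) (w w' : ℕ) : Prop :=
  s.pc i = .idle ∨ s'.pc i = .idle ∨ (∃ m, s'.pc i = .popTop m ∨ s'.pc i = .pushTop m) ∨
    (∃ m, s.Waiting i m) ∨
    (∃ m index him, s.pc i = .casCollision m index him ∧ s.collision index ≠ him) ∨
    Prod.Lex (· < ·) (· < ·) (rank (fun m => (s'.ops m).length) w' (s'.pc i))
      (rank (fun m => (s.ops m).length) w (s.pc i))

/-- The invariant holds after the step, and the step has the required effects. -/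
def Good (i : Fin N) (s s' : State N D) (lin : ℕ → Prop) (del : ℕ → ℕ → Prop)
    (la lb : Fin N → List ℕ) : Prop :=
  ∃ la' lb', (s'.conf (fun x => lin x ∨ s.Linearizes i x) (s.delegateStep s' i del) la' lb').Inv ∧
    Conf.Trans i (s.conf lin del la lb)
      (s'.conf (fun x => lin x ∨ s.Linearizes i x) (s.delegateStep s' i del) la' lb') ∧
    s.Advances i s' ((la i).length + (lb i).length) ((la' i).length + (lb' i).length)

/-- It suffices to recognize, field by field, the configuration after the step as the result `c'` of
an abstract transition. -/
theorem Good.mk (c' : Conf N) (h : c'.Inv ∧ Conf.Trans i (s.conf lin del la lb) c')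
    (hn : s'.numOps = c'.n) (hid : ∀ x, (s'.ops x).id = c'.id x)
    (hop : ∀ x, (s'.ops x).op = c'.op x) (hst : ∀ x, (s'.ops x).cStatus = c'.status x)
    (hnx : ∀ x, (s'.ops x).next = c'.next x) (hlt : ∀ x, (s'.ops x).last = c'.last x)
    (hrole : ∀ j, roleOf (fun x => (s'.ops x).op) (s'.location j) (s'.pc j) = c'.role j)
    (hlin : ∀ x, (lin x ∨ s.Linearizes i x) ↔ c'.lin x)
    (hdel : ∀ d r, s.delegateStep s' i del d r ↔ c'.del d r)
    (hadv : s.Advances i s' ((la i).length + (lb i).length)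
      ((c'.la i).length + (c'.lb i).length)) : Good i s s' lin del la lb := by
  have e : s'.conf (fun x => lin x ∨ s.Linearizes i x) (s.delegateStep s' i del)
      c'.la c'.lb = c' := by
    obtain ⟨n, id, op, st, nx, lt, role, lin', del', la', lb'⟩ := c'
    simp only [conf, Conf.mk.injEq]
    exact ⟨hn, funext hid, funext hop, funext hst, funext hnx, funext hlt, funext hrole,
      funext fun x => propext (hlin x), funext fun d => funext fun r =>
        propext (hdel d r), trivial, trivial⟩
  exact ⟨c'.la, c'.lb, by rw [e]; exact h.1, by rw [e]; exact h.2, hadv⟩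

theorem update_status {ops : ℕ → MultiOp N} {r : ℕ} {o : MultiOp N} (x : ℕ) :
    (Function.update ops r o x).cStatus =
      Function.update (fun x => (ops x).cStatus) r o.cStatus x := by
  by_cases e : x = r
  · subst e; simp
  · simp [e]

theorem update_next {ops : ℕ → MultiOp N} {r : ℕ} {o : MultiOp N} (x : ℕ) :
    (Function.update ops r o x).next = Function.update (fun x => (ops x).next) r o.next x := by
  by_cases e : x = r
  · subst e; simp
  · simp [e]

theorem update_last {ops : ℕ → MultiOp N} {r : ℕ} {o : MultiOp N} (x : ℕ) :
    (Function.update ops r o x).last = Function.update (fun x => (ops x).last) r o.last x := by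
  by_cases e : x = r
  · subst e; simp
  · simp [e]

theorem update_apply_eq {α : Type*} {f : ℕ → α} {r : ℕ} {a : α} (h : a = f r) (x : ℕ) :
    Function.update f r a x = f x := by
  rw [h, Function.update_eq_self]

/-- A step of thread `i` that does not touch the entries of the others in `location`. -/
theorem Good.local (c' : Conf N) (r : Role) (h : c'.Inv ∧ Conf.Trans i (s.conf lin del la lb) c')
    (hr : c'.role = Function.update (s.conf lin del la lb).role i r)
    (hn : s'.numOps = c'.n) (hid : ∀ x, (s'.ops x).id = c'.id x)
    (hop : ∀ x, (s'.ops x).op = c'.op x) (hop' : c'.op = fun x => (s.ops x).op)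
    (hst : ∀ x, (s'.ops x).cStatus = c'.status x)
    (hnx : ∀ x, (s'.ops x).next = c'.next x) (hlt : ∀ x, (s'.ops x).last = c'.last x)
    (hrole : roleOf (fun x => (s.ops x).op) (s'.location i) (s'.pc i) = r)
    (hloc : ∀ j ≠ i, s'.location j = s.location j) (hpc : ∀ j ≠ i, s'.pc j = s.pc j)
    (hlin : ∀ x, (lin x ∨ s.Linearizes i x) ↔ c'.lin x)
    (hdel : ∀ d r, s.delegateStep s' i del d r ↔ c'.del d r)
    (hadv : s.Advances i s' ((la i).length + (lb i).length)
      ((c'.la i).length + (c'.lb i).length)) : Good i s s' lin del la lb := by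
  refine Good.mk c' h hn hid hop hst hnx hlt (fun j => ?_) hlin hdel hadv
  have : (fun x => (s'.ops x).op) = fun x => (s.ops x).op := by
    rw [← hop']; exact funext hop
  rw [this, hr]
  by_cases e : j = i
  · subst e; simpa using hrole
  · simp [e, conf, hloc, hpc]

/-- A step that changes only data that is not part of the configuration. -/
theorem Good.skip (h : (s.conf lin del la lb).Inv)
    (hn : s'.numOps = s.numOps) (hid : ∀ x, (s'.ops x).id = (s.ops x).id)
    (hop : ∀ x, (s'.ops x).op = (s.ops x).op)
    (hst : ∀ x, (s'.ops x).cStatus = (s.ops x).cStatus)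
    (hnx : ∀ x, (s'.ops x).next = (s.ops x).next) (hlt : ∀ x, (s'.ops x).last = (s.ops x).last)
    (hrole : roleOf (fun x => (s.ops x).op) (s'.location i) (s'.pc i) =
      roleOf (fun x => (s.ops x).op) (s.location i) (s.pc i))
    (hloc : ∀ j ≠ i, s'.location j = s.location j) (hpc : ∀ j ≠ i, s'.pc j = s.pc j)
    (hlin : ∀ x, ¬ s.Linearizes i x)
    (hdel : ∀ d r, s.delegateStep s' i del d r ↔ del d r)
    (hadv : s.Advances i s' ((la i).length + (lb i).length)
      ((la i).length + (lb i).length)) : Good i s s' lin del la lb :=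
  Good.local (s.conf lin del la lb) _ ⟨h, .refl _⟩ (Function.update_eq_self ..).symm
    hn hid hop rfl hst hnx hlt
    hrole hloc hpc (fun x => by simp [hlin, conf]) hdel hadv

end State
end DECS

/-! ### The invariant and the rank at the individual lines -/

namespace DECS

/-- A relabeling of a thread that works on the same operation. -/
theorem Conf.Inv.relabelActive {N : ℕ} {c : Conf N} {i : Fin N} {m : ℕ} (h : c.Inv) (r : Role)
    (hm : (c.role i).op? = some m) (ha : (c.role i).Active) (hr : r.op? = some m)
    (hcapt : r ≠ .capt m) (hself : c.RInv (c.la i) (c.lb i) r)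
    (hw : (c.role i).Working → r.Working ∨ c.la i = [] ∧ c.lb i = []) :
    Inv { c with role := Function.update c.role i r } ∧
      Trans i c { c with role := Function.update c.role i r } :=
  h.relabel (fun x hx => by rwa [← hr.symm.trans hx]) (fun x e => by rw [e] at ha; exact ha.elim)
    (fun x e => hcapt (by subst e; cases hr; rfl))
    (fun x g hx _ => (h.not_gone_of_active hx ha g).elim) hself hw

namespace State

variable {N : ℕ} {D : Type*} {s s' : State N D} {i : Fin N} {lin : ℕ → Prop} {del : ℕ → ℕ → Prop}
  {la lb : Fin N → List ℕ}

theorem roleOf_loopPC (op : ℕ → Kind) (loc : Option ℕ) (o : Kind) (m : ℕ) :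
    roleOf op loc (loopPC N o m) = .free m := by cases o <;> rfl

theorem roleOf_congr {op op' : ℕ → Kind} {loc : Option ℕ} {c : PC N}
    (h : ∀ m, c.op? = some m → op' m = op m) (hl : ∀ a, loc = some a → op' a = op a)
    (hp : ∀ m a, c = .passiveReset m a → op' a = op a) : roleOf op' loc c = roleOf op loc c := by
  have key : ∀ m, op' m = op m → (if loc = some m then Role.free m
      else if loc.map op' = some (op' m) then .capt m else .gone m) =
      if loc = some m then Role.free m
      else if loc.map op = some (op m) then .capt m else .gone m := by
    intro m hm
    cases loc with
    | none => rfl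
    | some a => simp only [Option.map_some, hl a rfl, hm]
  cases c with
  | getIndex m | getHim m | casCollision m | getInfo m | casLocation m | delay m
  | casLocationDelayed m | passiveGet m => exact key m (h m rfl)
  | passiveReset m a => simp only [roleOf, h m rfl, hp m a rfl]
  | _ => rfl

theorem loopPC_eq (o : Kind) (m : ℕ) : loopPC N o m = .popTop m ∨ loopPC N o m = .pushTop m := by
  cases o
  exacts [.inr rfl, .inl rfl]

theorem Advances.of_rank {w w' : ℕ} (h : Prod.Lex (· < ·) (· < ·)
    (rank (fun m => (s'.ops m).length) w' (s'.pc i))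
    (rank (fun m => (s.ops m).length) w (s.pc i))) :
    s.Advances i s' w w' := .inr (.inr (.inr (.inr (.inr h))))

theorem Advances.of_loop {w w' : ℕ} {o : Kind} {m : ℕ} (h : s'.pc i = loopPC N o m) :
    s.Advances i s' w w' := .inr (.inr (.inl ⟨m, h ▸ loopPC_eq o m⟩))

section

variable {r : ℕ} {f : MultiOp N → MultiOp N} (x : ℕ)

theorem modOp_id (h : ∀ o, (f o).id = o.id) : ((s.modOp r f).ops x).id = (s.ops x).id :=
  update_id (h _) x

theorem modOp_op (h : ∀ o, (f o).op = o.op) : ((s.modOp r f).ops x).op = (s.ops x).op :=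
  update_op (h _) x

theorem modOp_status (h : ∀ o, (f o).cStatus = o.cStatus) :
    ((s.modOp r f).ops x).cStatus = (s.ops x).cStatus :=
  (update_status x).trans (update_apply_eq (h _) x)

theorem modOp_next (h : ∀ o, (f o).next = o.next) :
    ((s.modOp r f).ops x).next = (s.ops x).next :=
  (update_next x).trans (update_apply_eq (h _) x)

theorem modOp_last (h : ∀ o, (f o).last = o.last) :
    ((s.modOp r f).ops x).last = (s.ops x).last :=
  (update_last x).trans (update_apply_eq (h _) x)

end

/-- A step of thread `i` to the line `c` that changes only data that is not part of the
configuration. -/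
theorem Good.skipTo {t : State N D} {c : PC N} (h : (s.conf lin del la lb).Inv)
    (hs' : s' = t.goto i c) (hn : t.numOps = s.numOps) (hpc : t.pc = s.pc)
    (hid : ∀ x, (t.ops x).id = (s.ops x).id)
    (hop : ∀ x, (t.ops x).op = (s.ops x).op)
    (hst : ∀ x, (t.ops x).cStatus = (s.ops x).cStatus)
    (hnx : ∀ x, (t.ops x).next = (s.ops x).next) (hlt : ∀ x, (t.ops x).last = (s.ops x).last)
    (hrole : roleOf (fun x => (s.ops x).op) (t.location i) c =
      roleOf (fun x => (s.ops x).op) (s.location i) (s.pc i))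
    (hloc : ∀ j ≠ i, t.location j = s.location j)
    (hlin : ∀ x, ¬ s.Linearizes i x)
    (hdel : ∀ d r, s.delegateStep (t.goto i c) i del d r ↔ del d r)
    (hadv : s.Advances i (t.goto i c) ((la i).length + (lb i).length)
      ((la i).length + (lb i).length)) : Good i s s' lin del la lb := by
  subst hs'
  exact Good.skip h hn hid hop hst hnx hlt (by simpa using hrole) hloc
    (fun j hj => by simp [hj, hpc]) hlin hdel hadv

theorem nth_succ (r k : ℕ) : s.nth r (k + 1) = ((s.ops r).next).bind fun x => s.nth x k := by
  induction k with
  | zero => simp [nth]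
  | succ k ih =>
    rw [nth, ih]
    cases (s.ops r).next <;> rfl

theorem nth_eq {r : ℕ} {l : List ℕ} (hl : IsList (fun x => (s.ops x).next) (s.ops r).next l)
    (k : ℕ) : s.nth r k = (r :: l)[k]? := by
  induction k generalizing r l with
  | zero => rfl
  | succ k ih =>
    rw [nth_succ]
    cases l with
    | nil =>
      have : (s.ops r).next = none := hl
      simp [this]
    | cons x l =>
      have h1 : (s.ops r).next = some x := hl.1
      rw [h1]
      simpa using ih hl.2

theorem inList_iff {r x : ℕ} {l : List ℕ}
    (hl : IsList (fun x => (s.ops x).next) (s.ops r).next l) : s.InList r x ↔ x ∈ r :: l := by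
  unfold InList
  simp only [nth_eq hl]
  exact List.mem_iff_getElem?.symm

/-- A step that changes only the role of thread `i`, and possibly linearizes operations. -/
theorem Good.move {t : State N D} {c : PC N} {r : Role} {lin' : ℕ → Prop}
    (h : Conf.Inv { s.conf lin del la lb with
        role := Function.update (s.conf lin del la lb).role i r, lin := lin' } ∧
      Conf.Trans i (s.conf lin del la lb) { s.conf lin del la lb with
        role := Function.update (s.conf lin del la lb).role i r, lin := lin' })
    (hs' : s' = t.goto i c) (hn : t.numOps = s.numOps) (hpc : t.pc = s.pc) (hops : t.ops = s.ops)
    (hrole : roleOf (fun x => (s.ops x).op) (t.location i) c = r)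
    (hloc : ∀ j ≠ i, t.location j = s.location j)
    (hlin : ∀ x, (lin x ∨ s.Linearizes i x) ↔ lin' x)
    (hdel : ∀ d r, s.delegateStep (t.goto i c) i del d r ↔ del d r)
    (hadv : s.Advances i (t.goto i c) ((la i).length + (lb i).length)
      ((la i).length + (lb i).length)) : Good i s s' lin del la lb := by
  subst hs'
  refine Good.local _ r h rfl ?_ ?_ ?_ rfl ?_ ?_ ?_ ?_ hloc ?_ hlin hdel hadv
  · exact hn
  · exact fun x => by simp [hops, conf]
  · exact fun x => by simp [hops, conf]
  · exact fun x => by simp [hops, conf]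
  · exact fun x => by simp [hops, conf]
  · exact fun x => by simp [hops, conf]
  · simpa using hrole
  · exact fun j hj => by simp [hj, hpc]

/-- A step that changes the list structure and does not linearize any operation. -/
theorem Good.edit {t : State N D} {c : PC N} {rl : Role} {st : ℕ → Status} {nx : ℕ → Option ℕ}
    {lt : ℕ → ℕ} {la' lb' : Fin N → List ℕ}
    (h : Conf.Inv { s.conf lin del la lb with
        status := st, next := nx, last := lt, la := la', lb := lb'
        role := Function.update (s.conf lin del la lb).role i rl } ∧
      Conf.Trans i (s.conf lin del la lb) { s.conf lin del la lb with
        status := st, next := nx, last := lt, la := la', lb := lb'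
        role := Function.update (s.conf lin del la lb).role i rl })
    (hs' : s' = t.goto i c) (hn : t.numOps = s.numOps) (hpc : t.pc = s.pc)
    (hid : ∀ x, (t.ops x).id = (s.ops x).id) (hop : ∀ x, (t.ops x).op = (s.ops x).op)
    (hst : ∀ x, (t.ops x).cStatus = st x) (hnx : ∀ x, (t.ops x).next = nx x)
    (hlt : ∀ x, (t.ops x).last = lt x) (hloc : t.location = s.location)
    (hrole : roleOf (fun x => (s.ops x).op) (t.location i) c = rl)
    (hlin : ∀ x, ¬ s.Linearizes i x)
    (hdel : ∀ d r, s.delegateStep (t.goto i c) i del d r ↔ del d r)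
    (hadv : s.Advances i (t.goto i c) ((la i).length + (lb i).length)
      ((la' i).length + (lb' i).length)) : Good i s s' lin del la lb := by
  subst hs'
  refine Good.local _ rl h rfl hn hid hop rfl hst hnx hlt ?_ (fun _ _ => by rw [← hloc]; rfl) ?_
    (fun x => by simp [hlin, conf]) hdel hadv
  · simpa using hrole
  · exact fun j hj => by simp [hj, hpc]

/-- A step that changes only the program counter of thread `i`. -/
theorem Good.skipPC {c : PC N} (h : (s.conf lin del la lb).Inv) (hs' : s' = s.goto i c)
    (hrole : roleOf (fun x => (s.ops x).op) (s.location i) c =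
      roleOf (fun x => (s.ops x).op) (s.location i) (s.pc i))
    (hlin : ∀ x, ¬ s.Linearizes i x)
    (hdel : ∀ d r, s.delegateStep (s.goto i c) i del d r ↔ del d r)
    (hadv : s.Advances i (s.goto i c) ((la i).length + (lb i).length)
      ((la i).length + (lb i).length)) : Good i s s' lin del la lb :=
  Good.skipTo h hs' rfl rfl (fun _ => rfl) (fun _ => rfl) (fun _ => rfl) (fun _ => rfl)
    (fun _ => rfl) hrole (fun _ _ => rfl) hlin hdel hadv

section Cases

variable (hb : Base s) (hI : (s.conf lin del la lb).Inv) (h : Step i s s')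

include hI h

theorem good_popTop {m : ℕ} (hpc : s.pc i = .popTop m) : Good i s s' lin del la lb := by
  have hrole : (s.conf lin del la lb).role i = .free m := by simp [conf, hpc, roleOf]
  simp only [Step, hpc] at h
  split at h
  · rename_i hc
    have hr := hI.rinv i
    rw [hrole] at hr
    refine Good.move (hI.linearize hrole (.inl rfl) (lin' := fun x => lin x ∨ s.Linearizes i x)
      fun x => or_congr Iff.rfl ?_) h rfl rfl rfl rfl (fun _ _ => rfl) (fun _ => Iff.rfl)
      (fun _ _ => by simp [delegateStep, hpc]) (.of_rank ?_)
    · simp only [Linearizes, hpc, hc, true_and]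
      exact inList_iff hr.2.2.link
    · rw [hpc]; simp [Prod.lex_def, rank]
  · rename_i top hc
    refine Good.skipPC hI h (by rw [hpc]; rfl) (by simp [Linearizes, hpc, hc])
      (by simp [delegateStep, hpc]) (.of_rank ?_)
    rw [hpc]; simp [Prod.lex_def, rank]

theorem good_popCas {m top : ℕ} {nTop : Option ℕ} (hpc : s.pc i = .popCas m top nTop) :
    Good i s s' lin del la lb := by
  have hrole : (s.conf lin del la lb).role i = .free m := by simp [conf, hpc, roleOf]
  simp only [Step, hpc] at h
  split at h
  · rename_i hc
    have hr := hI.rinv i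
    rw [hrole] at hr
    refine Good.move (hI.linearize hrole (.inr rfl) (lin' := fun x => lin x ∨ s.Linearizes i x)
      fun x => or_congr Iff.rfl ?_) h rfl rfl rfl rfl (fun _ _ => rfl) (fun _ => Iff.rfl)
      (fun _ _ => by simp [delegateStep, hpc]) (.of_rank ?_)
    · simp only [Linearizes, hpc, hc, true_and]
      exact inList_iff hr.2.2.link
    · rw [hpc]; simp [Prod.lex_def, rank]
  · rename_i hc
    refine Good.skipPC hI h (by rw [hpc]; rfl) (by simp [Linearizes, hpc, hc])
      (by simp [delegateStep, hpc]) (.of_rank ?_)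
    rw [hpc]; simp [Prod.lex_def, rank]

theorem good_pushCas {m : ℕ} {top : Option ℕ} (hpc : s.pc i = .pushCas m top) :
    Good i s s' lin del la lb := by
  have hrole : (s.conf lin del la lb).role i = .free m := by simp [conf, hpc, roleOf]
  simp only [Step, hpc] at h
  split at h
  · rename_i hc
    have hr := hI.rinv i
    rw [hrole] at hr
    refine Good.move (hI.linearize hrole (.inr rfl) (lin' := fun x => lin x ∨ s.Linearizes i x)
      fun x => or_congr Iff.rfl ?_) h rfl rfl rfl rfl (fun _ _ => rfl) (fun _ => Iff.rfl)
      (fun _ _ => by simp [delegateStep, hpc]) (.of_rank ?_)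
    · simp only [Linearizes, hpc, hc, true_and]
      exact inList_iff hr.2.2.link
    · rw [hpc]; simp [Prod.lex_def, rank]
  · rename_i hc
    refine Good.skipPC hI h (by rw [hpc]; rfl) (by simp [Linearizes, hpc, hc])
      (by simp [delegateStep, hpc]) (.of_rank ?_)
    rw [hpc]; simp [Prod.lex_def, rank]

theorem good_popEmptyStatus {m cur : ℕ} (hpc : s.pc i = .popEmptyStatus m cur) :
    Good i s s' lin del la lb := by
  have hrole : (s.conf lin del la lb).role i = .empt m cur := by simp [conf, hpc, roleOf]
  simp only [Step, hpc] at h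
  subst h
  obtain ⟨l, h1, h2, h3⟩ := hI.finishEmpty hrole
  refine Good.edit ⟨h1, h2⟩ rfl rfl rfl (fun _ => modOp_id _ (by intro; rfl))
    (fun _ => modOp_op _ (by intro; rfl)) (fun _ => update_status _)
    (fun _ => modOp_next _ (by intro; rfl)) (fun _ => modOp_last _ (by intro; rfl)) rfl rfl
    (fun x => by simp [Linearizes, hpc]) (fun _ _ => by simp [delegateStep, hpc])
    (.of_rank ?_)
  rw [hpc]
  simp only [goto_pc, Function.update_self, Prod.lex_def, rank]
  simp only [conf] at h3 ⊢
  right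
  refine ⟨trivial, ?_⟩
  -- If `cur = m` the number of pending signals stays and the extra unit in the rank is used up;
  -- otherwise that number drops by one. In both cases, with `k` signals left, the rank falls from
  -- `10 * k + 21` to `10 * k + 13`.
  split at h3 <;> simp_all <;> omega

theorem good_popEmptyNext {m cur : ℕ} (hpc : s.pc i = .popEmptyNext m cur) :
    Good i s s' lin del la lb := by
  have hrole : (s.conf lin del la lb).role i = .emptNext m cur := by simp [conf, hpc, roleOf]
  have hm : ((s.conf lin del la lb).role i).op? = some m := by rw [hrole]; rfl
  have hr := hI.rinv i
  rw [hrole] at hr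
  obtain ⟨h1, h2, h3, h4⟩ := hr
  simp only [Step, hpc] at h
  split at h
  · rename_i hc
    have hla : la i = [] := by
      have h4 : IsList _ (s.ops cur).next (la i) := h4
      rw [hc] at h4
      cases e : la i with
      | nil => rfl
      | cons x l => rw [e] at h4; cases h4.1
    refine Good.move (hI.relabelActive (.gone m) hm (by rw [hrole]; trivial) rfl (by simp) ⟨hla, h1⟩
      fun _ => .inr ⟨hla, h1⟩) h rfl rfl rfl rfl
      (fun _ _ => rfl) (fun x => by simp [Linearizes, hpc, conf])
      (fun _ _ => by simp [delegateStep, hpc]) (.of_rank ?_)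
    · rw [hpc]; simp [Prod.lex_def, rank]
  · rename_i w hc
    have h4 : IsList _ (s.ops cur).next (la i) := h4
    rw [hc] at h4
    have hw := h4.head_mem
    -- The cursor does not come back to `m`, so the extra unit in the rank does not reappear.
    have hwm : w ≠ m := by
      rintro rfl
      exact hI.not_held_of_op (j := i) hm (by simp [hrole]) (by simp [conf, hw])
    refine Good.move (hI.relabelActive (.empt m w) hm (by rw [hrole]; trivial) rfl (by simp)
      ⟨h1, h2, .inr h4⟩ fun _ => .inl trivial) h rfl rfl rfl rfl
      (fun _ _ => rfl) (fun x => by simp [Linearizes, hpc, conf])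
      (fun _ _ => by simp [delegateStep, hpc]) (.of_rank ?_)
    · rw [hpc]; simp [Prod.lex_def, rank, hwm]

omit h in
/-- The tests at the head of the loop that serves the list of `m`. -/
theorem good_while {m : ℕ} {c₁ c₂ : PC N} (hrole : (s.conf lin del la lb).role i = .give m)
    (h : s' = match (s.ops m).next with
      | none => s.goto i c₁
      | some _ => s.goto i c₂)
    (hc₁ : ∀ op loc, roleOf op loc c₁ = .gone m) (hc₂ : ∀ op loc, roleOf op loc c₂ = .hand m)
    (hlin : ∀ x, ¬ s.Linearizes i x) (hdel : ∀ s' d r, s.delegateStep s' i del d r ↔ del d r)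
    (hadv : ∀ w (c : PC N), c = c₁ ∨ c = c₂ → s.Advances i (s.goto i c) w w) :
    Good i s s' lin del la lb := by
  have hm : ((s.conf lin del la lb).role i).op? = some m := by rw [hrole]; rfl
  have hr := hI.rinv i
  rw [hrole] at hr
  obtain ⟨h1, h2, h4⟩ := hr
  have h4 : IsList _ (s.ops m).next (la i) := h4
  split at h
  · rename_i hc
    have hla : la i = [] := by
      rw [hc] at h4
      cases e : la i with
      | nil => rfl
      | cons x l => rw [e] at h4; cases h4.1
    refine Good.move (hI.relabelActive (.gone m) hm (by rw [hrole]; trivial) rfl (by simp) ⟨hla, h1⟩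
      fun _ => .inr ⟨hla, h1⟩) h rfl rfl rfl (hc₁ _ _)
      (fun _ _ => rfl) (fun x => by simp [hlin, conf])
      (fun _ _ => hdel _ _ _) (hadv _ _ (.inl rfl))
  · rename_i w hc
    have hla : la i ≠ [] := by
      intro e
      rw [hc, e] at h4; cases h4
    refine Good.move (hI.relabelActive (.hand m) hm (by rw [hrole]; trivial) rfl (by simp)
      ⟨h1, h2, h4, hla⟩ fun _ => .inl trivial) h rfl rfl rfl
      (hc₂ _ _) (fun _ _ => rfl) (fun x => by simp [hlin, conf])
      (fun _ _ => hdel _ _ _) (hadv _ _ (.inr rfl))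

omit h in
theorem next_of_hand {m : ℕ} (hrole : (s.conf lin del la lb).role i = .hand m) :
    ∃ w, (s.ops m).next = some w := by
  have hr := hI.rinv i
  rw [hrole] at hr
  obtain ⟨h1, h2, h3, h4⟩ := hr
  cases e : (s.conf lin del la lb).la i with
  | nil => exact (h4 e).elim
  | cons x l => rw [e] at h3; exact ⟨x, h3.1⟩

omit h in
/-- The next operation of the list that is served is finished. -/
theorem good_finishNext {m w : ℕ} {c : PC N} (hrole : (s.conf lin del la lb).role i = .hand m)
    (hw : (s.ops m).next = some w)
    (h : s' = (s.modOp w fun x => { x with cStatus := .finished }).goto i c)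
    (hc : ∀ op loc, roleOf op loc c = .unlink m)
    (hlin : ∀ x, ¬ s.Linearizes i x) (hdel : ∀ s' d r, s.delegateStep s' i del d r ↔ del d r)
    (hadv : ∀ k, s.Advances i s' (k + 1) k) : Good i s s' lin del la lb := by
  obtain ⟨l, h1, h2, h3⟩ := hI.finishNext hrole hw
  refine Good.edit ⟨h1, h2⟩ h rfl rfl (fun _ => modOp_id _ (by intro; rfl))
    (fun _ => modOp_op _ (by intro; rfl)) (fun _ => update_status _)
    (fun _ => modOp_next _ (by intro; rfl)) (fun _ => modOp_last _ (by intro; rfl)) rfl (hc _ _)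
    hlin (fun _ _ => hdel _ _ _) ?_
  subst h
  have e : (la i).length + (lb i).length = l.length + (lb i).length + 1 := by
    have h3 : l.length + 1 = (la i).length := h3
    omega
  rw [e, Function.update_self]
  exact hadv _

omit h in
/-- The operation that has been served is unlinked. -/
theorem good_unlinkNext {m w : ℕ} {c : PC N} (hrole : (s.conf lin del la lb).role i = .unlink m)
    (hw : (s.ops m).next = some w)
    (h : s' = (s.modOp m fun x => { x with next := (s.ops w).next }).goto i c)
    (hc : ∀ op loc, roleOf op loc c = .give m)
    (hlin : ∀ x, ¬ s.Linearizes i x) (hdel : ∀ s' d r, s.delegateStep s' i del d r ↔ del d r)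
    (hadv : ∀ k, s.Advances i s' k k) : Good i s s' lin del la lb := by
  refine Good.edit (hI.unlinkNext hrole hw) h rfl rfl (fun _ => modOp_id _ (by intro; rfl))
    (fun _ => modOp_op _ (by intro; rfl)) (fun _ => modOp_status _ (by intro; rfl))
    (fun _ => update_next _) (fun _ => modOp_last _ (by intro; rfl)) rfl (hc _ _)
    hlin (fun _ _ => hdel _ _ _) ?_
  subst h
  exact hadv _

omit h in
theorem next_of_unlink {m : ℕ} (hrole : (s.conf lin del la lb).role i = .unlink m) :
    ∃ w, (s.ops m).next = some w := by
  have hr := hI.rinv i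
  rw [hrole] at hr
  obtain ⟨-, -, w, hw, -⟩ := hr
  exact ⟨w, hw⟩

theorem good_popWhile {m : ℕ} {top : Option ℕ} (hpc : s.pc i = .popWhile m top) :
    Good i s s' lin del la lb := by
  simp only [Step, hpc] at h
  refine good_while hI (m := m) (c₁ := .ret m) (c₂ := .popGiveCell m top)
    (by simp [conf, hpc, roleOf]) h (fun _ _ => rfl) (fun _ _ => rfl) (by simp [Linearizes, hpc])
    (by simp [delegateStep, hpc]) ?_
  rintro w c (rfl | rfl)
  all_goals
    refine .of_rank ?_
    rw [hpc]; simp [Prod.lex_def, rank]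

theorem good_pushWhile {m : ℕ} (hpc : s.pc i = .pushWhile m) :
    Good i s s' lin del la lb := by
  simp only [Step, hpc] at h
  refine good_while hI (m := m) (c₁ := .ret m) (c₂ := .pushStatus m)
    (by simp [conf, hpc, roleOf]) h (fun _ _ => rfl) (fun _ _ => rfl) (by simp [Linearizes, hpc])
    (by simp [delegateStep, hpc]) ?_
  rintro w c (rfl | rfl)
  all_goals
    refine .of_rank ?_
    rw [hpc]; simp [Prod.lex_def, rank]

theorem good_popStatus {m : ℕ} {top : Option ℕ} (hpc : s.pc i = .popStatus m top) :
    Good i s s' lin del la lb := by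
  have hrole : (s.conf lin del la lb).role i = .hand m := by simp [conf, hpc, roleOf]
  obtain ⟨w, hw⟩ := next_of_hand hI hrole
  simp only [Step, hpc, hw] at h
  refine good_finishNext hI hrole hw h (fun _ _ => rfl) (by simp [Linearizes, hpc])
    (by simp [delegateStep, hpc]) fun k => .of_rank ?_
  subst h
  rw [hpc]; simp [Prod.lex_def, rank]; omega

theorem good_pushStatus {m : ℕ} (hpc : s.pc i = .pushStatus m) : Good i s s' lin del la lb := by
  have hrole : (s.conf lin del la lb).role i = .hand m := by simp [conf, hpc, roleOf]
  obtain ⟨w, hw⟩ := next_of_hand hI hrole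
  simp only [Step, hpc, hw] at h
  refine good_finishNext hI hrole hw h (fun _ _ => rfl) (by simp [Linearizes, hpc])
    (by simp [delegateStep, hpc]) fun k => .of_rank ?_
  subst h
  rw [hpc]; simp [Prod.lex_def, rank]; omega

theorem good_popUnlink {m : ℕ} {top : Option ℕ} (hpc : s.pc i = .popUnlink m top) :
    Good i s s' lin del la lb := by
  have hrole : (s.conf lin del la lb).role i = .unlink m := by simp [conf, hpc, roleOf]
  obtain ⟨w, hw⟩ := next_of_unlink hI hrole
  simp only [Step, hpc, hw] at h
  refine good_unlinkNext hI hrole hw h (fun _ _ => rfl) (by simp [Linearizes, hpc])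
    (by simp [delegateStep, hpc]) fun k => .of_rank ?_
  subst h
  rw [hpc]; simp [Prod.lex_def, rank]

theorem good_pushUnlink {m : ℕ} (hpc : s.pc i = .pushUnlink m) : Good i s s' lin del la lb := by
  have hrole : (s.conf lin del la lb).role i = .unlink m := by simp [conf, hpc, roleOf]
  obtain ⟨w, hw⟩ := next_of_unlink hI hrole
  simp only [Step, hpc, hw] at h
  refine good_unlinkNext hI hrole hw h (fun _ _ => rfl) (by simp [Linearizes, hpc])
    (by simp [delegateStep, hpc]) fun k => .of_rank ?_
  subst h
  rw [hpc]; simp [Prod.lex_def, rank]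

theorem good_elimStatusA {m p a q : ℕ} (hpc : s.pc i = .elimStatusA m p a q) :
    Good i s s' lin del la lb := by
  have hrole : (s.conf lin del la lb).role i = .elimA m p a q := by simp [conf, hpc, roleOf]
  simp only [Step, hpc] at h
  obtain ⟨l, h1, h2, h3, -⟩ := hI.finishA hrole
  refine Good.edit ⟨h1, h2⟩ h rfl rfl (fun _ => modOp_id _ (by intro; rfl))
    (fun _ => modOp_op _ (by intro; rfl)) (fun _ => update_status _)
    (fun _ => modOp_next _ (by intro; rfl)) (fun _ => modOp_last _ (by intro; rfl)) rfl rfl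
    (fun x => by simp [Linearizes, hpc]) (fun _ _ => by simp [delegateStep, hpc]) (.of_rank ?_)
  rw [hpc]
  simp only [goto_pc, Function.update_self, Prod.lex_def, rank]
  simp only [conf] at h3 ⊢
  right
  refine ⟨trivial, ?_⟩
  -- The first round shortens no list; the two units that the rank adds for `q = p` pay for its two
  -- signals.
  split at h3 <;> simp_all <;> omega

theorem good_elimStatusP {m p a q : ℕ} (hpc : s.pc i = .elimStatusP m p a q) :
    Good i s s' lin del la lb := by
  have hrole : (s.conf lin del la lb).role i = .elimP m p a q := by simp [conf, hpc, roleOf]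
  simp only [Step, hpc] at h
  obtain ⟨l, h1, h2, h3⟩ := hI.finishP hrole
  refine Good.edit ⟨h1, h2⟩ h rfl rfl (fun _ => modOp_id _ (by intro; rfl))
    (fun _ => modOp_op _ (by intro; rfl)) (fun _ => update_status _)
    (fun _ => modOp_next _ (by intro; rfl)) (fun _ => modOp_last _ (by intro; rfl)) rfl rfl
    (fun x => by simp [Linearizes, hpc]) (fun _ _ => by simp [delegateStep, hpc]) (.of_rank ?_)
  rw [hpc]
  simp only [goto_pc, Function.update_self, Prod.lex_def, rank]
  simp only [conf] at h3 ⊢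
  right
  refine ⟨trivial, ?_⟩
  split at h3 <;> simp_all <;> omega

theorem good_elimNextA {m p a q : ℕ} (hpc : s.pc i = .elimNextA m p a q) :
    Good i s s' lin del la lb := by
  have hrole : (s.conf lin del la lb).role i = .elimNext m p a q := by simp [conf, hpc, roleOf]
  simp only [Step, hpc] at h
  have hr := hI.rinv i
  rw [hrole] at hr
  obtain ⟨h1, h2, h3, h4, h5, h6⟩ := hr
  refine Good.move (hI.relabelActive (.elimTest m p (s.ops a).next q) (by rw [hrole]; rfl)
    (by rw [hrole]; trivial) rfl (by simp) ⟨h1, h3, h4, h5, h6⟩ fun _ => .inl trivial) h rfl rfl rfl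
    rfl (fun _ _ => rfl) (fun x => by simp [Linearizes, hpc, conf])
    (fun _ _ => by simp [delegateStep, hpc]) (.of_rank ?_)
  rw [hpc]; simp [Prod.lex_def, rank]

/-- By `Pairs`, whatever is left when one of the lists ends has not been linearized. Therefore the
residue is a legitimate list for a new attempt, with the old delegate `m` or `p` until RETRY is
signalled. -/
theorem good_elimNextP {m p q : ℕ} {a : Option ℕ} (hpc : s.pc i = .elimNextP m p a q) :
    Good i s s' lin del la lb := by
  have hrole : (s.conf lin del la lb).role i = .elimTest m p a q := by simp [conf, hpc, roleOf]
  simp only [Step, hpc] at h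
  have hr := hI.rinv i
  rw [hrole] at hr
  obtain ⟨h1, h3, h4, h5, h6⟩ := hr
  have hm : ((s.conf lin del la lb).role i).op? = some m := by rw [hrole]; rfl
  have ha : ((s.conf lin del la lb).role i).Active := by rw [hrole]; trivial
  have h5 : IsList (s.conf lin del la lb).next (s.ops q).next ((s.conf lin del la lb).lb i) := h5
  have nil : ∀ {l : List ℕ}, IsList (s.conf lin del la lb).next none l → l = [] := by
    intro l hl
    cases l with
    | nil => rfl
    | cons x l => cases hl.1
  split at h
  · rename_i a' q' hq
    rw [hq] at h5
    -- The held `q'` differs from the released `p`, so that the surcharge for the first round does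
    -- not reappear.
    have hqp : q' ≠ p := by
      rintro rfl
      exact hI.not_gone_of_held (j := i) (List.mem_append_right _ h5.head_mem) h1.gone
    refine Good.move (hI.relabelActive (.elimA m p a' q') hm ha rfl (by simp)
      ⟨h1, h6, .inr ⟨h4, h5⟩⟩ fun _ => .inl trivial) h rfl rfl rfl
      rfl (fun _ _ => rfl) (fun x => by simp [Linearizes, hpc, conf])
      (fun _ _ => by simp [delegateStep, hpc]) (.of_rank ?_)
    rw [hpc]; simp [Prod.lex_def, rank, hqp]
  · rename_i a' hq
    rw [hq] at h5
    have hlb := nil h5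
    have hres : (s.conf lin del la lb).Residue m m a'
        ((s.conf lin del la lb).la i ++ (s.conf lin del la lb).lb i) := by
      rw [hlb] at h6 ⊢
      rw [List.append_nil]
      refine ⟨.inl rfl, h4, ?_, h1.delA, fun x hx => ?_, h1.endsA⟩
      · cases e : (s.conf lin del la lb).la i with
        | nil => simp
        | cons => rw [e] at h6; simpa [Pairs] using h6
      · rw [h1.kindA x hx, h1.kindA a' h4.head_mem]
    refine Good.move (hI.relabelActive (.residue m m a') hm ha rfl (by simp)
      hres fun _ => .inl trivial) h rfl rfl rfl
      rfl (fun _ _ => rfl) (fun x => by simp [Linearizes, hpc, conf])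
      (fun _ _ => by simp [delegateStep, hpc]) (.of_rank ?_)
    rw [hpc]; simp [Prod.lex_def, rank]
  · rename_i q' hq
    rw [hq] at h5
    have hla := nil h4
    have hres : (s.conf lin del la lb).Residue m p q'
        ((s.conf lin del la lb).la i ++ (s.conf lin del la lb).lb i) := by
      rw [hla] at h6 ⊢
      rw [List.nil_append]
      refine ⟨.inr h1.gone, h5, ?_, h1.delB, fun x hx => ?_, h1.endsB⟩
      · cases e : (s.conf lin del la lb).lb i with
        | nil => simp
        | cons => rw [e] at h6; simpa [Pairs] using h6
      · rw [h1.kindB x hx, h1.kindB q' h5.head_mem]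
    refine Good.move (hI.relabelActive (.residue m p q') hm ha rfl (by simp)
      hres fun _ => .inl trivial) h rfl rfl rfl
      rfl (fun _ _ => rfl) (fun x => by simp [Linearizes, hpc, conf])
      (fun _ _ => by simp [delegateStep, hpc]) (.of_rank ?_)
    rw [hpc]; simp [Prod.lex_def, rank]
  · rename_i hq
    rw [hq] at h5
    refine Good.move (hI.relabelActive (.gone m) hm ha rfl (by simp)
      ⟨nil h4, nil h5⟩ fun _ => .inr ⟨nil h4, nil h5⟩) h rfl rfl rfl
      rfl (fun _ _ => rfl) (fun x => by simp [Linearizes, hpc, conf])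
      (fun _ _ => by simp [delegateStep, hpc]) (.of_rank ?_)
    rw [hpc]; simp [Prod.lex_def, rank]

theorem good_residueLast {m src k : ℕ} (hpc : s.pc i = .residueLast m src k) :
    Good i s s' lin del la lb := by
  have hrole : (s.conf lin del la lb).role i = .residue m src k := by simp [conf, hpc, roleOf]
  simp only [Step, hpc] at h
  refine Good.edit (hI.residueLast hrole) h rfl rfl (fun _ => modOp_id _ (by intro; rfl))
    (fun _ => modOp_op _ (by intro; rfl)) (fun _ => modOp_status _ (by intro; rfl))
    (fun _ => modOp_next _ (by intro; rfl)) (fun _ => update_last _) rfl rfl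
    (fun x => by simp [Linearizes, hpc]) (fun _ _ => by simp [delegateStep, hpc]) (.of_rank ?_)
  rw [hpc]; simp [Prod.lex_def, rank, conf]

theorem good_combineNext {m p : ℕ} (hpc : s.pc i = .combineNext m p) :
    Good i s s' lin del la lb := by
  have hrole : (s.conf lin del la lb).role i = .merge m p := by simp [conf, hpc, roleOf]
  simp only [Step, hpc] at h
  refine Good.edit (hI.link hrole) h rfl rfl (fun _ => modOp_id _ (by intro; rfl))
    (fun _ => modOp_op _ (by intro; rfl)) (fun _ => modOp_status _ (by intro; rfl))
    (fun _ => update_next _) (fun _ => modOp_last _ (by intro; rfl)) rfl rfl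
    (fun x => by simp [Linearizes, hpc]) (fun _ _ => by simp [delegateStep, hpc]) (.of_rank ?_)
  rw [hpc]; simp [Prod.lex_def, rank]

theorem good_combineLast {m p : ℕ} (hpc : s.pc i = .combineLast m p) :
    Good i s s' lin del la lb := by
  have hrole : (s.conf lin del la lb).role i = .merged m p := by simp [conf, hpc, roleOf]
  simp only [Step, hpc] at h
  refine Good.edit (hI.relast hrole) h rfl rfl (fun _ => modOp_id _ (by intro; rfl))
    (fun _ => modOp_op _ (by intro; rfl)) (fun _ => modOp_status _ (by intro; rfl))
    (fun _ => modOp_next _ (by intro; rfl)) (fun _ => update_last _) rfl rfl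
    (fun x => by simp [Linearizes, hpc]) (fun _ _ => by simp [delegateStep, hpc]) (.of_rank ?_)
  rw [hpc]; simp [Prod.lex_def, rank]

theorem good_setInit {m : ℕ} (hpc : s.pc i = .setInit m) : Good i s s' lin del la lb := by
  have hrole : (s.conf lin del la lb).role i = .ready m := by simp [conf, hpc, roleOf]
  simp only [Step, hpc, startLoop_eq] at h
  refine Good.edit (hI.reset hrole) h rfl rfl (fun _ => modOp_id _ (by intro; rfl))
    (fun _ => modOp_op _ (by intro; rfl)) (fun _ => update_status _)
    (fun _ => modOp_next _ (by intro; rfl)) (fun _ => modOp_last _ (by intro; rfl)) rfl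
    (roleOf_loopPC _ _ _ _)
    (fun x => by simp [Linearizes, hpc]) (fun _ _ => by simp [delegateStep, hpc])
    (.of_loop (Function.update_self ..))

theorem good_residueRetry {m src k : ℕ} (hpc : s.pc i = .residueRetry m src k) :
    Good i s s' lin del la lb := by
  have hrole : (s.conf lin del la lb).role i = .residueRetry m src k := by
    simp [conf, hpc, roleOf]
  simp only [Step, hpc] at h
  have hr := hI.rinv i
  rw [hrole] at hr
  have hlist : ∀ r, s.InList k r ↔ r ∈ la i ++ lb i := by
    intro r
    have hl := hr.1.link
    cases e : la i ++ lb i with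
    | nil =>
      have e : (s.conf lin del la lb).la i ++ (s.conf lin del la lb).lb i = [] := e
      rw [e] at hl; cases hl
    | cons x l =>
      have e' : (s.conf lin del la lb).la i ++ (s.conf lin del la lb).lb i = x :: l := e
      rw [e'] at hl
      cases hl.1
      exact inList_iff hl.2
  have hself : (s.ops k).id ≠ i := by
    intro e
    obtain ⟨h1, h2, h3⟩ := hI.held i k hr.1.link.head_mem
    have h3 : (s.conf lin del la lb).role (s.ops k).id = .capt k := h3
    rw [e, hrole] at h3; cases h3
  refine Good.local _ _ (hI.signalRetry hrole (del' := s.delegateStep s' i del) fun d r => ?_)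
    rfl ?_ ?_ ?_ rfl ?_ ?_ ?_ ?_ ?_ ?_ ?_ ?_ ?_
  · simp only [delegateStep, hpc, hlist]; rfl
  · subst h; rfl
  · subst h; intro x; simp only [goto_ops]; exact modOp_id _ (by intro; rfl)
  · subst h; intro x; simp only [goto_ops]; exact modOp_op _ (by intro; rfl)
  · subst h; exact fun _ => update_status _
  · subst h; intro x; simp only [goto_ops]; exact modOp_next _ (by intro; rfl)
  · subst h; intro x; simp only [goto_ops]; exact modOp_last _ (by intro; rfl)
  · subst h; simp [roleOf]
  · subst h; exact fun _ _ => rfl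
  · subst h; exact fun j hj => by simp [hj]
  · simp [Linearizes, hpc, conf]
  · exact fun _ _ => Iff.rfl
  · subst h
    refine .of_rank ?_
    rw [hpc]; simp [Prod.lex_def, rank]

theorem good_ret {m : ℕ} (hpc : s.pc i = .ret m) : Good i s s' lin del la lb := by
  have hrole : (s.conf lin del la lb).role i = .gone m := by simp [conf, hpc, roleOf]
  have hr := hI.rinv i
  rw [hrole] at hr
  simp only [Step, hpc] at h
  refine Good.move (hI.relabel (r := .idle) (by simp [Role.op?]) (by simp [hrole]) (by simp)
    (by simp [Role.op?]) hr (by simp [hrole, Role.Working])) h rfl rfl rfl rfl (fun _ _ => rfl)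
    (fun x => by simp [Linearizes, hpc, conf]) (fun _ _ => by simp [delegateStep, hpc])
    (.inr (.inl (by simp)))

theorem good_spin {m : ℕ} (hpc : s.pc i = .spin m) : Good i s s' lin del la lb := by
  have hrole : (s.conf lin del la lb).role i = .capt m := by simp [conf, hpc, roleOf]
  have hr := hI.rinv i
  rw [hrole] at hr
  obtain ⟨h1, h2, h3⟩ := hr
  simp only [Step, hpc] at h
  split at h
  · rename_i hs
    refine Good.move (hI.relabel (r := .check m) (by simp [hrole]; simp [Role.op?]) ?_ (by simp)
      ?_ ⟨hs, h1, h2, h3⟩ (by simp [hrole, Role.Working])) h rfl rfl rfl rfl (fun _ _ => rfl)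
      (fun x => by simp [Linearizes, hpc, conf]) (fun _ _ => by simp [delegateStep, hpc])
      (.of_rank ?_)
    · intro x e
      rw [hrole] at e; cases e; exact hs
    · rintro x g hx hx'
      cases hx'
      refine .inr ⟨rfl, ?_⟩
      have := g.2
      rw [(hI.own i m (by rw [hrole]; rfl)).2, hrole] at this
      rcases this rfl with h | ⟨-, h⟩
      · cases h
      · exact h
    · rw [hpc]; simp [Prod.lex_def, rank]
  · rename_i hs
    subst h
    exact Good.skip hI rfl (fun _ => rfl) (fun _ => rfl) (fun _ => rfl) (fun _ => rfl)
      (fun _ => rfl)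
      rfl (fun _ _ => rfl) (fun _ _ => rfl) (fun x => by simp [Linearizes, hpc])
      (fun _ _ => by simp [delegateStep, hpc])
      (.inr (.inr (.inr (.inl ⟨m, hpc, by simpa using hs⟩))))

theorem good_checkStatus {m : ℕ} (hpc : s.pc i = .checkStatus m) : Good i s s' lin del la lb := by
  have hrole : (s.conf lin del la lb).role i = .check m := by simp [conf, hpc, roleOf]
  have hr := hI.rinv i
  rw [hrole] at hr
  obtain ⟨h0, h1, h2, h3⟩ := hr
  simp only [Step, hpc] at h
  split at h
  · rename_i hs
    refine Good.move (hI.relabel (r := .gone m) (by simp [hrole]; simp [Role.op?]) (by simp [hrole])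
      (by simp) ?_ ⟨h3 (by simp [conf, hs]), h1⟩ (by simp [hrole, Role.Working])) h rfl rfl rfl rfl
      (fun _ _ => rfl)
      (fun x => by simp [Linearizes, hpc, conf]) (fun _ _ => by simp [delegateStep, hpc])
      (.of_rank ?_)
    · rintro x g hx hx'
      cases hx'
      exact .inl rfl
    · rw [hpc]; simp [Prod.lex_def, rank]
  · rename_i hs
    have hs' : (s.conf lin del la lb).status m = .retry := by
      have : (s.ops m).cStatus ≠ .finished := hs
      have h0 : (s.ops m).cStatus ≠ .init := h0
      show (s.ops m).cStatus = .retry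
      cases e : (s.ops m).cStatus <;> simp_all
    refine Good.move (hI.relabel (r := .ready m) (by simp [hrole]; simp [Role.op?])
      (by simp [hrole])
      (by simp) ?_ ⟨h1, hs', h2 hs'⟩ (by simp [hrole, Role.Working])) h rfl rfl rfl rfl
      (fun _ _ => rfl)
      (fun x => by simp [Linearizes, hpc, conf]) (fun _ _ => by simp [delegateStep, hpc])
      (.of_rank ?_)
    · rintro x g hx hx'
      cases hx'
      have := g.2
      rw [(hI.own i m (by rw [hrole]; rfl)).2, hrole] at this
      rcases this rfl with h | ⟨-, h⟩
      · cases h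
      · exact (hs h).elim
    · rw [hpc]; simp [Prod.lex_def, rank]

include hb in
theorem good_idle (hpc : s.pc i = .idle) : Good i s s' lin del la lb := by
  have hrole : (s.conf lin del la lb).role i = .idle := by simp [conf, hpc, roleOf]
  have hnl : ∀ x, ¬ s.Linearizes i x := fun x => by simp [Linearizes, hpc]
  simp only [Step, hpc] at h
  have key : ∀ (t : State N D), t.numOps = s.numOps + 1 →
      ((t.ops s.numOps).id = i ∧ (t.ops s.numOps).cStatus = .init ∧
        (t.ops s.numOps).next = none ∧ (t.ops s.numOps).last = s.numOps) →
      (∀ x, x ≠ s.numOps → t.ops x = s.ops x) →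
      t.location = s.location → (∀ j ≠ i, t.pc j = s.pc j) →
      (∀ op loc, roleOf op loc (t.pc i) = .free s.numOps) →
      Good i s t lin del la lb := by
    intro t h1 h2 h3 h4 h5 h6
    have hlin' : (fun x => lin x ∨ s.Linearizes i x) = lin := by
      funext x; simp [hnl]
    have hdel' : ∀ d r, s.delegateStep t i del d r ↔ del d r ∨ (d = s.numOps ∧ r = s.numOps) := by
      simp [delegateStep, hpc, h1]
    have hinv := hI.invoke (c' := t.conf (fun x => lin x ∨ s.Linearizes i x)
      (s.delegateStep t i del) la lb) hrole h1 h2 (fun x hx => ?_) (funext fun j => ?_) hlin' hdel'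
      rfl rfl
    · exact ⟨la, lb, hinv.1, hinv.2, .inl hpc⟩
    · have := h3 x hx
      exact ⟨by simp [conf, this], by simp [conf, this], by simp [conf, this], by simp [conf, this],
        by simp [conf, this]⟩
    · by_cases e : j = i
      · subst e
        simpa [conf] using h6 _ _
      · simp only [conf, e, h4, h5 j e, ne_eq, not_false_eq_true, Function.update_of_ne]
        -- The roles of the other threads depend only on the kinds of records that existed before
        -- the invocation.
        refine roleOf_congr (fun m hm => ?_) (fun a ha => ?_) fun m a hm => ?_
        · rw [h3 m (hb.own j m hm).1.ne]
        · rw [h3 a (hb.loclt j a ha).ne]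
        · have hp := hb.pinv j
          rw [hm] at hp
          rw [h3 a (hb.loclt j a hp.1).ne]
  rcases h with rfl | ⟨d, rfl⟩ | rfl
  · exact Good.skip hI rfl (fun _ => rfl) (fun _ => rfl) (fun _ => rfl) (fun _ => rfl)
      (fun _ => rfl)
      rfl (fun _ _ => rfl) (fun _ _ => rfl) hnl
      (fun _ _ => by simp [delegateStep, hpc]) (.inl hpc)
  · refine key _ rfl (by simp [invokePush]) (by simp +contextual [invokePush]) rfl
      (by simp +contextual [invokePush]) (by simp [invokePush, roleOf])
  · refine key _ rfl (by simp [invokePop]) (by simp +contextual [invokePop]) rfl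
      (by simp +contextual [invokePop]) (by simp [invokePop, roleOf])

end Cases

end State
end DECS

/-! ### Collisions, and dereferences that must not be null -/

namespace DECS

theorem EndsAt.mem {m y : ℕ} {l : List ℕ} (h : EndsAt (m :: l) y) : y ∈ m :: l := by
  have := h _ (List.getLast?_eq_some_getLast (l := m :: l) (by simp))
  rw [← this]
  exact List.getLast_mem _

namespace State

variable {N : ℕ} {D : Type*} {s s' : State N D} {i : Fin N} {lin : ℕ → Prop} {del : ℕ → ℕ → Prop}
  {la lb : Fin N → List ℕ}

/-- The role of a thread whose operation is announced in `location`. -/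
theorem Base.announced (hb : Base s) {p : ℕ} (hl : s.location (s.ops p).id = some p)
    (op : ℕ → Kind) (loc : Option ℕ) : roleOf op loc (s.pc (s.ops p).id) =
      if loc = some p then .free p
      else if loc.map op = some (op p) then .capt p else .gone p := by
  have hp := hb.pinv (s.ops p).id
  cases hpc : s.pc (s.ops p).id
  case getIndex m | getHim m _ | casCollision m _ _ | getInfo m _ | delay m |
      casLocationDelayed m =>
    rw [hpc] at hp
    obtain ⟨a, h1, h2⟩ := hp
    obtain rfl := Option.some_injective _ (hl.symm.trans h1)
    obtain rfl : p = m := by simpa using h2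
    rfl
  case casLocation m o =>
    rw [hpc] at hp
    obtain ⟨⟨a, h1, h2⟩, -⟩ := hp
    obtain rfl := Option.some_injective _ (hl.symm.trans h1)
    obtain rfl : p = m := by simpa using h2
    rfl
  case passiveReset m a =>
    rw [hpc] at hp
    obtain ⟨h1, h2⟩ := hp
    obtain rfl := Option.some_injective _ (hl.symm.trans h1)
    exact (h2 rfl).elim
  all_goals
    rw [hpc] at hp
    simp [PInv, hl] at hp

variable (hb : Base s) (hI : (s.conf lin del la lb).Inv) (h : Step i s s')

include hb hI h

/-- The CAS changes two roles although only one thread moves: as soon as the entry of the thread of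
`p` contains `m`, `roleOf` yields `capt p` or `gone p` for it instead of `free p`. -/
theorem good_activeCas {m p : ℕ} (hpc : s.pc i = .activeCas m p) : Good i s s' lin del la lb := by
  have hrole : (s.conf lin del la lb).role i = .free m := by simp [conf, hpc, roleOf]
  have hp := hb.pinv i
  rw [hpc] at hp
  obtain ⟨hp0, hp1, hp2⟩ := hp
  simp only [Step, hpc, startLoop_eq] at h
  by_cases hl : s.location (s.ops p).id = some p
  · rw [if_pos hl] at h
    have hk : (s.conf lin del la lb).role (s.ops p).id = .free p := by
      have := hb.announced hl (fun x => (s.ops x).op) (some p)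
      rw [if_pos rfl] at this
      rw [← this, ← hl]; rfl
    have hmp : m ≠ p := by
      rintro rfl
      exact hp2 (hb.own i m (by rw [hpc]; rfl)).2
    have hrole' : ∀ (r₁ r₂ : Role) (c : PC N),
        s' = (s.setLocation (s.ops p).id (some m)).goto i c →
        (roleOf (fun x => (s.ops x).op) none c = r₁) →
        ((if (s.ops m).op = (s.ops p).op then Role.capt p else .gone p) = r₂) →
        ∀ j, roleOf (fun x => (s'.ops x).op) (s'.location j) (s'.pc j) =
          Function.update (Function.update (s.conf lin del la lb).role i r₁) (s.ops p).id r₂ j := by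
      rintro r₁ r₂ c rfl h1 h2 j
      by_cases e : j = (s.ops p).id
      · subst e
        simp only [goto_ops, setLocation_ops, goto_location, setLocation_location,
          Function.update_self, goto_pc, setLocation_pc, ne_eq, hp2, not_false_eq_true,
          Function.update_of_ne]
        rw [hb.announced hl]
        simpa [hmp] using h2
      · by_cases e' : j = i
        · subst e'
          simpa [e, hp0] using h1
        · simp [e, e', conf]
    have hri := hI.rinv i
    have hrk := hI.rinv (s.ops p).id
    rw [hrole] at hri
    rw [hk] at hrk
    by_cases hop : (s.ops m).op = (s.ops p).op
    · rw [if_pos hop] at h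
      refine Good.mk _ (hI.captureSame hrole hk hp2 hop (del' := s.delegateStep s' i del)
        fun d r => by simp only [delegateStep, hpc]; rw [if_pos ⟨hl, hop⟩]; rfl)
        ?_ ?_ ?_ ?_ ?_ ?_ ?_ ?_ (fun _ _ => Iff.rfl) ?_
      · subst h; rfl
      · subst h; exact fun _ => rfl
      · subst h; exact fun _ => rfl
      · subst h; exact fun _ => rfl
      · subst h; exact fun _ => rfl
      · subst h; exact fun _ => rfl
      · exact hrole' _ _ _ h (by split <;> rfl) (if_pos hop)
      · simp [Linearizes, hpc, hop, conf]
      · subst h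
        refine .of_rank ?_
        rw [hpc]
        simp only [goto_pc, Function.update_self]
        split <;> simp [Prod.lex_def, rank]
    · rw [if_neg hop] at h
      refine Good.mk _ (hI.captureDiff hrole hk hp2 hop (lin' := fun x => lin x ∨ s.Linearizes i x)
        fun x => or_congr Iff.rfl ?_) ?_ ?_ ?_ ?_ ?_ ?_ ?_ (fun _ => Iff.rfl) ?_ ?_
      · simp only [Linearizes, hpc]
        simp only [hl, ne_eq, hop, not_false_eq_true, true_and]
        refine exists_congr fun n => exists_congr fun a => exists_congr fun b => ?_
        rw [nth_eq hri.2.2.link, nth_eq hrk.2.2.link]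
      · subst h; rfl
      · subst h; exact fun _ => rfl
      · subst h; exact fun _ => rfl
      · subst h; exact fun _ => rfl
      · subst h; exact fun _ => rfl
      · subst h; exact fun _ => rfl
      · exact hrole' _ _ _ h rfl (if_neg hop)
      · simp [delegateStep, hpc, hop, conf]
      · subst h
        refine .of_rank ?_
        rw [hpc]
        simp [Prod.lex_def, rank]
  · rw [if_neg hl] at h
    exact Good.skipPC hI h (by rw [hpc, roleOf_loopPC]; rfl) (by simp [Linearizes, hpc, hl])
      (by simp [delegateStep, hpc, hl]) (.of_loop (Function.update_self ..))

/-- The entry was overwritten by a foreign operation, so the role is not `free`. From here on the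
role is read off the local copy `a`, since the next line erases the entry. -/
theorem good_passiveGet {m : ℕ} (hpc : s.pc i = .passiveGet m) : Good i s s' lin del la lb := by
  have hp := hb.pinv i
  have hm := (hb.own i m (by rw [hpc]; rfl)).2
  rw [hpc] at hp
  obtain ⟨a, h1, h2⟩ := hp
  simp only [Step, hpc, hm, h1] at h
  have ham : a ≠ m := by
    rintro rfl; exact h2 hm
  refine Good.skipPC hI h (by rw [hpc]; simp [roleOf, h1, ham, eq_comm (a := (s.ops m).op)])
    (by simp [Linearizes, hpc])
    (by simp [delegateStep, hpc]) (.of_rank ?_)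
  rw [hpc]; simp [Prod.lex_def, rank]

theorem good_passiveReset {m a : ℕ} (hpc : s.pc i = .passiveReset m a) :
    Good i s s' lin del la lb := by
  have hm := (hb.own i m (by rw [hpc]; rfl)).2
  simp only [Step, hpc, hm] at h
  refine Good.skipTo hI h rfl rfl (fun _ => rfl) (fun _ => rfl) (fun _ => rfl) (fun _ => rfl)
    (fun _ => rfl) ?_ (fun j hj => Function.update_of_ne hj _ _) (by simp [Linearizes, hpc])
    (by simp [delegateStep, hpc]) (.of_rank ?_)
  · rw [hpc]
    by_cases e : (s.ops m).op = (s.ops a).op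
    · simp [roleOf, e]
    · rw [if_pos e]
      by_cases e' : (s.ops m).op = .pop
      · rw [if_pos e']; exact (if_neg e).symm
      · rw [if_neg e']; exact (if_neg e).symm
  · rw [hpc]
    simp only [goto_pc, Function.update_self]
    repeat' split
    all_goals simp [Prod.lex_def, rank]

omit hb in
theorem good_casCollision {m : ℕ} {index : Fin N} {him : Option (Fin N)}
    (hpc : s.pc i = .casCollision m index him) : Good i s s' lin del la lb := by
  simp only [Step, hpc] at h
  by_cases hc : s.collision index = him
  · rw [if_pos hc] at h
    refine Good.skipTo hI h rfl rfl (fun _ => rfl) (fun _ => rfl) (fun _ => rfl) (fun _ => rfl)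
      (fun _ => rfl) ?_ (fun j hj => rfl) (by simp [Linearizes, hpc])
      (by simp [delegateStep, hpc]) (.of_rank ?_)
    · rw [hpc]
      split <;> rfl
    · rw [hpc]
      simp only [goto_pc, Function.update_self]
      split <;> simp [Prod.lex_def, rank]
  · rw [if_neg hc] at h
    exact Good.skipPC hI h (by rw [hpc]; rfl) (by simp [Linearizes, hpc])
      (by simp [delegateStep, hpc]) (.inr (.inr (.inr (.inr (.inl ⟨m, index, him, hpc, hc⟩)))))

omit hb in
theorem good_popGiveCell {m : ℕ} {top : Option ℕ} (hpc : s.pc i = .popGiveCell m top) :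
    Good i s s' lin del la lb := by
  have hrole : (s.conf lin del la lb).role i = .hand m := by simp [conf, hpc, roleOf]
  obtain ⟨w, hw⟩ := next_of_hand hI hrole
  simp only [Step, hpc, hw] at h
  have key : ∀ (f : MultiOp N → MultiOp N) (c : PC N), s' = (s.modOp w f).goto i c →
      (∀ o, (f o).id = o.id) → (∀ o, (f o).op = o.op) → (∀ o, (f o).cStatus = o.cStatus) →
      (∀ o, (f o).next = o.next) → (∀ o, (f o).last = o.last) →
      (c = .popStatus m none ∨ ∃ t, c = .popGiveTop m t) → Good i s s' lin del la lb := by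
    intro f c h h1 h2 h3 h4 h5 h6
    refine Good.skipTo hI h rfl rfl (fun _ => modOp_id _ h1) (fun _ => modOp_op _ h2)
      (fun _ => modOp_status _ h3) (fun _ => modOp_next _ h4) (fun _ => modOp_last _ h5) ?_
      (fun _ _ => rfl) (by simp [Linearizes, hpc]) (by simp [delegateStep, hpc]) (.of_rank ?_)
    · rw [hpc]; obtain rfl | ⟨t, rfl⟩ := h6 <;> rfl
    · rw [hpc]
      obtain rfl | ⟨t, rfl⟩ := h6 <;> simp [Prod.lex_def, rank]
  cases top with
  | none =>
    exact key _ _ h (fun _ => rfl) (fun _ => rfl) (fun _ => rfl)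
      (fun _ => rfl) (fun _ => rfl) (.inl rfl)
  | some t =>
    exact key _ _ h (fun _ => rfl) (fun _ => rfl) (fun _ => rfl)
      (fun _ => rfl) (fun _ => rfl) (.inr ⟨t, rfl⟩)

/-- The thread must not get stuck on a null cell. The record `last m` belongs to the list of `m`,
all of whose operations are pushes like `m`, and pushes have cells. -/
theorem good_pushSetLast (hc : PushCells s) {m : ℕ} {top : Option ℕ}
    (hpc : s.pc i = .pushSetLast m top) : Good i s s' lin del la lb := by
  have hrole : (s.conf lin del la lb).role i = .free m := by simp [conf, hpc, roleOf]
  have hr := hI.rinv i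
  have hp := hb.pinv i
  have hm := hb.own i m (by rw [hpc]; rfl)
  rw [hrole] at hr
  rw [hpc] at hp
  obtain ⟨-, -, hr⟩ := hr
  have hcell : (s.ops (s.ops m).last).cell ≠ none := by
    rcases List.mem_cons.1 hr.ends.mem with e | e
    · have e : (s.ops m).last = m := e
      rw [e]; exact hc _ hm.1 hp.2
    · exact hc _ (hI.idlt (List.mem_append_left _ e)) ((hr.kind _ e).trans hp.2)
  obtain ⟨c, hcell⟩ := Option.ne_none_iff_exists'.1 hcell
  simp only [Step, hpc, hcell] at h
  refine Good.skipTo hI h rfl rfl (fun _ => rfl) (fun _ => rfl) (fun _ => rfl) (fun _ => rfl)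
    (fun _ => rfl) (by rw [hpc]; rfl) (fun j hj => rfl) (by simp [Linearizes, hpc])
    (by simp [delegateStep, hpc]) (.of_rank ?_)
  rw [hpc]; simp [Prod.lex_def, rank]

theorem good_combineCells (hc : PushCells s) {m p : ℕ}
    (hpc : s.pc i = .combineCells m p) : Good i s s' lin del la lb := by
  have hrole : (s.conf lin del la lb).role i = .merge m p := by simp [conf, hpc, roleOf]
  have hr := hI.rinv i
  have hp := hb.pinv i
  have hm := hb.own i m (by rw [hpc]; rfl)
  rw [hrole] at hr
  rw [hpc] at hp
  obtain ⟨-, -, -, hk, l₁, l₂, hl, -, -, hr, -⟩ := hr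
  have hcell : (s.ops (s.ops m).last).cell ≠ none := by
    rcases List.mem_cons.1 hr.mem with e | e
    · have e : (s.ops m).last = m := e
      rw [e]; exact hc _ hm.1 hp.2
    · have e : (s.conf lin del la lb).last m ∈ (s.conf lin del la lb).la i := by simp [hl, e]
      exact hc _ (hI.idlt (List.mem_append_left _ e)) ((hk _ e).trans hp.2)
  obtain ⟨c, hcell⟩ := Option.ne_none_iff_exists'.1 hcell
  simp only [Step, hpc, hcell] at h
  refine Good.skipTo hI h rfl rfl (fun _ => rfl) (fun _ => rfl) (fun _ => rfl) (fun _ => rfl)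
    (fun _ => rfl) (by rw [hpc]; rfl) (fun j hj => rfl) (by simp [Linearizes, hpc])
    (by simp [delegateStep, hpc]) (.of_rank ?_)
  rw [hpc]; simp [Prod.lex_def, rank]

omit hb hI h in
theorem Step.good (h : Step i s s') (hb : Base s) (hc : PushCells s)
    (hI : (s.conf lin del la lb).Inv) : Good i s s' lin del la lb := by
  have own := fun m h => (hb.own i m h).2
  have hst := h
  unfold Step at h
  cases hpc : s.pc i <;> rw [hpc] at h own
  case idle => exact good_idle hb hI hst hpc
  case popTop => exact good_popTop hI hst hpc
  case popEmptyStatus => exact good_popEmptyStatus hI hst hpc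
  case popEmptyNext => exact good_popEmptyNext hI hst hpc
  case popCas => exact good_popCas hI hst hpc
  case popWhile => exact good_popWhile hI hst hpc
  case popGiveCell => exact good_popGiveCell hI hst hpc
  case popStatus => exact good_popStatus hI hst hpc
  case popUnlink => exact good_popUnlink hI hst hpc
  case pushSetLast => exact good_pushSetLast hb hI hst hc hpc
  case pushCas => exact good_pushCas hI hst hpc
  case pushWhile => exact good_pushWhile hI hst hpc
  case pushStatus => exact good_pushStatus hI hst hpc
  case pushUnlink => exact good_pushUnlink hI hst hpc
  case casCollision => exact good_casCollision hI hst hpc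
  case activeCas => exact good_activeCas hb hI hst hpc
  case combineCells => exact good_combineCells hb hI hst hc hpc
  case combineNext => exact good_combineNext hI hst hpc
  case combineLast => exact good_combineLast hI hst hpc
  case elimStatusA => exact good_elimStatusA hI hst hpc
  case elimStatusP => exact good_elimStatusP hI hst hpc
  case elimNextA => exact good_elimNextA hI hst hpc
  case elimNextP => exact good_elimNextP hI hst hpc
  case residueLast => exact good_residueLast hI hst hpc
  case residueRetry => exact good_residueRetry hI hst hpc
  case passiveGet => exact good_passiveGet hb hI hst hpc
  case passiveReset => exact good_passiveReset hb hI hst hpc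
  case spin => exact good_spin hI hst hpc
  case checkStatus => exact good_checkStatus hI hst hpc
  case setInit => exact good_setInit hI hst hpc
  case ret => exact good_ret hI hst hpc
  -- The remaining lines write only to data outside the configuration or to the own entry of
  -- `location`, and leave the role as it is.
  all_goals
    simp only [PC.op?, Option.some.injEq, forall_eq'] at own
    obtain ⟨_, rfl⟩ := h
    repeat' split
    all_goals try rw [startLoop_eq]
    all_goals
      refine Good.skipTo hI rfl ?_ ?_ ?_ ?_ ?_ ?_ ?_ ?_ ?_ ?_ ?_ ?_
      · rfl
      · rfl
      · first | exact fun _ => rfl | exact fun _ => modOp_id _ (by intro; rfl)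
      · first | exact fun _ => rfl | exact fun _ => modOp_op _ (by intro; rfl)
      · first | exact fun _ => rfl | exact fun _ => modOp_status _ (by intro; rfl)
      · first | exact fun _ => rfl | exact fun _ => modOp_next _ (by intro; rfl)
      · first | exact fun _ => rfl | exact fun _ => modOp_last _ (by intro; rfl)
      · first
          | (rw [hpc]; rfl)
          | (rw [hpc]; simp [roleOf, *]; done)
          | (rw [hpc, roleOf_loopPC]; rfl)
          | (rw [hpc, roleOf_loopPC]; simp [roleOf, *])
      · first
          | exact fun _ _ => rfl
          | exact fun j hj => Function.update_of_ne hj _ _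
      · simp [Linearizes, hpc]
      · simp [delegateStep, hpc]
      · first
          | exact .of_loop (Function.update_self ..)
          | (refine .of_rank ?_; rw [hpc]; simp only [goto_pc, Function.update_self]
             simp [Prod.lex_def, rank]; done)
          | (refine .of_rank ?_; rw [hpc]; simp only [goto_pc, Function.update_self]
             simp [Prod.lex_def, rank]; omega)

end State
end DECS

/-! ### Preservation of cells, and what a single step can change -/

namespace DECS
namespace State

variable {N : ℕ} {D : Type*} {s s' : State N D} {i : Fin N} {lin : ℕ → Prop} {del : ℕ → ℕ → Prop}
  {la lb : Fin N → List ℕ}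

/-- A null pointer might be copied only in an elimination, where the target is a pop: the walk
visits operations of the kind of `m` on one side and of the opposite kind of `p` on the other. The
other assignments to existing records write the address of a cell. -/
theorem Step.cell (h : Step i s s') (hb : Base s) (hI : (s.conf lin del la lb).Inv) {x : ℕ}
    (hx : x < s.numOps) : (s'.ops x).cell = (s.ops x).cell ∨ (s'.ops x).cell ≠ none ∨
      (s.ops x).op = .pop := by
  have hp := hb.pinv i
  have key : ∀ (r : ℕ) (f : MultiOp N → MultiOp N),
      (f (s.ops r)).cell ≠ none ∨ (s.ops r).op = .pop →
      ((s.modOp r f).ops x).cell = (s.ops x).cell ∨ ((s.modOp r f).ops x).cell ≠ none ∨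
        (s.ops x).op = .pop := by
    intro r f hf
    by_cases e : x = r
    · subst e; right; simpa using hf
    · left; simp [e]
  have key' : ∀ (r : ℕ) (f : MultiOp N → MultiOp N), (f (s.ops r)).cell = (s.ops r).cell →
      ((s.modOp r f).ops x).cell = (s.ops x).cell := by
    intro r f hf
    by_cases e : x = r
    · subst e; simpa using hf
    · simp [e]
  unfold Step at h
  cases hpc : s.pc i <;> rw [hpc] at h hp
  case idle =>
    rcases h with rfl | ⟨d, rfl⟩ | rfl
    · exact .inl rfl
    · left; simp [invokePush, hx.ne]
    · left; simp [invokePop, hx.ne]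
  case elimCell m p a q =>
    have hrole : (s.conf lin del la lb).role i = .elimA m p a q := by simp [conf, hpc, roleOf]
    have hr := hI.rinv i
    rw [hrole] at hr
    obtain ⟨h1, -, h2⟩ := hr
    have h3 : (s.ops a).op = (s.ops m).op ∧ (s.ops q).op = (s.ops p).op := by
      rcases h2 with ⟨rfl, rfl, -⟩ | ⟨h2, h3⟩
      · exact ⟨rfl, rfl⟩
      · exact ⟨h1.kindA _ h2.head_mem, h1.kindB _ h3.head_mem⟩
    subst h
    split
    · rename_i e
      simp only [goto_ops]; exact key _ _ (.inr (h3.1.trans e))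
    · rename_i e
      simp only [goto_ops]
      refine key _ _ (.inr (h3.2.trans ?_))
      have h4 : (s.ops m).op ≠ (s.ops p).op := h1.ne
      cases e1 : (s.ops m).op <;> cases e2 : (s.ops p).op <;> simp_all
  case passiveCell m a =>
    subst h
    simp only [goto_ops]
    exact key _ _ (.inr hp.2)
  case popEmptyCell | popOwnCell => subst h; simp only [goto_ops]; exact key _ _ (.inl (by simp))
  case popGiveCell =>
    subst h
    split
    · exact .inl rfl
    · simp only [goto_ops]; exact key _ _ (.inl (by simp))
    · simp only [goto_ops]; exact key _ _ (.inl (by simp))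
  all_goals
    obtain ⟨_, rfl⟩ := h
    repeat' split
    all_goals try rw [startLoop_eq]
    all_goals first
      | exact .inl rfl
      | (simp only [goto_ops]; exact .inl (key' _ _ (by rfl)))

theorem Step.pushCells (h : Step i s s') (hb : Base s) (hI : (s.conf lin del la lb).Inv)
    (hc : PushCells s) : PushCells s' := by
  intro x hx ho
  by_cases hx' : x < s.numOps
  · rw [h.static.op x hx'] at ho
    rcases h.cell hb hI hx' with e | e | e
    · rw [e]; exact hc x hx' ho
    · exact e
    · rw [e] at ho; cases ho
  · have hst := h
    unfold Step at h
    cases hpc : s.pc i <;> rw [hpc] at h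
    case idle =>
      rcases h with rfl | ⟨d, rfl⟩ | rfl
      · exact (hx' hx).elim
      · have : x = s.numOps := by simp [invokePush] at hx; omega
        subst this
        simp [invokePush]
      · have : x = s.numOps := by simp [invokePop] at hx; omega
        subst this
        simp [invokePop] at ho
    all_goals
      exfalso
      revert hx
      obtain ⟨_, rfl⟩ := h
      repeat' split
      all_goals simpa [startLoop_eq] using hx'

theorem IsInitial.pushCells (h : s.IsInitial) : PushCells s := fun x hx => by
  rw [h.1] at hx; cases hx

theorem IsInitial.inv (h : s.IsInitial) :
    (s.conf (fun _ => False) (fun _ _ => False) (fun _ => []) (fun _ => [])).Inv := by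
  have hr : ∀ i, (s.conf (fun _ => False) (fun _ _ => False) (fun _ => []) (fun _ => [])).role i
      = .idle := by
    intro i; simp [conf, h.2.2.2.2.2.2 i, roleOf]
  refine ⟨fun i m e => ?_, fun i => ?_, fun i x hx => (List.not_mem_nil hx).elim, fun i x e => ?_,
    fun i => List.nodup_nil, fun i j x hx => (List.not_mem_nil hx).elim, fun x hx => hx.elim,
    fun d x hx => hx.elim⟩
  · rw [hr] at e; cases e
  · rw [hr]; exact ⟨rfl, rfl⟩
  · rw [hr] at e; cases e

/-- The length of the list of a thread that does not make the step remains unchanged. -/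
theorem Step.length (h : Step i s s') (hb : Base s) (hI : (s.conf lin del la lb).Inv) {j : Fin N}
    (hj : j ≠ i) {m : ℕ} (hm : (s.conf lin del la lb).role j = .free m) :
    (s'.ops m).length = (s.ops m).length := by
  have hop : ((s.conf lin del la lb).role j).op? = some m := by rw [hm]; rfl
  have hmj : (s.ops m).id = j := (hI.own j m hop).2
  have hmn : m < s.numOps := (hI.own j m hop).1
  have hheld : ∀ k, m ∉ (s.conf lin del la lb).la k ++ (s.conf lin del la lb).lb k := fun k =>
    hI.not_held_of_op (i := j) hop (by rw [hm]; simp)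
  have hgone : ¬ (s.conf lin del la lb).Gone m := hI.not_gone_of_active (i := j) hop
    (by rw [hm]; trivial)
  have own := hb.own i
  have hne : ∀ (r : ℕ) (f : MultiOp N → MultiOp N),
      m ≠ r ∨ (f (s.ops r)).length = (s.ops r).length →
      ((s.modOp r f).ops m).length = (s.ops m).length := by
    intro r f hf
    by_cases e : m = r
    · subst e; simpa using hf
    · simp [e]
  unfold Step at h
  cases hpc : s.pc i <;> rw [hpc] at h own
  case idle =>
    rcases h with rfl | ⟨d, rfl⟩ | rfl
    · rfl
    · simp [invokePush, hmn.ne]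
    · simp [invokePop, hmn.ne]
  case elimLengthP m' p a q =>
    have hrole : (s.conf lin del la lb).role i = .elimNext m' p a q := by simp [conf, hpc, roleOf]
    have hr := hI.rinv i
    rw [hrole] at hr
    subst h
    simp only [goto_ops]
    refine hne _ _ (.inl ?_)
    rintro rfl
    exact hgone hr.1.gone
  case residueLength m' src k =>
    have hrole : (s.conf lin del la lb).role i = .residue m' src k := by simp [conf, hpc, roleOf]
    have hr := hI.rinv i
    rw [hrole] at hr
    subst h
    simp only [goto_ops]
    refine hne _ _ (.inl ?_)
    rintro rfl
    exact hheld i hr.link.head_mem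
  case combineLength m' p =>
    subst h
    rw [startLoop_eq]
    simp only [goto_ops]
    refine hne _ _ (.inl ?_)
    rintro rfl
    exact hj (hmj.symm.trans (own m rfl).2)
  case elimLengthA m' p a q =>
    subst h
    simp only [goto_ops]
    refine hne _ _ (.inl ?_)
    rintro rfl
    exact hj (hmj.symm.trans (own m rfl).2)
  all_goals
    obtain ⟨_, rfl⟩ := h
    repeat' split
    all_goals try rw [startLoop_eq]
    all_goals first
      | rfl
      | (simp only [goto_ops]; exact hne _ _ (.inr (by rfl)))

/-- Only a successful CAS changes the pointer to the stack. -/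
theorem Step.centralStack (h : Step i s s') : s'.centralStack = s.centralStack ∨
    ∃ m, (s.pc i).op? = some m ∧ s.Linearizes i m ∧
      ((∃ top nTop, s.pc i = .popCas m top nTop) ∨ ∃ top, s.pc i = .pushCas m top) := by
  unfold Step at h
  cases hpc : s.pc i <;> rw [hpc] at h
  case idle => rcases h with rfl | ⟨d, rfl⟩ | rfl <;> exact .inl rfl
  case popCas m top nTop =>
    subst h
    split
    · exact .inr ⟨m, rfl, by simp only [Linearizes, hpc]; exact ⟨‹_›, 0, rfl⟩, .inl ⟨_, _, rfl⟩⟩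
    · exact .inl rfl
  case pushCas m top =>
    subst h
    split
    · exact .inr ⟨m, rfl, by simp only [Linearizes, hpc]; exact ⟨‹_›, 0, rfl⟩, .inr ⟨_, rfl⟩⟩
    · exact .inl rfl
  all_goals
    left
    obtain ⟨_, rfl⟩ := h
    repeat' split
    all_goals first
      | rfl
      | rw [startLoop_eq]; rfl

/-- Only a successful CAS of `collide` changes the array `collision`. -/
theorem Step.collision (h : Step i s s') : s'.collision = s.collision ∨
    ∃ m index him, s.pc i = .casCollision m index him ∧ s.collision index = him := by
  unfold Step at h
  cases hpc : s.pc i <;> rw [hpc] at h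
  case idle => rcases h with rfl | ⟨d, rfl⟩ | rfl <;> exact .inl rfl
  case casCollision m index him =>
    subst h
    split
    · exact .inr ⟨m, index, him, rfl, ‹_›⟩
    · exact .inl rfl
  all_goals
    left
    obtain ⟨_, rfl⟩ := h
    repeat' split
    all_goals first
      | rfl
      | rw [startLoop_eq]; rfl

theorem Step.pc_eq_idle (h : Step i s s') (hi : s'.pc i = .idle) :
    s.pc i = .idle ∨ ∃ m, s.pc i = .ret m := by
  cases hpc : s.pc i
  case idle => exact .inl rfl
  case ret m => exact .inr ⟨m, rfl⟩
  all_goals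
    exfalso
    unfold Step at h
    rw [hpc] at h
    obtain ⟨_, rfl⟩ := h
    revert hi
    repeat' split
    all_goals try rw [startLoop_eq]
    all_goals try simp only [goto_pc, Function.update_self]
    all_goals first
      | simp; done
      | simp [hpc]; done
      | (unfold loopPC; split <;> simp)

/-- The rank depends on the number of pending signals only in working roles, and on the field
`length` only in the loop of `cMultiPop`, where the role is `free`. Both data are protected from the
steps of other threads. -/
theorem rank_congr {len len' : ℕ → ℤ} {w w' : ℕ} {c : PC N} {op : ℕ → Kind} {loc : Option ℕ}
    (hw : (roleOf op loc c).Working → w' = w)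
    (hl : ∀ m, roleOf op loc c = .free m → len' m = len m) :
    rank len' w' c = rank len w c := by
  cases c with
  | popLoop m | popIncr m => simp only [rank, hl m rfl]
  | _ => first | rfl | (obtain rfl := hw trivial; rfl)

/-- Only the lines between the announcement and the reset of the entry have roles that depend on
`location` or on kinds, and these roles are not working. -/
theorem roleOf_working {op op' : ℕ → Kind} {loc loc' : Option ℕ} {c : PC N}
    (h : (roleOf op loc c).Working) : roleOf op' loc' c = roleOf op loc c := by
  have key : ∀ m, (if loc = some m then Role.free m
      else if loc.map op = some (op m) then .capt m else .gone m).Working → False := by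
    intro m h
    split at h
    · exact h
    · split at h <;> exact h
  cases c with
  | getIndex m | getHim m | casCollision m | getInfo m | casLocation m | delay m
  | casLocationDelayed m | passiveGet m => exact (key m h).elim
  | passiveReset m a =>
    simp only [roleOf] at h
    split at h <;> exact h.elim
  | _ => rfl

/-- Every operation that is linearized by a step is in the list of a free operation that is
linearized by this step. -/
theorem Linearizes.root (hb : Base s) (hI : (s.conf lin del la lb).Inv) {r : ℕ}
    (h : s.Linearizes i r) : ∃ k m, (s.conf lin del la lb).role k = .free m ∧ r ∈ m :: la k ∧
      (s.conf lin del la lb).Root m (la k) ∧ s.Linearizes i m := by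
  have list : ∀ {m}, (s.conf lin del la lb).role i = .free m → s.InList m r →
      r ∈ m :: la i ∧ (s.conf lin del la lb).Root m (la i) := by
    intro m hm hr
    have hri := hI.rinv i
    rw [hm] at hri
    exact ⟨(inList_iff hri.2.2.link).1 hr, hri.2.2⟩
  have hl := h
  unfold Linearizes at h
  split at h
  case h_1 m hpc =>
    have hm : (s.conf lin del la lb).role i = .free m := by simp [conf, hpc, roleOf]
    obtain ⟨h1, h2⟩ := list hm h.2
    exact ⟨i, m, hm, h1, h2, by simp only [Linearizes, hpc]; exact ⟨h.1, 0, rfl⟩⟩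
  case h_2 m top n hpc =>
    have hm : (s.conf lin del la lb).role i = .free m := by simp [conf, hpc, roleOf]
    obtain ⟨h1, h2⟩ := list hm h.2
    exact ⟨i, m, hm, h1, h2, by simp only [Linearizes, hpc]; exact ⟨h.1, 0, rfl⟩⟩
  case h_3 m top hpc =>
    have hm : (s.conf lin del la lb).role i = .free m := by simp [conf, hpc, roleOf]
    obtain ⟨h1, h2⟩ := list hm h.2
    exact ⟨i, m, hm, h1, h2, by simp only [Linearizes, hpc]; exact ⟨h.1, 0, rfl⟩⟩
  case h_4 m p hpc =>
    obtain ⟨h1, h2, k, x, y, h3, h4, h5⟩ := h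
    have hm : (s.conf lin del la lb).role i = .free m := by simp [conf, hpc, roleOf]
    have hp : (s.conf lin del la lb).role (s.ops p).id = .free p := by
      have := hb.announced h1 (fun x => (s.ops x).op) (some p)
      rw [if_pos rfl] at this
      rw [← this, ← h1]; rfl
    have hri := hI.rinv i
    have hrp := hI.rinv (s.ops p).id
    rw [hm] at hri
    rw [hp] at hrp
    have hlm : ∀ z, z = m ∨ z = p → s.Linearizes i z := by
      intro z hz
      simp only [Linearizes, hpc]
      exact ⟨h1, h2, 0, m, p, rfl, rfl, hz⟩
    rcases h5 with rfl | rfl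
    · exact ⟨i, m, hm, (inList_iff hri.2.2.link).1 ⟨k, h3⟩, hri.2.2, hlm _ (.inl rfl)⟩
    · exact ⟨_, p, hp, (inList_iff hrp.2.2.link).1 ⟨k, h4⟩, hrp.2.2, hlm _ (.inr rfl)⟩
  case h_5 => exact h.elim

end State
end DECS

/-! ### Executions: delegates, signals and release -/

namespace DECS
namespace Execution

variable {N : ℕ} {D : Type*} (e : Execution N D)

/-- The operation `x` has been linearized before time `t`. -/
def Lin (t x : ℕ) : Prop := ∃ u < t, e.LinearizedAt u x

theorem lin_succ (t x : ℕ) : e.Lin (t + 1) x ↔ e.Lin t x ∨ e.LinearizedAt t x := by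
  constructor
  · rintro ⟨u, hu, h⟩
    rcases Nat.lt_succ_iff_lt_or_eq.1 hu with hu | rfl
    exacts [.inl ⟨u, hu, h⟩, .inr h]
  · rintro (⟨u, hu, h⟩ | h)
    exacts [⟨u, hu.trans t.lt_succ_self, h⟩, ⟨t, t.lt_succ_self, h⟩]

theorem delegate_succ (t : ℕ) : e.Delegate (t + 1) =
    (e.st t).delegateStep (e.st (t + 1)) (e.sched t) (e.Delegate t) := by
  funext d r
  rw [Delegate]
  rfl

theorem base (t : ℕ) : (e.st t).Base := by
  induction t with
  | zero => exact e.initial.base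
  | succ t ih => exact (e.step t).base ih

/-- The lists of the threads throughout an execution. -/
structure Run (la lb : ℕ → Fin N → List ℕ) : Prop where
  inv : ∀ t, ((e.st t).conf (e.Lin t) (e.Delegate t) (la t) (lb t)).Inv
  trans : ∀ t, Conf.Trans (e.sched t) ((e.st t).conf (e.Lin t) (e.Delegate t) (la t) (lb t))
    ((e.st (t + 1)).conf (e.Lin (t + 1)) (e.Delegate (t + 1)) (la (t + 1)) (lb (t + 1)))
  advances : ∀ t, (e.st t).Advances (e.sched t) (e.st (t + 1))
    ((la t (e.sched t)).length + (lb t (e.sched t)).length)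
    ((la (t + 1) (e.sched t)).length + (lb (t + 1) (e.sched t)).length)

/-- The auxiliary lists are not part of the state. `Step.good` provides suitable lists after each
step, and they are chosen recursively along the execution. -/
theorem exists_run : ∃ la lb, e.Run la lb := by
  let P : ℕ → (Fin N → List ℕ) × (Fin N → List ℕ) → Prop := fun t p =>
    ((e.st t).conf (e.Lin t) (e.Delegate t) p.1 p.2).Inv ∧ (e.st t).PushCells
  let Q : ℕ → (Fin N → List ℕ) × (Fin N → List ℕ) → (Fin N → List ℕ) × (Fin N → List ℕ) → Prop :=
    fun t p q => Conf.Trans (e.sched t) ((e.st t).conf (e.Lin t) (e.Delegate t) p.1 p.2)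
        ((e.st (t + 1)).conf (e.Lin (t + 1)) (e.Delegate (t + 1)) q.1 q.2) ∧
      (e.st t).Advances (e.sched t) (e.st (t + 1))
        ((p.1 (e.sched t)).length + (p.2 (e.sched t)).length)
        ((q.1 (e.sched t)).length + (q.2 (e.sched t)).length)
  have h0 : P 0 (fun _ => [], fun _ => []) := by
    have h := e.initial.inv
    have h1 : e.Lin 0 = fun _ => False := by funext x; simp [Lin]
    have h2 : e.Delegate 0 = fun _ _ => False := rfl
    refine ⟨?_, e.initial.pushCells⟩
    rw [h1, h2]
    exact h
  have hs : ∀ t p, P t p → ∃ q, P (t + 1) q ∧ Q t p q := by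
    rintro t ⟨la, lb⟩ ⟨hI, hc⟩
    obtain ⟨la', lb', h1, h2, h3⟩ := (e.step t).good (e.base t) hc hI
    have hl : (fun x => e.Lin t x ∨ (e.st t).Linearizes (e.sched t) x) = e.Lin (t + 1) :=
      funext fun x => propext (e.lin_succ t x).symm
    rw [hl, ← e.delegate_succ] at h1 h2
    exact ⟨(la', lb'), ⟨h1, (e.step t).pushCells (e.base t) hI hc⟩, h2, h3⟩
  choose f hf hf' using hs
  let g : (t : ℕ) → {p // P t p} := fun t =>
    Nat.rec ⟨_, h0⟩ (fun t p => ⟨f t p.1 p.2, hf t p.1 p.2⟩) t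
  refine ⟨fun t => (g t).1.1, fun t => (g t).1.2, fun t => (g t).2.1, fun t => ?_, fun t => ?_⟩
  · exact (hf' t (g t).1 (g t).2).1
  · exact (hf' t (g t).1 (g t).2).2

variable {e} {i j : Fin N} {t r d : ℕ}

theorem pc_succ (hi : e.sched t ≠ i) : (e.st (t + 1)).pc i = (e.st t).pc i :=
  (e.step t).static.pc i hi.symm

theorem pc_eq_of_not_scheduled {u : ℕ} (htu : t ≤ u) (h : ∀ v, t ≤ v → v < u → e.sched v ≠ i) :
    (e.st u).pc i = (e.st t).pc i := by
  induction u, htu using Nat.le_induction with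
  | base => rfl
  | succ u htu ih =>
    rw [pc_succ (h u htu u.lt_succ_self), ih fun v h1 h2 => h v h1 (h2.trans u.lt_succ_self)]

theorem Fair.next (hfair : e.Fair) (i : Fin N) (t : ℕ) :
    ∃ u, t ≤ u ∧ e.sched u = i ∧ ∀ v, t ≤ v → v < u → e.sched v ≠ i := by
  classical
  have h := hfair i t
  refine ⟨Nat.find h, (Nat.find_spec h).1, (Nat.find_spec h).2, fun v h1 h2 h3 => ?_⟩
  exact Nat.find_min h h2 ⟨h1, h3⟩

namespace Run

variable {la lb : ℕ → Fin N → List ℕ} (R : e.Run la lb)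

variable (e la lb) in
/-- The configuration at time `t`. -/
abbrev cf (t : ℕ) : Conf N := (e.st t).conf (e.Lin t) (e.Delegate t) (la t) (lb t)

variable (e la lb) in
/-- The termination measure of thread `i` at time `t`. -/
def measure (t : ℕ) (i : Fin N) : ℕ × ℕ :=
  rank (fun m => ((e.st t).ops m).length) ((la t i).length + (lb t i).length) ((e.st t).pc i)

include R

theorem measure_succ (hi : e.sched t ≠ i) : measure e la lb (t + 1) i = measure e la lb t i := by
  unfold measure
  rw [pc_succ hi]
  refine State.rank_congr (op := fun x => ((e.st t).ops x).op) (loc := (e.st t).location i)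
    (fun hw => ?_) fun m hm => ?_
  · obtain ⟨h1, h2⟩ := (R.trans t).keep i hi.symm hw
    exact congrArg₂ (fun a b => a.length + b.length) h1 h2
  · exact (e.step t).length (e.base t) (R.inv t) hi.symm hm

theorem measure_eq {u : ℕ} (htu : t ≤ u) (h : ∀ v, t ≤ v → v < u → e.sched v ≠ i) :
    measure e la lb u i = measure e la lb t i := by
  induction u, htu using Nat.le_induction with
  | base => rfl
  | succ u htu ih =>
    rw [R.measure_succ (h u htu u.lt_succ_self), ih fun v h1 h2 => h v h1 (h2.trans u.lt_succ_self)]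

/-- An operation that is linearized has not been linearized before. -/
theorem not_lin (h : e.LinearizedAt t r) : ¬ e.Lin t r := by
  obtain ⟨k, m, h1, h2, h3, h4⟩ := h.root (e.base t) (R.inv t)
  exact h3.fresh r h2

theorem not_linearizedAt (h : e.LinearizedAt t r) : ∀ u < t, ¬ e.LinearizedAt u r :=
  fun u hu hl => R.not_lin h ⟨u, hu, hl⟩

theorem held_of_waiting (h : (e.st t).Waiting i r) : ∃ j, r ∈ la t j ++ lb t j :=
  (R.inv t).cover i r (by simp [State.conf, h.1, roleOf]) h.2

theorem delegate_of_waiting (h : (e.st t).Waiting i r) : ∃! d, e.Delegate t d r := by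
  obtain ⟨j, hj⟩ := R.held_of_waiting h
  obtain ⟨d, hd, -⟩ := (R.inv t).delegate hj
  exact ⟨d, (hd d).2 rfl, fun d' hd' => (hd d').1 hd'⟩

theorem not_waiting_delegate (hj : r ∈ la t j ++ lb t j) (hd : e.Delegate t d r) (k : Fin N) :
    ¬ (e.st t).Waiting k d := by
  intro h
  obtain ⟨k', hk'⟩ := R.held_of_waiting h
  exact (R.inv t).del_not_held (j := j) hj hd hk'

/-- The operation `r` lies in the list of a free operation that is linearized by the same step, and
this operation is the only delegate of the whole list. -/
theorem linearizedAt_delegate (hd : e.Delegate t d r)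
    (h : e.LinearizedAt t r) : e.LinearizedAt t d := by
  obtain ⟨k, m, h1, h2, h3, h4⟩ := h.root (e.base t) (R.inv t)
  rwa [(h3.del r h2 d).1 hd]

/-- Being a delegate of a held operation, `d` is not held itself, so it must be the free head of the
list that is linearized. Then `r` is in the list of this head, which is fresh. -/
theorem not_lin_of_delegate (hj : r ∈ la t j ++ lb t j) (hd : e.Delegate t d r)
    (h : e.LinearizedAt t d) : ¬ e.Lin t r := by
  obtain ⟨k, m, h1, h2, h3, h4⟩ := h.root (e.base t) (R.inv t)
  have hdm : d = m := by
    refine (List.mem_cons.1 h2).resolve_right fun h' => ?_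
    exact (R.inv t).del_not_held (j := j) hj hd (List.mem_append_left _ h' : d ∈ la t k ++ lb t k)
  subst hdm
  have hjk := (R.inv t).eq_of_free (j := j) hj h1 hd
  subst hjk
  have hr := (R.inv t).rinv j
  rw [h1] at hr
  have hlb : lb t j = [] := hr.1
  rw [hlb, List.append_nil] at hj
  exact h3.fresh r (List.mem_cons_of_mem _ hj)

/-- A step linearizes only members of lists with free heads, and by disjointness `r` is in no list
other than that of the working thread. -/
theorem not_linearizedAt_of_working (hw : ((cf e la lb t).role i).Working)
    (hr : r ∈ la t i ++ lb t i) : ¬ e.LinearizedAt t r := by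
  intro h
  obtain ⟨k, m, h1, h2, h3, h4⟩ := h.root (e.base t) (R.inv t)
  rcases List.mem_cons.1 h2 with rfl | h2
  · exact (R.inv t).not_held_of_op (i := k) (j := i) (by rw [h1]; rfl) (by rw [h1]; simp) hr
  · have : k = i := (R.inv t).disj k i r (List.mem_append_left _ h2) hr
    subst this
    have h1 : (cf e la lb t).role k = .free m := h1
    rw [h1] at hw
    exact hw

/-- The other alternatives of `Advances` are ruled out: a working thread neither waits nor tries to
enter `collision`, and an idle thread or one at the head of the loop is not working. -/
theorem working_step (hw : ((cf e la lb t).role i).Working) (hi : e.sched t = i)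
    (hw' : ((cf e la lb (t + 1)).role i).Working) :
    Prod.Lex (· < ·) (· < ·) (measure e la lb (t + 1) i) (measure e la lb t i) := by
  subst hi
  simp only [cf, State.conf] at hw hw'
  rcases R.advances t with h | h | ⟨m, h | h⟩ | ⟨m, h⟩ | ⟨m, index, him, h, -⟩ | h
  · rw [h] at hw; exact hw.elim
  · rw [h] at hw'; exact hw'.elim
  · rw [h] at hw'; exact hw'.elim
  · rw [h] at hw'; exact hw'.elim
  · rw [h.1] at hw; exact hw.elim
  · rw [h] at hw
    simp only [roleOf] at hw
    split at hw
    · exact hw.elim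
    · split at hw <;> exact hw.elim
  · exact h

/-- Until its next step, neither the role, the lists and the measure of a working thread nor the
linearization of the operations that it holds can change. -/
theorem working_next (hfair : e.Fair) (hw : ((cf e la lb t).role i).Working) :
    ∃ u, t ≤ u ∧ e.sched u = i ∧ (cf e la lb u).role i = (cf e la lb t).role i ∧
      la u i = la t i ∧ lb u i = lb t i ∧ measure e la lb u i = measure e la lb t i ∧
      ∀ r ∈ la t i ++ lb t i, e.Lin u r ↔ e.Lin t r := by
  obtain ⟨u, h1, h2, h3⟩ := hfair.next i t
  have key : ∀ v, t ≤ v → v ≤ u → (cf e la lb v).role i = (cf e la lb t).role i ∧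
      la v i = la t i ∧ lb v i = lb t i ∧ ∀ r ∈ la t i ++ lb t i, e.Lin v r ↔ e.Lin t r := by
    intro v hv
    induction v, hv using Nat.le_induction with
    | base => exact fun _ => ⟨rfl, rfl, rfl, fun _ _ => Iff.rfl⟩
    | succ v hv ih =>
      intro hvu
      obtain ⟨k1, k2, k3, k4⟩ := ih (by omega)
      have hs := h3 v hv hvu
      have hwv : ((cf e la lb v).role i).Working := by rw [k1]; exact hw
      obtain ⟨m1, m2⟩ := (R.trans v).keep i hs.symm hwv
      refine ⟨?_, m1.trans k2, m2.trans k3, fun r hr => ?_⟩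
      · rw [← k1]
        simp only [cf, State.conf, pc_succ hs]
        exact State.roleOf_working hwv
      · rw [e.lin_succ, k4 r hr]
        rw [← k2, ← k3] at hr
        simp [R.not_linearizedAt_of_working hwv hr]
  obtain ⟨k1, k2, k3, k4⟩ := key u h1 le_rfl
  exact ⟨u, h1, h2, k1, k2, k3, R.measure_eq h1 h3, k4⟩

/-- A thread that distributes results eventually signals to every operation in its lists. -/
theorem signals (hfair : e.Fair) (hw : ((cf e la lb t).role i).Working)
    (hr : r ∈ la t i ++ lb t i) : ∃ u ≥ t, (e.Lin t r ∧ e.SignalsAt u i .finished r) ∨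
      (¬ e.Lin t r ∧ ∃ h, e.SignalsAt u i .retry h ∧ e.Delegate (u + 1) h r) := by
  have wf : WellFounded (Prod.Lex (· < ·) (· < ·) : ℕ × ℕ → ℕ × ℕ → Prop) :=
    WellFounded.prod_lex wellFounded_lt wellFounded_lt
  generalize hμ : measure e la lb t i = μ
  induction μ using wf.induction generalizing t with
  | _ μ ih =>
  obtain ⟨u, h1, h2, h3, h4, h5, h6, h7⟩ := R.working_next hfair hw
  have hwu : ((cf e la lb u).role i).Working := by rw [h3]; exact hw
  have hru : r ∈ la u i ++ lb u i := by rw [h4, h5]; exact hr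
  have hinit := ((R.inv u).held i r hru).2.1
  subst h2
  -- Either `r` remains held by the working thread and the measure has decreased, or this step
  -- signals FINISHED to `r` or RETRY to its new delegate.
  rcases (R.trans u).serve hwu r hru with ⟨s1, s2⟩ | ⟨s1, s2⟩ | ⟨h, s1, s2, s3, s4⟩
  · have hlex := R.working_step hwu rfl s1
    rw [h6, hμ] at hlex
    obtain ⟨v, hv, hs⟩ := ih _ hlex s1 s2 rfl
    have hl : e.Lin (u + 1) r ↔ e.Lin t r := by
      rw [e.lin_succ, h7 r hr]
      simp [R.not_linearizedAt_of_working hwu hru]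
    rw [hl] at hs
    exact ⟨v, by omega, hs⟩
  · exact ⟨u, h1, .inl ⟨(h7 r hr).1 s2, rfl, hinit, s1⟩⟩
  · exact ⟨u, h1, .inr ⟨fun hl => s4 ((h7 r hr).2 hl), h, ⟨rfl, s1, s2⟩, s3⟩⟩

/-- By `linked`, the thread that linearizes `d` is responsible for `r` after the step, so `signals`
applies. As `r` was not linearized before, the case distinction made there is whether this very step
linearizes `r`. -/
theorem delegate_linearized (hfair : e.Fair) (h : (e.st t).Waiting i r) (hd : e.Delegate t d r)
    (hl : e.LinearizedAt t d) :
    (e.LinearizedAt t r ∧ ∃ u > t, e.SignalsAt u (e.sched t) .finished r) ∨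
      (¬ e.LinearizedAt t r ∧ ∃ u > t, ∃ h,
        e.SignalsAt u (e.sched t) .retry h ∧ e.Delegate (u + 1) h r) := by
  obtain ⟨j, hj⟩ := R.held_of_waiting h
  have hnr := R.not_lin_of_delegate hj hd hl
  obtain ⟨hw, hr⟩ := (R.trans t).linked j d r hj hd ⟨t, t.lt_succ_self, hl⟩ (R.not_lin hl)
  obtain ⟨u, hu, hs⟩ := R.signals hfair hw hr
  have hlr : e.Lin (t + 1) r ↔ e.LinearizedAt t r := by
    rw [e.lin_succ]; simp [hnr]
  rw [hlr] at hs
  refine hs.imp (fun h => ⟨h.1, u, by omega, h.2⟩) fun h => ⟨h.1, u, by omega, h.2⟩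

/-- A signalled operation is no longer held, so another thread can change its status only if it is
released already, and then only from FINISHED to FINISHED. -/
theorem status_succ (hi : e.sched t ≠ i)
    (hpc : (e.st t).pc i = .spin r ∨ (e.st t).pc i = .checkStatus r)
    (hs : ((e.st t).ops r).cStatus ≠ .init) :
    ((e.st (t + 1)).ops r).cStatus = ((e.st t).ops r).cStatus := by
  have hrole : (cf e la lb t).role i = .capt r ∨ (cf e la lb t).role i = .check r := by
    rcases hpc with h | h <;> simp [State.conf, h, roleOf]
  have hop : ((cf e la lb t).role i).op? = some r := by
    rcases hrole with h | h <;> rw [h] <;> rfl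
  obtain ⟨h1, h2⟩ := (R.inv t).own i r hop
  rcases (R.trans t).status r h1 with h | h | ⟨h, h'⟩ | h
  · exact h
  · exact (hs ((R.inv t).held _ r h).2.1).elim
  · have := h.2
    rw [h2] at this
    have h' : ((e.st (t + 1)).ops r).cStatus = .finished := h'
    rcases this hop with h | ⟨-, h⟩
    · rcases hrole with h3 | h3 <;> rw [h3] at h <;> cases h
    · exact h'.trans h.symm
  · exact (hi (h.symm.trans h2)).elim

theorem status_eq {u : ℕ} (htu : t ≤ u) (h : ∀ v, t ≤ v → v < u → e.sched v ≠ i)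
    (hpc : (e.st t).pc i = .spin r ∨ (e.st t).pc i = .checkStatus r)
    (hs : ((e.st t).ops r).cStatus ≠ .init) :
    ((e.st u).ops r).cStatus = ((e.st t).ops r).cStatus := by
  induction u, htu using Nat.le_induction with
  | base => rfl
  | succ u htu ih =>
    have h' : ∀ v, t ≤ v → v < u → e.sched v ≠ i := fun v h1 h2 => h v h1 (h2.trans u.lt_succ_self)
    have ih := ih h'
    rw [R.status_succ (h u htu u.lt_succ_self)
      (by rwa [pc_eq_of_not_scheduled htu h']) (by rwa [ih]),
      ih]

theorem released (hfair : e.Fair) (hpc : (e.st t).pc i = .spin r)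
    (hs : ((e.st t).ops r).cStatus ≠ .init) :
    ∃ u > t, e.sched u = i ∧ (e.st u).pc i = .checkStatus r ∧
      ((e.st u).ops r).cStatus = ((e.st t).ops r).cStatus := by
  obtain ⟨u, h1, h2, h3⟩ := hfair.next i t
  have p1 := pc_eq_of_not_scheduled h1 h3
  have s1 := R.status_eq h1 h3 (.inl hpc) hs
  have step := e.step u
  rw [hpc] at p1
  simp only [State.Step, h2, p1, ne_eq, s1, hs, not_false_eq_true, if_true] at step
  obtain ⟨v, k1, k2, k3⟩ := hfair.next i (u + 1)
  have p2 : (e.st (u + 1)).pc i = .checkStatus r := by rw [step]; simp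
  have s2 : ((e.st (u + 1)).ops r).cStatus = ((e.st t).ops r).cStatus := by
    rw [step]; exact s1
  refine ⟨v, by omega, k2, (pc_eq_of_not_scheduled k1 k3).trans p2, ?_⟩
  rw [R.status_eq k1 k3 (.inr p2) (by rwa [s2]), s2]

theorem released_finished (hfair : e.Fair) (hpc : (e.st t).pc i = .spin r)
    (hs : ((e.st t).ops r).cStatus = .finished) : ∃ u > t, e.CompletesAt u i r := by
  obtain ⟨u, h1, h2, h3, h4⟩ := R.released hfair hpc (by simp [hs])
  have step := e.step u
  simp only [State.Step, h2, h3, h4, hs, if_true] at step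
  obtain ⟨v, k1, k2, k3⟩ := hfair.next i (u + 1)
  refine ⟨v, by omega, k2, (pc_eq_of_not_scheduled k1 k3).trans ?_⟩
  rw [step]; simp

theorem iteration_delegate (h : (e.st t).pc i = .popTop r ∨ (e.st t).pc i = .pushTop r) :
    e.Delegate t r r := by
  have hrole : (cf e la lb t).role i = .free r := by
    rcases h with h | h <;> simp [State.conf, h, roleOf]
  have hr := (R.inv t).rinv i
  rw [hrole] at hr
  exact (hr.2.2.del r (by simp) r).2 rfl

theorem released_retry (hfair : e.Fair) (hpc : (e.st t).pc i = .spin r)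
    (hs : ((e.st t).ops r).cStatus = .retry) :
    ∃ u > t, e.IterationAt u i r ∧ e.Delegate u r r := by
  obtain ⟨u, h1, h2, h3, h4⟩ := R.released hfair hpc (by simp [hs])
  have step := e.step u
  simp only [State.Step, h2, h3, h4, hs, reduceCtorEq, if_false] at step
  obtain ⟨v, k1, k2, k3⟩ := hfair.next i (u + 1)
  have p2 : (e.st v).pc i = .setInit r := by
    rw [pc_eq_of_not_scheduled k1 k3, step]; simp
  have step' := e.step v
  simp only [State.Step, k2, p2, State.startLoop_eq] at step'
  obtain ⟨w, l1, l2, l3⟩ := hfair.next i (v + 1)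
  have p3 : (e.st w).pc i = .popTop r ∨ (e.st w).pc i = .pushTop r := by
    rw [pc_eq_of_not_scheduled l1 l3, step']
    simp only [State.goto_pc, Function.update_self]
    exact State.loopPC_eq _ _
  exact ⟨w, by omega, ⟨l2, p3⟩, R.iteration_delegate p3⟩

end Run
end Execution
end DECS

/-! ### Linearization in each iteration, and deadlock-freedom -/

namespace DECS

/-- The thread prepares a CAS on the pointer to the stack, with the old value `c`. -/
def PC.Attempt {N : ℕ} (c : Option ℕ) (r : ℕ) : PC N → Prop
  | .pushSetLast m x | .pushCas m x => m = r ∧ x = c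
  | .popInitNext m top | .popLoop m top _ _ | .popIncr m top _ _ | .popCas m top _ =>
      m = r ∧ c = some top
  | _ => False

namespace State

variable {N : ℕ} {D : Type*} {s s' : State N D} {i : Fin N}

theorem Step.attempt (h : Step i s s') {c : Option ℕ} {r : ℕ} (ha : (s.pc i).Attempt c r) :
    (s'.pc i).Attempt c r ∨ (∃ top nTop, s.pc i = .popCas r top nTop ∧ c = some top) ∨
      s.pc i = .pushCas r c := by
  unfold Step at h
  cases hpc : s.pc i <;> rw [hpc] at h ha
  case popCas => obtain ⟨rfl, rfl⟩ := ha; exact .inr (.inl ⟨_, _, rfl, rfl⟩)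
  case pushCas => obtain ⟨rfl, rfl⟩ := ha; exact .inr (.inr rfl)
  case popInitNext | popLoop | popIncr | pushSetLast =>
    left
    obtain ⟨_, rfl⟩ := h
    repeat' split
    all_goals simpa [PC.Attempt, hpc] using ha
  all_goals exact ha.elim

theorem Step.numOps (h : Step i s s') :
    s'.numOps = s.numOps ∨ s.pc i = .idle ∧ s'.pc i ≠ .idle := by
  unfold Step at h
  cases hpc : s.pc i <;> rw [hpc] at h
  case idle =>
    rcases h with rfl | ⟨d, rfl⟩ | rfl
    · exact .inl rfl
    · exact .inr ⟨rfl, by simp [invokePush]⟩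
    · exact .inr ⟨rfl, by simp [invokePop]⟩
  all_goals
    left
    obtain ⟨_, rfl⟩ := h
    repeat' split
    all_goals try rw [startLoop_eq]
    all_goals rfl

theorem Step.eq_of_waiting (h : Step i s s') {m : ℕ} (hw : s.Waiting i m) : s' = s := by
  simpa [Step, hw.1, hw.2] using h

theorem Step.pc_eq_casCollision (h : Step i s s') {m : ℕ} {index : Fin N} {him : Option (Fin N)}
    (hc : s'.pc i = .casCollision m index him) : him = s.collision index := by
  revert hc
  unfold Step at h
  cases hpc : s.pc i <;> rw [hpc] at h
  case idle =>
    rcases h with rfl | ⟨d, rfl⟩ | rfl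
    · simp [hpc]
    · simp [invokePush]
    · simp [invokePop]
  case getHim =>
    subst h
    simp only [goto_pc, Function.update_self, PC.casCollision.injEq]
    rintro ⟨-, rfl, rfl⟩
    rfl
  all_goals
    obtain ⟨_, rfl⟩ := h
    repeat' split
    all_goals try rw [startLoop_eq]
    all_goals try simp only [goto_pc, Function.update_self]
    all_goals first
      | simp; done
      | simp [hpc]; done
      | (unfold loopPC; split <;> simp)

end State

/-- A sequence that decreases or remains unchanged at each step is eventually constant. -/
theorem eventually_constant {α : Type*} {lt : α → α → Prop} (wf : WellFounded lt) (f : ℕ → α)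
    {T : ℕ} (h : ∀ t ≥ T, f (t + 1) = f t ∨ lt (f (t + 1)) (f t)) :
    ∃ T' ≥ T, ∀ t ≥ T', f t = f T' := by
  obtain ⟨a, ⟨T', h1, rfl⟩, h2⟩ := wf.has_min (f '' Set.Ici T) ⟨f T, T, le_refl T, rfl⟩
  refine ⟨T', h1, fun t ht => ?_⟩
  induction t, ht using Nat.le_induction with
  | base => rfl
  | succ t ht ih =>
    have hT : T ≤ t := le_trans h1 ht
    rcases h t hT with h | h
    · exact h.trans ih
    · rw [ih] at h
      exact (h2 _ ⟨t + 1, by simp; omega, rfl⟩ h).elim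

open Filter in
theorem eventually_or_of_mono {P : ℕ → Prop} {T : ℕ} (h : ∀ t ≥ T, P t → P (t + 1)) :
    (∀ᶠ t in atTop, P t) ∨ ∀ᶠ t in atTop, ¬ P t := by
  by_cases hP : ∃ t ≥ T, P t
  · obtain ⟨t, ht, hP⟩ := hP
    refine .inl (eventually_atTop.2 ⟨t, fun u hu => ?_⟩)
    induction u, hu using Nat.le_induction with
    | base => exact hP
    | succ u hu ih => exact h u (by omega) ih
  · push Not at hP
    exact .inr (eventually_atTop.2 ⟨T, hP⟩)

namespace Execution
namespace Run

variable {N : ℕ} {D : Type*} {e : Execution N D} {i j : Fin N} {t r d : ℕ}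
  {la lb : ℕ → Fin N → List ℕ} (R : e.Run la lb)

theorem lex_wf : WellFounded (Prod.Lex (· < ·) (· < ·) : ℕ × ℕ → ℕ × ℕ → Prop) :=
  WellFounded.prod_lex wellFounded_lt wellFounded_lt

include R

/-- Between reading `CentralStack` and the CAS no line waits or starts anew, so the measure
decreases until the CAS is reached. In particular the walk of `cMultiPop` ends, because no other
thread changes the `length` of a free operation. -/
theorem attempt_reaches (hfair : e.Fair) {c : Option ℕ} (ha : ((e.st t).pc i).Attempt c r) :
    ∃ u ≥ t, e.sched u = i ∧ (∀ v, t ≤ v → v ≤ u → ((e.st v).pc i).Attempt c r) ∧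
      ((∃ top nTop, (e.st u).pc i = .popCas r top nTop ∧ c = some top) ∨
        (e.st u).pc i = .pushCas r c) := by
  generalize hμ : measure e la lb t i = μ
  induction μ using lex_wf.induction generalizing t with
  | _ μ ih =>
  obtain ⟨u, h1, h2, h3⟩ := hfair.next i t
  have hpc : ∀ v, t ≤ v → v ≤ u → ((e.st v).pc i).Attempt c r := by
    intro v k1 k2
    rwa [pc_eq_of_not_scheduled k1 fun w l1 l2 => h3 w l1 (by omega)]
  have hu := hpc u h1 le_rfl
  subst h2
  rcases (e.step u).attempt hu with h | h
  · have hlex : Prod.Lex (· < ·) (· < ·) (measure e la lb (u + 1) (e.sched u))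
        (measure e la lb u (e.sched u)) := by
      rcases R.advances u with k | k | ⟨m, k | k⟩ | ⟨m, k⟩ | ⟨m, index, him, k, -⟩ | k
      · rw [k] at hu; exact hu.elim
      · rw [k] at h; exact h.elim
      · rw [k] at h; exact h.elim
      · rw [k] at h; exact h.elim
      · rw [k.1] at hu; exact hu.elim
      · rw [k] at hu; exact hu.elim
      · exact k
    rw [R.measure_eq h1 h3, hμ] at hlex
    obtain ⟨w, k1, k2, k3, k4⟩ := ih _ hlex h rfl
    refine ⟨w, by omega, k2, fun v l1 l2 => ?_, k4⟩
    by_cases l : v ≤ u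
    · exact hpc v l1 l
    · exact k3 v (by omega) l2
  · exact ⟨u, h1, rfl, hpc, h⟩

/-- The value of `CentralStack` at the CAS is compared with the value that was read. If they are
equal, the CAS succeeds and `r` is linearized. If they differ, some step in between changed the
pointer, and that step linearizes the operation of the thread that made it. -/
theorem iteration_linearizes (hfair : e.Fair) (h : e.IterationAt t i r) :
    ∃ t' j r', t ≤ t' ∧ e.SameIteration i t t' ∧ e.LinearizedAt t' r' ∧
      ((e.st t').pc j).op? = some r' ∧ ∀ u < t', ¬ e.LinearizedAt u r' := by
  obtain ⟨rfl, hpc⟩ := h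
  -- Reading null in `cMultiPop` is itself a linearization point; otherwise an attempt begins.
  by_cases hnow : (e.st t).pc (e.sched t) = .popTop r ∧ (e.st t).centralStack = none
  · have hl : e.LinearizedAt t r := by
      simp only [LinearizedAt, State.Linearizes, hnow.1]
      exact ⟨hnow.2, 0, rfl⟩
    exact ⟨t, e.sched t, r, le_rfl, fun u h1 h2 => by omega, hl, by rw [hnow.1]; rfl,
      R.not_linearizedAt hl⟩
  have hstep : ((e.st (t + 1)).pc (e.sched t)).Attempt (e.st t).centralStack r ∧
      (e.st (t + 1)).centralStack = (e.st t).centralStack := by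
    have step := e.step t
    rcases hpc with hpc | hpc
    · cases hc : (e.st t).centralStack with
      | none => exact (hnow ⟨hpc, hc⟩).elim
      | some top =>
        simp only [State.Step, hpc, hc] at step
        rw [step]
        simp [PC.Attempt, hc]
    · simp only [State.Step, hpc] at step
      rw [step]
      simp [PC.Attempt]
  obtain ⟨ha, hcs⟩ := hstep
  obtain ⟨u, h1, h2, h3, h4⟩ := R.attempt_reaches hfair ha
  have hsame : ∀ v ≤ u, e.SameIteration (e.sched t) t v := by
    intro v hv w k1 k2
    have := h3 w k1 (by omega)
    refine ⟨fun k => ?_, fun r' => ⟨fun k => ?_, fun k => ?_⟩⟩ <;>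
    · rw [k] at this; exact this
  by_cases hc : (e.st u).centralStack = (e.st t).centralStack
  · have hl : e.LinearizedAt u r := by
      unfold LinearizedAt
      rw [h2]
      rcases h4 with ⟨top, nTop, k1, k2⟩ | k1
      · simp only [State.Linearizes, k1]
        exact ⟨hc.trans k2, 0, rfl⟩
      · simp only [State.Linearizes, k1]
        exact ⟨hc, 0, rfl⟩
    refine ⟨u, e.sched t, r, by omega, hsame u le_rfl, hl, ?_, R.not_linearizedAt hl⟩
    rcases h4 with ⟨top, nTop, k1, k2⟩ | k1 <;> rw [k1] <;> rfl
  -- The step at time `t` only reads the pointer, so the change happens strictly between the reading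
  -- and the CAS.
  · have hex : ∃ v, t + 1 ≤ v ∧ v < u ∧ (e.st (v + 1)).centralStack ≠ (e.st v).centralStack := by
      by_contra hno
      push Not at hno
      apply hc
      have : ∀ v, t + 1 ≤ v → v ≤ u → (e.st v).centralStack = (e.st t).centralStack := by
        intro v hv
        induction v, hv using Nat.le_induction with
        | base => exact fun _ => hcs
        | succ v hv ih => exact fun hvu => (hno v hv (by omega)).trans (ih (by omega))
      exact this u h1 le_rfl
    obtain ⟨v, k1, k2, k3⟩ := hex
    obtain ⟨m, l1, l2, -⟩ := (e.step v).centralStack.resolve_left k3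
    exact ⟨v, e.sched v, m, by omega, hsame v k2.le, l2, l1, R.not_linearizedAt l2⟩

omit R in
theorem pending_succ {T : ℕ} (hno : ∀ t ≥ T, ∀ j r, ¬ e.CompletesAt t j r) (ht : T ≤ t)
    (hp : (e.st t).pc i ≠ .idle) : (e.st (t + 1)).pc i ≠ .idle := by
  intro h
  by_cases hi : e.sched t = i
  · subst hi
    obtain ⟨m, hm⟩ := ((e.step t).pc_eq_idle h).resolve_left hp
    exact hno t ht _ m ⟨rfl, hm⟩
  · rw [pc_succ hi] at h
    exact hp h

omit R in
theorem pending_of_le {T : ℕ} (hno : ∀ t ≥ T, ∀ j r, ¬ e.CompletesAt t j r) (ht : T ≤ t)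
    (hp : (e.st t).pc i ≠ .idle) {u : ℕ} (hu : t ≤ u) : (e.st u).pc i ≠ .idle := by
  induction u, hu using Nat.le_induction with
  | base => exact hp
  | succ u hu ih => exact pending_succ hno (ht.trans hu) ih

open Filter

section Quiescence

variable {T : ℕ} (hno : ∀ t ≥ T, ∀ j r, ¬ e.CompletesAt t j r) (hfair : e.Fair)

include hno

omit R in
-- Without completions a pending thread stays pending, so each of the finitely many threads changes
-- between idle and pending at most once more.
theorem eventually_idle_iff :
    ∀ᶠ t in atTop, ∀ i, ((e.st (t + 1)).pc i = .idle ↔ (e.st t).pc i = .idle) := by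
  refine eventually_all.2 fun i => ?_
  rcases eventually_or_of_mono (P := fun t => (e.st t).pc i ≠ .idle)
    fun t ht => pending_succ hno ht with h | h
  · filter_upwards [h, (tendsto_add_atTop_nat 1).eventually h] with t h1 h2
    exact iff_of_false h2 h1
  · filter_upwards [h, (tendsto_add_atTop_nat 1).eventually h] with t h1 h2
    exact iff_of_true (not_not.1 h2) (not_not.1 h1)

omit R in
-- An invocation would turn an idle thread into a pending one.
theorem exists_numOps : ∃ n, ∀ᶠ t in atTop, (e.st t).numOps = n := by
  obtain ⟨T', hT'⟩ := eventually_atTop.1 (eventually_idle_iff hno)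
  refine ⟨(e.st T').numOps, eventually_atTop.2 ⟨T', fun t ht => ?_⟩⟩
  induction t, ht using Nat.le_induction with
  | base => rfl
  | succ t ht ih =>
    rw [← ih]
    refine (e.step t).numOps.resolve_right fun h => ?_
    exact h.2 ((hT' t ht _).2 h.1)

/-- Finitely many operations exist in total, and each is linearized at most once. -/
theorem eventually_not_linearizedAt : ∀ᶠ t in atTop, ∀ r, ¬ e.LinearizedAt t r := by
  obtain ⟨n, hn⟩ := exists_numOps hno
  have h1 : ∀ r, ∀ᶠ t in atTop, ¬ e.LinearizedAt t r := by
    intro r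
    by_cases h : ∃ t, e.LinearizedAt t r
    · obtain ⟨t, h⟩ := h
      exact eventually_atTop.2 ⟨t + 1, fun u hu hl => R.not_linearizedAt hl t hu h⟩
    · push Not at h
      exact Eventually.of_forall h
  have h2 : ∀ᶠ t in atTop, ∀ r ∈ Finset.range n, ¬ e.LinearizedAt t r :=
    (eventually_all_finset _).2 fun r _ => h1 r
  filter_upwards [h2, (tendsto_add_atTop_nat 1).eventually hn] with t h2 hn r hl
  refine h2 r (Finset.mem_range.2 ?_) hl
  rw [← hn]
  exact (R.inv (t + 1)).linlt r ((e.lin_succ t r).2 (.inr hl))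

include hfair

/-- A thread at the head of the loop would, when scheduled, begin an iteration, and every iteration
contains a linearization. -/
theorem eventually_not_loop : ∀ᶠ t in atTop, ∀ i r,
    (e.st t).pc i ≠ .popTop r ∧ (e.st t).pc i ≠ .pushTop r := by
  obtain ⟨T', hT'⟩ := eventually_atTop.1 (R.eventually_not_linearizedAt hno)
  refine eventually_atTop.2 ⟨T', fun t ht i r => ?_⟩
  rw [← not_or]
  intro h
  obtain ⟨u, h1, h2, h3⟩ := hfair.next i t
  rw [← pc_eq_of_not_scheduled h1 h3] at h
  obtain ⟨t', j, r', k1, -, k2, -⟩ := R.iteration_linearizes hfair ⟨h2, h⟩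
  exact hT' t' (by omega) r' k2

/-- Eventually, each step is made by an idle or waiting thread, or fails to enter the array
`collision`, or makes progress. -/
theorem eventually_progress : ∀ᶠ t in atTop,
    ((e.st t).pc (e.sched t) = .idle ∧ (e.st (t + 1)).pc (e.sched t) = .idle) ∨
    (∃ r, (e.st t).Waiting (e.sched t) r) ∨
    (∃ m index him, (e.st t).pc (e.sched t) = .casCollision m index him ∧
      (e.st t).collision index ≠ him) ∨
    Prod.Lex (· < ·) (· < ·) (measure e la lb (t + 1) (e.sched t))
      (measure e la lb t (e.sched t)) := by
  filter_upwards [(tendsto_add_atTop_nat 1).eventually (R.eventually_not_loop hno hfair),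
    eventually_idle_iff hno] with t h1 h2
  rcases R.advances t with h | h | ⟨m, h | h⟩ | h | h | h
  · exact .inl ⟨h, (h2 _).2 h⟩
  · exact .inl ⟨(h2 _).1 h, h⟩
  · exact ((h1 _ m).1 h).elim
  · exact ((h1 _ m).2 h).elim
  · exact .inr (.inl h)
  · exact .inr (.inr (.inl h))
  · exact .inr (.inr (.inr h))

omit hno hfair R in
theorem measure_idle (h : (e.st t).pc i = .idle) : measure e la lb t i = (0, 0) := by
  unfold measure; rw [h]; rfl

omit hno hfair R in
theorem measure_waiting (h : (e.st t).Waiting i r) : measure e la lb t i = (4, 4) := by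
  unfold measure; rw [h.1]; rfl

omit hno hfair R in
theorem measure_casCollision {m : ℕ} {index : Fin N} {him : Option (Fin N)}
    (h : (e.st t).pc i = .casCollision m index him) : measure e la lb t i = (5, 6) := by
  unfold measure; rw [h]; rfl

omit hno hfair R in
theorem waiting_succ (h : (e.st t).Waiting (e.sched t) r) :
    (e.st (t + 1)).Waiting (e.sched t) r := by
  rwa [(e.step t).eq_of_waiting h]

/-- A successful CAS on `collision` takes the first component of the measure below 5. Since no
iteration begins any more, it never rises again, so each thread succeeds at most once more. -/
theorem exists_collision : ∃ C, ∀ᶠ t in atTop, (e.st t).collision = C := by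
  obtain ⟨T', hT'⟩ := eventually_atTop.1 (R.eventually_progress hno hfair)
  have h1 : ∀ᶠ t in atTop, ∀ i,
      (measure e la lb (t + 1) i).1 < 5 → (measure e la lb t i).1 < 5 := by
    refine eventually_all.2 fun i => ?_
    have hmono : ∀ t ≥ T', (measure e la lb t i).1 < 5 → (measure e la lb (t + 1) i).1 < 5 := by
      intro t ht h
      by_cases hi : e.sched t = i
      · subst hi
        rcases hT' t ht with k | ⟨r, k⟩ | ⟨m, index, him, k, -⟩ | k
        · rw [measure_idle k.2]; simp
        · rw [measure_waiting (waiting_succ k)]; simp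
        · rw [measure_casCollision k] at h; simp at h
        · rw [Prod.lex_def] at k; omega
      · rwa [R.measure_succ hi]
    rcases eventually_or_of_mono hmono with h | h
    · filter_upwards [h] with t h _ using h
    · filter_upwards [(tendsto_add_atTop_nat 1).eventually h] with t h1 h2 using (h1 h2).elim
  obtain ⟨T₁, hT₁⟩ := eventually_atTop.1 h1
  refine ⟨(e.st T₁).collision, eventually_atTop.2 ⟨T₁, fun t ht => ?_⟩⟩
  induction t, ht using Nat.le_induction with
  | base => rfl
  | succ t ht ih =>
    rw [← ih]
    refine (e.step t).collision.resolve_right ?_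
    rintro ⟨m, index, him, k1, k2⟩
    have step := e.step t
    simp only [State.Step, k1, k2, if_true] at step
    have := hT₁ t ht (e.sched t) (by
      unfold measure
      rw [step]
      simp only [State.goto_pc, Function.update_self]
      split <;> simp [rank])
    rw [measure_casCollision k1] at this
    simp at this

/-- Once `collision` is constant, a CAS on it can fail only because of a value read earlier. After
rereading, the value is correct, so a modified measure decreases at such failures too; it becomes
constant for each thread, and a thread that is not at rest would lower it. -/
theorem eventually_rests : ∀ᶠ t in atTop,
    (e.st t).pc (e.sched t) = .idle ∨ ∃ r, (e.st t).Waiting (e.sched t) r := by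
  classical
  obtain ⟨C, hC⟩ := R.exists_collision hno hfair
  let Bad : ℕ → Fin N → Prop := fun t i =>
    ∃ m index him, (e.st t).pc i = .casCollision m index him ∧ C index ≠ him
  -- A thread with an outdated value `him` is about to fall back to `getHim`, whose rank is `(5,
  -- 7)`; the value `(5, 8)` turns this step into a decrease.
  let f : Fin N → ℕ → ℕ × ℕ := fun i t => if Bad t i then (5, 8) else measure e la lb t i
  obtain ⟨T', hT'⟩ := eventually_atTop.1 ((R.eventually_progress hno hfair).and hC)
  have hstep : ∀ t ≥ T', ¬ ((e.st t).pc (e.sched t) = .idle ∨ ∃ r, (e.st t).Waiting (e.sched t) r) →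
      Prod.Lex (· < ·) (· < ·) (f (e.sched t) (t + 1)) (f (e.sched t) t) := by
    intro t ht hr
    obtain ⟨h1, h2⟩ := hT' t ht
    -- A value that has just been read agrees with the constant array, so no step creates a new
    -- outdated value.
    have hB : ¬ Bad (t + 1) (e.sched t) := by
      rintro ⟨m, index, him, k1, k2⟩
      exact k2 ((e.step t).pc_eq_casCollision k1 ▸ congrFun h2.symm index)
    simp only [f, if_neg hB]
    rcases h1 with k | k | ⟨m, index, him, k1, k2⟩ | k
    · exact (hr (.inl k.1)).elim
    · exact (hr (.inr k)).elim
    · rw [if_pos ⟨m, index, him, k1, h2 ▸ k2⟩]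
      have step := e.step t
      simp only [State.Step, k1, k2, if_false] at step
      unfold measure
      rw [step]
      simp [rank, Prod.lex_def]
    · split
      · rename_i hb
        obtain ⟨m, index, him, k1, -⟩ := hb
        rw [measure_casCollision k1] at k
        rw [Prod.lex_def] at k ⊢
        dsimp only at k ⊢
        omega
      · exact k
  have hrest : ∀ i, ∀ᶠ t in atTop, e.sched t = i →
      (e.st t).pc i = .idle ∨ ∃ r, (e.st t).Waiting i r := by
    intro i
    obtain ⟨T₁, h1, h2⟩ := eventually_constant lex_wf (f i) (T := T') (fun t ht => by
      by_cases hi : e.sched t = i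
      · subst hi
        by_cases hr : (e.st t).pc (e.sched t) = .idle ∨ ∃ r, (e.st t).Waiting (e.sched t) r
        · left
          rcases hr with k | ⟨r, k⟩
          · have k' : (e.st (t + 1)).pc (e.sched t) = .idle := by
              rcases (hT' t ht).1 with l | ⟨r, l⟩ | ⟨m, index, him, l, -⟩ | l
              · exact l.2
              · rw [l.1] at k; cases k
              · rw [l] at k; cases k
              · rw [measure_idle k, Prod.lex_def] at l; simp at l
            simp [f, Bad, k, k', measure_idle k, measure_idle k']
          · have k' := waiting_succ k
            simp [f, Bad, k.1, k'.1, measure_waiting k, measure_waiting k']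
        · exact .inr (hstep t ht hr)
      · left
        simp only [f, Bad, pc_succ hi, R.measure_succ hi])
    refine eventually_atTop.2 ⟨T₁, fun t ht hi => ?_⟩
    subst hi
    by_contra hr
    have := hstep t (by omega) hr
    rw [h2 t ht, h2 (t + 1) (by omega)] at this
    exact lex_wf.irrefl.irrefl _ this
  filter_upwards [eventually_all.2 hrest] with t h using h _ rfl

/-- A resting thread is responsible for nobody: its lists are empty if it is idle, and also if it is
captured with status INIT. But each waiting operation is in some list, so nobody waits. -/
theorem eventually_idle : ∀ᶠ t in atTop, ∀ i, (e.st t).pc i = .idle := by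
  obtain ⟨T', hT'⟩ := eventually_atTop.1 (R.eventually_rests hno hfair)
  refine eventually_atTop.2 ⟨T', fun t ht => ?_⟩
  have h1 : ∀ i, (e.st t).pc i = .idle ∨ ∃ r, (e.st t).Waiting i r := by
    intro i
    obtain ⟨u, k1, k2, k3⟩ := hfair.next i t
    have hpc := pc_eq_of_not_scheduled k1 k3
    have := hT' u (by omega)
    rw [k2, hpc] at this
    refine this.imp_right ?_
    rintro ⟨r, hw⟩
    have hpc' : (e.st t).pc i = .spin r := hpc ▸ hw.1
    refine ⟨r, hpc', ?_⟩
    -- A signalled status would persist until the next step of `i`, at which the thread is known to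
    -- be waiting.
    by_contra hs
    have := R.status_eq k1 k3 (.inl hpc') hs
    exact hs (this.symm.trans hw.2)
  have h2 : ∀ i, la t i ++ lb t i = [] := by
    intro i
    have hr := (R.inv t).rinv i
    rcases h1 i with h | ⟨r, h⟩
    · have hrole : (cf e la lb t).role i = .idle := by simp [State.conf, h, roleOf]
      rw [hrole] at hr
      have ha : la t i = [] := hr.1
      have hb : lb t i = [] := hr.2
      rw [ha, hb]; rfl
    · have hrole : (cf e la lb t).role i = .capt r := by simp [State.conf, h.1, roleOf]
      rw [hrole] at hr
      have ha : la t i = [] := hr.2.2 (by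
        show ((e.st t).ops r).cStatus ≠ .retry
        rw [h.2]; simp)
      have hb : lb t i = [] := hr.1
      rw [ha, hb]; rfl
  intro i
  refine (h1 i).resolve_right ?_
  rintro ⟨r, hw⟩
  obtain ⟨j, hj⟩ := R.held_of_waiting hw
  rw [h2] at hj
  cases hj

end Quiescence

theorem exists_completes (hfair : e.Fair) (hp : (e.st t).pc i ≠ .idle) :
    ∃ t' j r, t ≤ t' ∧ e.CompletesAt t' j r := by
  by_contra h
  push Not at h
  have hno : ∀ u ≥ t, ∀ j r, ¬ e.CompletesAt u j r := fun u hu j r => h u j r hu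
  obtain ⟨T, hT⟩ := eventually_atTop.1 (R.eventually_idle hno hfair)
  exact pending_of_le hno le_rfl hp (le_max_left t T) (hT _ (le_max_right t T) i)

/-- An operation that is never signalled waits forever. If only finitely many operations completed,
this would contradict the fact that eventually all threads are idle. -/
theorem signalled_or_completes (hfair : e.Fair) (hw : (e.st t).Waiting i r) :
    (∃ u ≥ t, ∃ j, e.SignalsAt u j .finished r ∨ e.SignalsAt u j .retry r) ∨
      ∀ T, ∃ t' j r', T ≤ t' ∧ e.CompletesAt t' j r' := by
  by_contra h
  push Not at h
  obtain ⟨h1, T, h2⟩ := h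
  have hno : ∀ u ≥ T, ∀ j r, ¬ e.CompletesAt u j r := fun u hu j r => h2 u j r hu
  have hwait : ∀ u ≥ t, (e.st u).Waiting i r := by
    intro u hu
    induction u, hu using Nat.le_induction with
    | base => exact hw
    | succ u hu ih =>
      refine ⟨?_, ?_⟩
      · by_cases hi : e.sched u = i
        · subst hi
          exact (waiting_succ ih).1
        · rw [pc_succ hi]; exact ih.1
      · obtain ⟨k1, k2⟩ := h1 u hu (e.sched u)
        cases hs : ((e.st (u + 1)).ops r).cStatus with
        | init => rfl
        | finished => exact (k1 ⟨rfl, ih.2, hs⟩).elim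
        | retry => exact (k2 ⟨rfl, ih.2, hs⟩).elim
  obtain ⟨T', hT'⟩ := eventually_atTop.1 (R.eventually_idle hno hfair)
  have := (hwait _ (le_max_left t T')).1
  rw [hT' _ (le_max_right t T') i] at this
  cases this

end Run
end Execution
end DECS

open DECS in
theorem mainTheorem3 {N : ℕ} {D : Type*} (e : Execution N D) (hfair : e.Fair) :
    -- deadlock-freedom: while some operation is pending, some operation completes later
    (∀ t i, (e.st t).pc i ≠ .idle → ∃ t' j r, t ≤ t' ∧ e.CompletesAt t' j r) ∧
    -- in each iteration of each operation, some pending operation is linearized (for the first time)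
    (∀ t i r, e.IterationAt t i r → ∃ t' j r', t ≤ t' ∧ e.SameIteration i t t' ∧
      e.LinearizedAt t' r' ∧ ((e.st t').pc j).op? = some r' ∧ ∀ u < t', ¬ e.LinearizedAt u r') ∧
    -- a waiting operation has exactly one delegate; it is linearized only together with the delegate,
    -- and the linearization of the delegate is followed by a signal of FINISHED to it, or of RETRY
    -- to it or to an operation that becomes its delegate, by the thread that made that step
    (∀ t i r, (e.st t).Waiting i r → ∃! d, e.Delegate t d r) ∧
    (∀ t i r d, (e.st t).Waiting i r → e.Delegate t d r →
      d ≠ r ∧ (∀ j, ¬ (e.st t).Waiting j d) ∧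
      (e.LinearizedAt t r → e.LinearizedAt t d) ∧
      (e.LinearizedAt t d →
        (e.LinearizedAt t r ∧ ∃ u > t, e.SignalsAt u (e.sched t) .finished r) ∨
        (¬ e.LinearizedAt t r ∧ ∃ u > t, ∃ h,
          e.SignalsAt u (e.sched t) .retry h ∧ e.Delegate (u + 1) h r))) ∧
    -- a signalled thread is released: it completes after FINISHED, and after RETRY it begins a new
    -- iteration as its own delegate
    (∀ t i r, (e.st t).pc i = .spin r →
      (((e.st t).ops r).cStatus = .finished → ∃ u > t, e.CompletesAt u i r) ∧
      (((e.st t).ops r).cStatus = .retry → ∃ u > t, e.IterationAt u i r ∧ e.Delegate u r r)) ∧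
    -- every waiting thread is eventually signalled, unless infinitely many operations complete
    (∀ t i r, (e.st t).Waiting i r →
      (∃ u ≥ t, ∃ j, e.SignalsAt u j .finished r ∨ e.SignalsAt u j .retry r) ∨
      ∀ T, ∃ t' j r', T ≤ t' ∧ e.CompletesAt t' j r') := by
  obtain ⟨la, lb, R⟩ := e.exists_run
  refine ⟨fun t i => R.exists_completes hfair, fun t i r => R.iteration_linearizes hfair,
    fun t i r => R.delegate_of_waiting, fun t i r d hw hd => ?_, fun t i r hpc =>
      ⟨R.released_finished hfair hpc, R.released_retry hfair hpc⟩,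
    fun t i r => R.signalled_or_completes hfair⟩
  obtain ⟨j, hj⟩ := R.held_of_waiting hw
  have hnw := R.not_waiting_delegate hj hd
  refine ⟨?_, hnw, R.linearizedAt_delegate hd, R.delegate_linearized hfair hw hd⟩
  rintro rfl
  exact hnw i hw
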